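/- **Setting.** There are $n\ge 1$ agents. Agent $i$ has sample losses $f_i(\cdot;\xi_{f,i})$, $g_i(\cdot;\xi_{g,i})$ on $\mathbb R^{d_x}\times\mathbb R^{d_y}$, differentiable for every sample, and $f_i=\mathbb E f_i(\cdot;\xi_{f,i})$, $g_i=\mathbb E g_i(\cdot;\xi_{g,i})$, $F=\frac1n\sum_i f_i$, $G=\frac1n\sum_i g_i$. For $\gamma>0$ put $$V_\gamma(x,y)=\min_\theta\Big\{G(x,\theta)+\tfrac1{2\gamma}\|\theta-y\|^2\Big\},\qquad \Psi_\mu=\mu F+G-V_\gamma,$$ and let $\theta^*_\gamma(x,y)$ be the minimizer. Assume: 1. $F\ge\underline F$; each $f_i$ is $C^1$ with $L_1$-Lipschitz gradient and each $g_i$ is $C^1$ with $L_2$-Lipschitz gradient in $(x,y)$, where $L_2>0$; and $0<\gamma<\frac1{2L_2}$. 2. $\nabla f_i(z;\xi_{f,i})$ and $\nabla g_i(z;\xi_{g,i})$ are unbiased for $\nabla f_i(z)$ and $\nabla g_i(z)$ with variances at most $\delta_f^2$ and $\delta_g^2$; the sample pairs $(\xi_{f,i}^k,\xi_{g,i}^k)$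 are independent over agents $i$ and iterations $k$, with the given marginal laws. 3. $W=(w_{ij})$ is non-negative, symmetric and doubly stochastic with eigenvalues $1=\lambda_1\ge\lambda_2\ge\dots\ge\lambda_n$ and $\rho=\max\{|\lambda_2|,|\lambda_n|\}<1$ ($\rho=0$ if $n=1$). Let $\mu_k=\mu_0(k+1)^{-p}$ with $\mu_0>0$, $p\in[0,\frac14)$, and, for a horizon $K\ge1$, constant rates $\lambda_\theta=c_\theta n^{1/2}K^{-1/2}$ and $\lambda_x=\lambda_y=c_\lambda\lambda_\theta$. At local variables $(x_i^k,y_i^k,\theta_i^k)$ agent $i$ computes $$\hat D_{\theta,i}^k=\nabla_y g_i(x_i^k,\theta_i^k;\xi_{g,i}^k)+\tfrac1\gamma(\theta_i^k-y_i^k),$$ $$\hat D_{x,i}^k=\mu_k\nabla_x f_i(x_i^k,y_i^k;\xi_{f,i}^k)+\nabla_x g_i(x_i^k,y_i^k;\xi_{g,i}^k)-\nabla_x g_i(x_i^k,\theta_i^k;\xi_{g,i}^k),$$ $$\hat D_{y,i}^k=\mu_k\nabla_y f_i(x_i^k,y_i^k;\xi_{f,i}^k)+\nabla_y g_i(x_i^k,y_i^k;\xi_{g,i}^k)-\tfrac1\gamma(y_i^k-\theta_i^k).$$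 For each $\Diamond\in\{x,y,\theta\}$ the update is $\Diamond_i^{k+1}=\sum_j w_{ij}(\Diamond_j^k-\lambda_\Diamond D_{\Diamond,j}^k)$. In SUN-DSBO-SE, $D^k=\hat D^k$. In SUN-DSBO-GT, $D_{\Diamond,i}^k=\sum_j w_{ij}(D_{\Diamond,j}^{k-1}+\hat D_{\Diamond,j}^k-\hat D_{\Diamond,j}^{k-1})$ with $D^{-1}=\hat D^{-1}=0$. The initial points are deterministic and bars denote averages over the agents. Write $\Delta^0=\frac1n\sum_i(\|x_i^0-\bar x^0\|^2+\|y_i^0-\bar y^0\|^2+\|\theta_i^0-\bar\theta^0\|^2)$, $$\Lambda^0=\mu_0\big(F(\bar x^0,\bar y^0)-\underline F\big)+G(\bar x^0,\bar y^0)-V_\gamma(\bar x^0,\bar y^0)+\|\bar\theta^0-\theta^*_\gamma(\bar x^0,\bar y^0)\|^2+\Delta^0,$$ $$T^0=\tfrac1n\sum_i\mathbb E\big(\|D_{x,i}^0-\bar D_x^0\|^2+\|D_{y,i}^0-\bar D_y^0\|^2+\|D_{\theta,i}^0-\bar D_\theta^0\|^2\big)\quad(D^0\text{ the initial trackers of GT}).$$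 **Statement.** There is $\bar c>0$ depending only on $L_2,\gamma$; for all $L_1\ge0$, $\mu_0$, $p$ and $0<c_\lambda\le\bar c$ there is $\bar\lambda>0$ depending only on $L_1,L_2,\gamma,\mu_0,p,c_\lambda$; and for every $c_\theta>0$ there is $A>0$ depending only on these quantities and $c_\theta$ (so not on $n$, $\rho$, $K$, the dimensions, the objectives, the initial points, or $\delta_f,\delta_g,\sigma_f,\sigma_g$), such that in every such problem the minimum defining $V_\gamma$ is attained, every $\Psi_\mu$ is differentiable, and the following hold. * **SUN-DSBO-SE.** Suppose in addition that $\frac1n\sum_i\|\nabla f_i-\nabla F\|^2\le\sigma_f^2$ and $\frac1n\sum_i\|\nabla g_i-\nabla G\|^2\le\sigma_g^2$ everywhere. If $\lambda_\theta\le\bar\lambda(1-\rho)$, then, with $\mathcal C_1=\Lambda^0+\delta_f^2+\delta_g^2$, $$\min_{\lfloor (K-1)/2\rfloor\le k\le K-1}\mathbb E\|\nabla\Psi_{\mu_k}(\bar x^k,\bar y^k)\|^2\le A\left(\frac{\mathcal C_1}{n^{1/2}K^{1/2}}+\frac{n(\delta_f^2+\delta_g^2)}{(1-\rho)^2K}+\frac{n(\sigma_f^2+\sigma_g^2)}{(1-\rho)^2K}\right).$$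 * **SUN-DSBO-GT.** If $\lambda_\theta\le\bar\lambda(1-\rho)^4$, then, with $\mathcal C_2=\Lambda^0+T^0+\delta_f^2+\delta_g^2$, $$\min_{\lfloor (K-1)/2\rfloor\le k\le K-1}\mathbb E\|\nabla\Psi_{\mu_k}(\bar x^k,\bar y^k)\|^2\le A\left(\frac{\mathcal C_2}{n^{1/2}K^{1/2}}+\frac{n(\delta_f^2+\delta_g^2)}{(1-\rho)^4K}\right).$$ * In both cases the expectations are finite, and there is $\hat k\in[\lfloor (K-1)/2\rfloor,K-1]$ such that $\mathbb E\|\nabla\Psi_{\mu_{\hat k}}(\bar x^{\hat k},\bar y^{\hat k})\|^2$ is at most the stated bound while $\mu_{\hat k}\le\mu_0(2/K)^p$. -/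

import Mathlib

open MeasureTheory ProbabilityTheory

noncomputable section

namespace SunDSBO

/-- `ℝ^d` with the Euclidean norm. -/
abbrev Vec (d : ℕ) : Type := EuclideanSpace ℝ (Fin d)

/-- `ℝ^dx × ℝ^dy` with the Euclidean norm; a point is a pair `(x, y)`. -/
abbrev Pair (dx dy : ℕ) : Type := WithLp 2 (Vec dx × Vec dy)

/-- The point `(x, y)`. -/
def pair {dx dy : ℕ} (x : Vec dx) (y : Vec dy) : Pair dx dy := WithLp.toLp 2 (x, y)

/-! ### The decentralized stochastic bilevel problem -/

/-- Agent `i` holds the sample losses `lossF i z s`, `s ∼ Df i`, and `lossG i z s`, `s ∼ Dg i`. -/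
structure Problem (n dx dy : ℕ) (Sf Sg : Type*) [MeasurableSpace Sf] [MeasurableSpace Sg] where
  Df : Fin n → Measure Sf
  Dg : Fin n → Measure Sg
  lossF : Fin n → Pair dx dy → Sf → ℝ
  lossG : Fin n → Pair dx dy → Sg → ℝ

/-- The expected loss `z ↦ 𝔼_{s ∼ D i} [loss i z s]` of agent `i`. -/
def expectedLoss {n dx dy : ℕ} {S : Type*} [MeasurableSpace S] (D : Fin n → Measure S)
    (loss : Fin n → Pair dx dy → S → ℝ) (i : Fin n) (z : Pair dx dy) : ℝ :=
  ∫ s, loss i z s ∂(D i)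

namespace Problem

variable {n dx dy : ℕ} {Sf Sg : Type*} [MeasurableSpace Sf] [MeasurableSpace Sg]

/-- Local upper-level objective `f_i`. -/
def f (P : Problem n dx dy Sf Sg) (i : Fin n) : Pair dx dy → ℝ := expectedLoss P.Df P.lossF i

/-- Local lower-level objective `g_i`. -/
def g (P : Problem n dx dy Sf Sg) (i : Fin n) : Pair dx dy → ℝ := expectedLoss P.Dg P.lossG i

/-- Global upper-level objective `F = (1/n) ∑ f_i`. -/
def F (P : Problem n dx dy Sf Sg) (z : Pair dx dy) : ℝ := (1 / (n : ℝ)) * ∑ i, P.f i z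

/-- Global lower-level objective `G = (1/n) ∑ g_i`. -/
def G (P : Problem n dx dy Sf Sg) (z : Pair dx dy) : ℝ := (1 / (n : ℝ)) * ∑ i, P.g i z

/-- The objective `θ ↦ G(x,θ) + ‖θ - y‖² / (2γ)` defining the Moreau envelope at `z = (x,y)`. -/
def proxObj (P : Problem n dx dy Sf Sg) (γ : ℝ) (z : Pair dx dy) (θ : Vec dy) : ℝ :=
  P.G (pair z.fst θ) + 1 / (2 * γ) * ‖θ - z.snd‖ ^ 2

/-- The Moreau envelope `V_γ(x,y) = min_θ {G(x,θ) + ‖θ - y‖² / (2γ)}`. -/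
def V (P : Problem n dx dy Sf Sg) (γ : ℝ) (z : Pair dx dy) : ℝ := ⨅ θ, P.proxObj γ z θ

/-- `θ*_γ(x,y)`, the minimizer in the definition of `V_γ(x,y)`. -/
def thetaStar (P : Problem n dx dy Sf Sg) (γ : ℝ) (z : Pair dx dy) : Vec dy :=
  Classical.epsilon fun θ => IsMinOn (P.proxObj γ z) Set.univ θ

/-- The penalty function `Ψ_m = m F + G - V_γ`. -/
def Psi (P : Problem n dx dy Sf Sg) (γ m : ℝ) (z : Pair dx dy) : ℝ :=
  m * P.F z + P.G z - P.V γ z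

end Problem

/-! ### Assumptions -/

section Assumptions

variable {n dx dy : ℕ} {Sf Sg : Type*} [MeasurableSpace Sf] [MeasurableSpace Sg]

/-- `h` is continuously differentiable with `L`-Lipschitz gradient. -/
structure IsSmooth (L : ℝ) (h : Pair dx dy → ℝ) : Prop where
  contDiff : ContDiff ℝ 1 h
  lipschitz : ∀ z w, ‖gradient h z - gradient h w‖ ≤ L * ‖z - w‖

/-- Smoothness: every `f_i` is `L₁`-smooth and every `g_i` is `L₂`-smooth. -/
structure Smoothness (P : Problem n dx dy Sf Sg) (L₁ L₂ : ℝ) : Prop where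
  f_smooth : ∀ i, IsSmooth L₁ (P.f i)
  g_smooth : ∀ i, IsSmooth L₂ (P.g i)

/-- Stochastic first-order oracle for one family of losses: the gradients of the sample losses are
unbiased estimators of the gradients of the expected losses, with variance at most `δ²`. -/
structure IsOracle {S : Type*} [MeasurableSpace S] (D : Fin n → Measure S)
    (loss : Fin n → Pair dx dy → S → ℝ) (δ : ℝ) : Prop where
  integrable_loss : ∀ i z, Integrable (loss i z) (D i)
  differentiable : ∀ i s, Differentiable ℝ fun z => loss i z s
  measurable_grad : ∀ i,
    Measurable fun q : Pair dx dy × S => gradient (fun z => loss i z q.2) q.1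
  integrable_grad : ∀ i z, Integrable (fun s => gradient (fun w => loss i w s) z) (D i)
  unbiased : ∀ i z,
    ∫ s, gradient (fun w => loss i w s) z ∂(D i) = gradient (expectedLoss D loss i) z
  integrable_sq : ∀ i z, Integrable
    (fun s => ‖gradient (expectedLoss D loss i) z - gradient (fun w => loss i w s) z‖ ^ 2) (D i)
  variance : ∀ i z,
    ∫ s, ‖gradient (expectedLoss D loss i) z - gradient (fun w => loss i w s) z‖ ^ 2 ∂(D i) ≤ δ ^ 2

/-- The samples `ξf i k`, `ξg i k` used by agent `i` at iteration `k` have laws `Df i`, `Dg i`, and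
the pairs `(ξf i k, ξg i k)` are independent over agents and iterations. -/
structure IsSampling {Ω : Type*} [MeasurableSpace Ω] (P : Problem n dx dy Sf Sg) (Pr : Measure Ω)
    (ξf : Fin n → ℕ → Ω → Sf) (ξg : Fin n → ℕ → Ω → Sg) : Prop where
  measurable_f : ∀ i k, Measurable (ξf i k)
  measurable_g : ∀ i k, Measurable (ξg i k)
  law_f : ∀ i k, Pr.map (ξf i k) = P.Df i
  law_g : ∀ i k, Pr.map (ξg i k) = P.Dg i
  indep : iIndepFun (fun (ik : Fin n × ℕ) ω => (ξf ik.1 ik.2 ω, ξg ik.1 ik.2 ω)) Pr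

/-- `max {|λ₂|, |λ_n|}`, i.e. the largest modulus of the eigenvalues of the symmetric matrix `W`
other than the first one, where `λ₁ ≥ λ₂ ≥ ⋯ ≥ λ_n`; it is `0` if `n = 1`. -/
def connectivity {W : Matrix (Fin n) (Fin n) ℝ} (hW : W.IsHermitian) : ℝ :=
  ⨆ j : {j : Fin (Fintype.card (Fin n)) // 1 ≤ (j : ℕ)}, |hW.eigenvalues₀ j|

/-- Gradient dissimilarity of the upper- and lower-level objectives over the agents. -/
structure Dissimilarity (P : Problem n dx dy Sf Sg) (σf σg : ℝ) : Prop where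
  upper : ∀ z, (1 / (n : ℝ)) * ∑ i, ‖gradient (P.f i) z - gradient P.F z‖ ^ 2 ≤ σf ^ 2
  lower : ∀ z, (1 / (n : ℝ)) * ∑ i, ‖gradient (P.g i) z - gradient P.G z‖ ^ 2 ≤ σg ^ 2

end Assumptions

/-! ### The algorithms -/

/-- A triple `(x_i, y_i, θ_i)` of vectors for every agent (local variables or directions). -/
@[ext] structure Vars (n dx dy : ℕ) where
  x : Fin n → Vec dx
  y : Fin n → Vec dy
  θ : Fin n → Vec dy

section Algorithms

variable {n dx dy : ℕ} {Sf Sg : Type*} [MeasurableSpace Sf] [MeasurableSpace Sg]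

/-- Average over the agents. -/
def avg {d : ℕ} (v : Fin n → Vec d) : Vec d := (1 / (n : ℝ)) • ∑ i, v i

namespace Vars

/-- One round of communication: `v_i ↦ ∑_j w_ij v_j`. -/
def mix (W : Matrix (Fin n) (Fin n) ℝ) (v : Vars n dx dy) : Vars n dx dy where
  x i := ∑ j, W i j • v.x j
  y i := ∑ j, W i j • v.y j
  θ i := ∑ j, W i j • v.θ j

/-- `v - λ D`, with step `lx` for `x` and `y` and step `lθ` for `θ`. -/
def descend (lx lθ : ℝ) (v D : Vars n dx dy) : Vars n dx dy where
  x i := v.x i - lx • D.x i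
  y i := v.y i - lx • D.y i
  θ i := v.θ i - lθ • D.θ i

/-- All components are zero. -/
def zero (n dx dy : ℕ) : Vars n dx dy where
  x _ := 0
  y _ := 0
  θ _ := 0

/-- `a + b - c`. -/
def addSub (a b c : Vars n dx dy) : Vars n dx dy where
  x i := a.x i + b.x i - c.x i
  y i := a.y i + b.y i - c.y i
  θ i := a.θ i + b.θ i - c.θ i

/-- The averaged pair `(x̄, ȳ)`. -/
def mean (v : Vars n dx dy) : Pair dx dy := pair (avg v.x) (avg v.y)

/-- `(1/n) ∑_i (‖x_i - x̄‖² + ‖y_i - ȳ‖² + ‖θ_i - θ̄‖²)`. -/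
def disagreement (v : Vars n dx dy) : ℝ :=
  (1 / (n : ℝ)) *
    ∑ i, (‖v.x i - avg v.x‖ ^ 2 + ‖v.y i - avg v.y‖ ^ 2 + ‖v.θ i - avg v.θ‖ ^ 2)

end Vars

/-- The stochastic directions `D̂_x`, `D̂_y`, `D̂_θ` of all agents at the local variables `v`, with
penalty parameter `m` and samples `sf i`, `sg i`. -/
def direction (P : Problem n dx dy Sf Sg) (γ m : ℝ) (sf : Fin n → Sf) (sg : Fin n → Sg)
    (v : Vars n dx dy) : Vars n dx dy where
  x i := m • (gradient (fun z => P.lossF i z (sf i)) (pair (v.x i) (v.y i))).fst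
    + (gradient (fun z => P.lossG i z (sg i)) (pair (v.x i) (v.y i))).fst
    - (gradient (fun z => P.lossG i z (sg i)) (pair (v.x i) (v.θ i))).fst
  y i := m • (gradient (fun z => P.lossF i z (sf i)) (pair (v.x i) (v.y i))).snd
    + (gradient (fun z => P.lossG i z (sg i)) (pair (v.x i) (v.y i))).snd
    - (1 / γ) • (v.y i - v.θ i)
  θ i := (gradient (fun z => P.lossG i z (sg i)) (pair (v.x i) (v.θ i))).snd
    + (1 / γ) • (v.θ i - v.y i)

/-- SUN-DSBO-SE with penalties `μ k`, steps `lx k` (for `x` and `y`), `lθ k` (for `θ`), initial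
local variables `init`, along the samples `sf i k`, `sg i k`: the local variables at time `k`. -/
def seIter (P : Problem n dx dy Sf Sg) (γ : ℝ) (μ lx lθ : ℕ → ℝ) (W : Matrix (Fin n) (Fin n) ℝ)
    (init : Vars n dx dy) (sf : Fin n → ℕ → Sf) (sg : Fin n → ℕ → Sg) : ℕ → Vars n dx dy
  | 0 => init
  | k + 1 =>
    let v := seIter P γ μ lx lθ W init sf sg k
    Vars.mix W (Vars.descend (lx k) (lθ k) v
      (direction P γ (μ k) (fun i => sf i k) (fun i => sg i k) v))

/-- State of SUN-DSBO-GT before iteration `k`: local variables at time `k`, and the trackers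
`D^{k-1}` and stochastic directions `D̂^{k-1}` of the preceding iteration. -/
structure GTState (n dx dy : ℕ) where
  vars : Vars n dx dy
  D : Vars n dx dy
  Dhat : Vars n dx dy

/-- SUN-DSBO-GT, with the same parameters as `seIter`. -/
def gtState (P : Problem n dx dy Sf Sg) (γ : ℝ) (μ lx lθ : ℕ → ℝ) (W : Matrix (Fin n) (Fin n) ℝ)
    (init : Vars n dx dy) (sf : Fin n → ℕ → Sf) (sg : Fin n → ℕ → Sg) : ℕ → GTState n dx dy
  | 0 => ⟨init, Vars.zero n dx dy, Vars.zero n dx dy⟩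
  | k + 1 =>
    let s := gtState P γ μ lx lθ W init sf sg k
    let Dhat := direction P γ (μ k) (fun i => sf i k) (fun i => sg i k) s.vars
    let D := Vars.mix W (Vars.addSub s.D Dhat s.Dhat)
    ⟨Vars.mix W (Vars.descend (lx k) (lθ k) s.vars D), D, Dhat⟩

/-- The local variables of SUN-DSBO-GT at time `k`. -/
def gtIter (P : Problem n dx dy Sf Sg) (γ : ℝ) (μ lx lθ : ℕ → ℝ) (W : Matrix (Fin n) (Fin n) ℝ)
    (init : Vars n dx dy) (sf : Fin n → ℕ → Sf) (sg : Fin n → ℕ → Sg) (k : ℕ) : Vars n dx dy :=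
  (gtState P γ μ lx lθ W init sf sg k).vars

/-- The initial trackers `D^0 = W D̂^0` of SUN-DSBO-GT. -/
def initialTracker (P : Problem n dx dy Sf Sg) (γ m : ℝ) (W : Matrix (Fin n) (Fin n) ℝ)
    (init : Vars n dx dy) (sf : Fin n → Sf) (sg : Fin n → Sg) : Vars n dx dy :=
  Vars.mix W (direction P γ m sf sg init)

/-- `initialTracker` is the tracker that SUN-DSBO-GT computes in its first iteration. -/
theorem gtState_one_D (P : Problem n dx dy Sf Sg) (γ : ℝ) (μ lx lθ : ℕ → ℝ)
    (W : Matrix (Fin n) (Fin n) ℝ) (init : Vars n dx dy) (sf : Fin n → ℕ → Sf)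
    (sg : Fin n → ℕ → Sg) :
    (gtState P γ μ lx lθ W init sf sg 1).D
      = initialTracker P γ (μ 0) W init (fun i => sf i 0) (fun i => sg i 0) := by
  simp [gtState, initialTracker, Vars.addSub, Vars.zero]

/-! ### Parameters and error measures -/

/-- Penalty parameters `μ_k = μ₀ (k+1)^{-p}`. -/
def penalty (μ₀ p : ℝ) (k : ℕ) : ℝ := μ₀ * ((k : ℝ) + 1) ^ (-p)

/-- The learning rate `c_θ n^{1/2} K^{-1/2}`. -/
def rate (cθ : ℝ) (n K : ℕ) : ℝ := cθ * Real.sqrt n / Real.sqrt K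

/-- The late iterations `⌊(K-1)/2⌋, …, K-1`. -/
def lateIters (K : ℕ) : Finset ℕ := Finset.Icc ((K - 1) / 2) (K - 1)

theorem lateIters_nonempty (K : ℕ) : (lateIters K).Nonempty :=
  Finset.nonempty_Icc.mpr (Nat.div_le_self _ _)

/-- `‖∇Ψ_m(z)‖²`. -/
def statSq (P : Problem n dx dy Sf Sg) (γ m : ℝ) (z : Pair dx dy) : ℝ :=
  ‖gradient (P.Psi γ m) z‖ ^ 2

/-- The initial error
`μ₀ (F(x̄⁰,ȳ⁰) - Flow) + G(x̄⁰,ȳ⁰) - V_γ(x̄⁰,ȳ⁰) + ‖θ̄⁰ - θ*_γ(x̄⁰,ȳ⁰)‖² + Δ⁰`. -/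
def initialError (P : Problem n dx dy Sf Sg) (γ μ₀ Flow : ℝ) (init : Vars n dx dy) : ℝ :=
  μ₀ * (P.F init.mean - Flow) + P.G init.mean - P.V γ init.mean
    + ‖avg init.θ - P.thetaStar γ init.mean‖ ^ 2 + init.disagreement

/-- `𝓒₁ / (n^{1/2} K^{1/2}) + n(δf² + δg²) / ((1-ρ)² K) + n(σf² + σg²) / ((1-ρ)² K)`. -/
def seBound (n K : ℕ) (ρ C₁ δf δg σf σg : ℝ) : ℝ :=
  C₁ / (Real.sqrt n * Real.sqrt K) + n * (δf ^ 2 + δg ^ 2) / ((1 - ρ) ^ 2 * K)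
    + n * (σf ^ 2 + σg ^ 2) / ((1 - ρ) ^ 2 * K)

/-- `𝓒₂ / (n^{1/2} K^{1/2}) + n(δf² + δg²) / ((1-ρ)⁴ K)`. -/
def gtBound (n K : ℕ) (ρ C₂ δf δg : ℝ) : ℝ :=
  C₂ / (Real.sqrt n * Real.sqrt K) + n * (δf ^ 2 + δg ^ 2) / ((1 - ρ) ^ 4 * K)

/-- For the random averaged iterates `z k ω`: the minimum over the late iterations of
`𝔼 ‖∇Ψ_{μ_k}(z k)‖²` is at most `B`; and some late iterate, whose penalty parameter is at most
`μ₀ (2/K)^p`, attains `𝔼 ‖∇Ψ_{μ_k}(z k)‖² ≤ B`. All expectations are finite. -/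
def LateStationary {Ω : Type*} [MeasurableSpace Ω] (Pr : Measure Ω) (P : Problem n dx dy Sf Sg)
    (γ μ₀ p : ℝ) (K : ℕ) (z : ℕ → Ω → Pair dx dy) (B : ℝ) : Prop :=
  (∀ k ∈ lateIters K, Integrable (fun ω => statSq P γ (penalty μ₀ p k) (z k ω)) Pr) ∧
  (lateIters K).inf' (lateIters_nonempty K)
      (fun k => ∫ ω, statSq P γ (penalty μ₀ p k) (z k ω) ∂Pr) ≤ B ∧
  ∃ k ∈ lateIters K, ∫ ω, statSq P γ (penalty μ₀ p k) (z k ω) ∂Pr ≤ B ∧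
    penalty μ₀ p k ≤ μ₀ * (2 / (K : ℝ)) ^ p

end Algorithms

end SunDSBO

end

noncomputable section
set_option linter.unusedSectionVars false
namespace SunDSBO

/-! Collect the variables of one agent into a state w = (x, y, θ) and scale the x and y directions
by c = c_λ. Both methods then become decentralized stochastic iterations with the single step λ_θ
and Lipschitz fields b k i. The proof rests on a potential of the averaged state: m (F - Flow) + (G
- V_γ) plus the gap of θ in the minimization that defines V_γ. Put a = ∇Ψ_m, let e be the error made
in ∇V_γ by using θ instead of θ*, and let h be the gradient of the θ-problem at θ. The averaged
field is (c (a + e), h), while the gradient of the potential is (a - e, h). Their inner product is c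
(‖a‖² - ‖e‖²) + ‖h‖², without cross terms. Since γ < 1/(2 L₂), the θ-problem is strongly convex, so
‖h‖ bounds a multiple of ‖θ - θ*‖ from above, whereas ‖e‖ is at most a multiple of ‖θ - θ*‖. For c
small in terms of L₂ and γ alone, the error is absorbed and the potential decreases at the rate of
the residual ‖∇Ψ_m‖² + ‖θ - θ*‖² (`landscape`). The potential is nonnegative, and nonincreasing in k
because F ≥ Flow and μ_k decreases. Hence no estimate divides by μ_k.

`Landscape` records what the rest of the argument needs. Descent at the averaged state
(`Landscape.descent_step`) costs the disagreement of the agents and the noise. In SE the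
disagreement contracts with factor ρ and is driven by gradient dissimilarity and noise
(`Landscape.path_bound_se`). In GT the trackers average to the directions, so the dissimilarity
drops out except where μ_k changes: there the difference μ_{k+1} - μ_k multiplies the upper-level
heterogeneity, for which no bound is assumed. That difference is at most μ₀/(k+2), and the
heterogeneity grows only as fast as the averaged state moves, so a weighted telescoping sum bounds
its total effect by its initial value and the squared increments (`sum_heterogeneity_le`). The
initial value is recovered from the initial trackers by a linear map that cancels the lower-level
part (`initial_heterogeneity_le`). This explains the presence of T⁰ and the absence of σ_f, σ_g in
the GT bound (`Landscape.path_bound_gt`).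

These inequalities hold along each sample path. In expectation the products of gradient and noise
vanish, as fresh samples are independent of the past, and the averaged noise has variance at most
v/n (`IsNoise.mean_sq`). This bounds the sum of the expected residuals over K iterations. At least
K/2 of the indices are late, so some late iterate is at most twice the average (`exists_late_le`),
and the choice of the rate turns this into the stated bounds (`exists_late_bound`). -/

/-! ### Averages, deviations and mixing -/

section Consensus

variable {n : ℕ} {H : Type*} [NormedAddCommGroup H] [InnerProductSpace ℝ H]

/-- Average over the agents. -/
def mean (v : Fin n → H) : H := (1 / (n : ℝ)) • ∑ i, v i

/-- Mean square over the agents. -/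
def msq (v : Fin n → H) : ℝ := (1 / (n : ℝ)) * ∑ i, ‖v i‖ ^ 2

/-- Mean square deviation from the average. -/
def dev (v : Fin n → H) : ℝ := msq fun i => v i - mean v

/-- One round of communication. -/
def mixing (W : Matrix (Fin n) (Fin n) ℝ) (v : Fin n → H) : Fin n → H := fun i => ∑ j, W i j • v j

theorem msq_nonneg (v : Fin n → H) : 0 ≤ msq v := by unfold msq; positivity

theorem dev_nonneg (v : Fin n → H) : 0 ≤ dev v := msq_nonneg _

theorem msq_le_msq {H' : Type*} [NormedAddCommGroup H'] [InnerProductSpace ℝ H']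
    {u : Fin n → H} {v : Fin n → H'} {c : ℝ}
    (h : ∀ i, ‖u i‖ ^ 2 ≤ c * ‖v i‖ ^ 2) : msq u ≤ c * msq v := by
  unfold msq
  calc (1 / (n : ℝ)) * ∑ i, ‖u i‖ ^ 2 ≤ (1 / (n : ℝ)) * ∑ i, c * ‖v i‖ ^ 2 := by
        gcongr with i; exact h i
    _ = _ := by rw [← Finset.mul_sum]; ring

theorem mean_add (u v : Fin n → H) : mean (fun i => u i + v i) = mean u + mean v := by
  simp [mean, Finset.sum_add_distrib]

theorem mean_sub (u v : Fin n → H) : mean (fun i => u i - v i) = mean u - mean v := by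
  simp [mean, Finset.sum_sub_distrib, smul_sub]

theorem mean_smul (c : ℝ) (v : Fin n → H) : mean (fun i => c • v i) = c • mean v := by
  simp only [mean, ← Finset.smul_sum]; rw [smul_comm]

theorem mean_map {H' : Type*} [NormedAddCommGroup H'] [InnerProductSpace ℝ H'] (A : H →ₗ[ℝ] H')
    (v : Fin n → H) : mean (fun i => A (v i)) = A (mean v) := by
  simp [mean, map_sum]

theorem mean_const (hn : 0 < n) (c : H) : mean (fun _ : Fin n => c) = c := by
  have : (n : ℝ) ≠ 0 := by positivity
  simp only [mean, Finset.sum_const, Finset.card_univ, Fintype.card_fin]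
  rw [← Nat.cast_smul_eq_nsmul ℝ, smul_smul, one_div, inv_mul_cancel₀ this, one_smul]

theorem sum_eq_smul_mean (hn : 0 < n) (v : Fin n → H) : ∑ i, v i = (n : ℝ) • mean v := by
  have : (n : ℝ) ≠ 0 := by positivity
  simp [mean, smul_smul, this]

theorem msq_const (hn : 0 < n) (c : H) : msq (fun _ : Fin n => c) = ‖c‖ ^ 2 := by
  have : (n : ℝ) ≠ 0 := by positivity
  simp [msq, this]

/-- Bias-variance decomposition: the deviations sum to zero, so the cross term vanishes. -/
theorem msq_eq_dev_add (hn : 0 < n) (v : Fin n → H) (c : H) :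
    msq (fun i => v i - c) = dev v + ‖mean v - c‖ ^ 2 := by
  have hn' : (n : ℝ) ≠ 0 := by positivity
  have h0 : ∑ i, (v i - mean v) = 0 := by
    rw [Finset.sum_sub_distrib, sum_eq_smul_mean hn]
    simp [← Nat.cast_smul_eq_nsmul ℝ]
  have h1 : ∑ i, ‖v i - c‖ ^ 2 = ∑ i, (‖v i - mean v‖ ^ 2
      + 2 * inner ℝ (v i - mean v) (mean v - c) + ‖mean v - c‖ ^ 2) := by
    refine Finset.sum_congr rfl fun i _ => ?_
    rw [← norm_add_sq_real]; congr 2; abel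
  unfold dev msq
  rw [h1, Finset.sum_add_distrib, Finset.sum_add_distrib, ← Finset.mul_sum, ← sum_inner, h0]
  simp
  field_simp

theorem dev_le_msq_sub (hn : 0 < n) (v : Fin n → H) (c : H) : dev v ≤ msq fun i => v i - c := by
  rw [msq_eq_dev_add hn]; nlinarith [sq_nonneg ‖mean v - c‖]

theorem dev_le_msq (hn : 0 < n) (v : Fin n → H) : dev v ≤ msq v := by
  simpa using dev_le_msq_sub hn v 0

theorem norm_mean_sq_le_msq (hn : 0 < n) (v : Fin n → H) : ‖mean v‖ ^ 2 ≤ msq v := by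
  have := msq_eq_dev_add hn v 0
  simp only [sub_zero] at this
  linarith [dev_nonneg v]

theorem msq_add_le (u v : Fin n → H) {β : ℝ} (hβ : 0 < β) :
    msq (fun i => u i + v i) ≤ (1 + β) * msq u + (1 + 1 / β) * msq v := by
  unfold msq
  rw [mul_left_comm, mul_left_comm (1 + 1 / β), ← mul_add]
  gcongr
  rw [Finset.mul_sum, Finset.mul_sum, ← Finset.sum_add_distrib]
  refine Finset.sum_le_sum fun i _ => ?_
  have h1 : ‖u i + v i‖ ^ 2 ≤ (‖u i‖ + ‖v i‖) ^ 2 := by gcongr; exact norm_add_le _ _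
  have h2 : 2 * ‖u i‖ * ‖v i‖ ≤ β * ‖u i‖ ^ 2 + 1 / β * ‖v i‖ ^ 2 := by
    have : β * ‖u i‖ ^ 2 + 1 / β * ‖v i‖ ^ 2 - 2 * ‖u i‖ * ‖v i‖
        = (1 / β) * (β * ‖u i‖ - ‖v i‖) ^ 2 := by field_simp; ring
    nlinarith [show 0 ≤ (1 / β) * (β * ‖u i‖ - ‖v i‖) ^ 2 by positivity]
  nlinarith

theorem dev_add_le (u v : Fin n → H) {β : ℝ} (hβ : 0 < β) :
    dev (fun i => u i + v i) ≤ (1 + β) * dev u + (1 + 1 / β) * dev v := by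
  unfold dev
  simp_rw [mean_add, add_sub_add_comm]
  exact msq_add_le (fun i => u i - mean u) (fun i => v i - mean v) hβ

theorem dev_smul (c : ℝ) (v : Fin n → H) : dev (fun i => c • v i) = c ^ 2 * dev v := by
  unfold dev msq
  simp_rw [mean_smul, ← smul_sub, norm_smul, mul_pow, ← Finset.mul_sum]
  simp; ring

theorem msq_smul (c : ℝ) (v : Fin n → H) : msq (fun i => c • v i) = c ^ 2 * msq v := by
  unfold msq
  simp_rw [norm_smul, mul_pow, ← Finset.mul_sum]
  simp; ring

theorem dev_add_le_two (u v : Fin n → H) :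
    dev (fun i => u i + v i) ≤ 2 * dev u + 2 * dev v := by
  have := dev_add_le u v one_pos
  norm_num at this; linarith

theorem dev_sub_le_two (u v : Fin n → H) :
    dev (fun i => u i - v i) ≤ 2 * dev u + 2 * dev v := by
  have := dev_add_le_two u (fun i => (-1 : ℝ) • v i)
  rw [dev_smul] at this
  simpa [sub_eq_add_neg] using this

theorem msq_add_le_two (u v : Fin n → H) :
    msq (fun i => u i + v i) ≤ 2 * msq u + 2 * msq v := by
  have := msq_add_le u v one_pos
  norm_num at this; linarith

theorem msq_sub_le_two (u v : Fin n → H) :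
    msq (fun i => u i - v i) ≤ 2 * msq u + 2 * msq v := by
  have := msq_add_le_two u (fun i => (-1 : ℝ) • v i)
  rw [msq_smul] at this
  simpa [sub_eq_add_neg] using this

theorem mixing_add (W : Matrix (Fin n) (Fin n) ℝ) (u v : Fin n → H) :
    mixing W (fun i => u i + v i) = fun i => mixing W u i + mixing W v i := by
  ext i; simp [mixing, Finset.sum_add_distrib]

theorem mixing_sub (W : Matrix (Fin n) (Fin n) ℝ) (u v : Fin n → H) :
    mixing W (fun i => u i - v i) = fun i => mixing W u i - mixing W v i := by
  ext i; simp [mixing, smul_sub]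

theorem mixing_smul (W : Matrix (Fin n) (Fin n) ℝ) (c : ℝ) (v : Fin n → H) :
    mixing W (fun i => c • v i) = fun i => c • mixing W v i := by
  ext i; simp only [mixing, Finset.smul_sum]
  exact Finset.sum_congr rfl fun j _ => smul_comm _ _ _

theorem mixing_map {H' : Type*} [NormedAddCommGroup H'] [InnerProductSpace ℝ H'] (A : H →ₗ[ℝ] H')
    (W : Matrix (Fin n) (Fin n) ℝ) (v : Fin n → H) :
    mixing W (fun i => A (v i)) = fun i => A (mixing W v i) := by
  ext i; simp [mixing, map_sum]

theorem dev_map_le {H' : Type*} [NormedAddCommGroup H'] [InnerProductSpace ℝ H'] (A : H →ₗ[ℝ] H')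
    {c : ℝ} (hA : ∀ h, ‖A h‖ ≤ c * ‖h‖) (v : Fin n → H) :
    dev (fun i => A (v i)) ≤ c ^ 2 * dev v := by
  unfold dev
  refine msq_le_msq fun i => ?_
  rw [mean_map, ← map_sub, ← mul_pow]
  gcongr
  exact hA _

/-- A matrix whose rows and columns sum to one and which contracts the vectors of mean zero. -/
structure IsGossip (H : Type*) [NormedAddCommGroup H] [InnerProductSpace ℝ H]
    (W : Matrix (Fin n) (Fin n) ℝ) (ρ : ℝ) : Prop where
  row : ∀ i, ∑ j, W i j = 1
  col : ∀ j, ∑ i, W i j = 1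
  nonneg : 0 ≤ ρ
  lt_one : ρ < 1
  contract : ∀ v : Fin n → H, ∑ i, v i = 0 → ∑ i, ‖mixing W v i‖ ^ 2 ≤ ρ ^ 2 * ∑ i, ‖v i‖ ^ 2

namespace IsGossip

variable {W : Matrix (Fin n) (Fin n) ℝ} {ρ : ℝ}

theorem mean_mixing (hW : IsGossip H W ρ) (v : Fin n → H) : mean (mixing W v) = mean v := by
  unfold mean mixing
  rw [Finset.sum_comm]
  simp_rw [← Finset.sum_smul, hW.col, one_smul]

theorem dev_mixing_le_sq (hW : IsGossip H W ρ) (hn : 0 < n) (v : Fin n → H) :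
    dev (mixing W v) ≤ ρ ^ 2 * dev v := by
  have h1 : ∀ i, mixing W v i - mean (mixing W v) = mixing W (fun i => v i - mean v) i := by
    intro i
    rw [hW.mean_mixing, mixing_sub]
    simp [mixing, ← Finset.sum_smul, hW.row]
  have h0 : ∑ i, (v i - mean v) = 0 := by
    rw [Finset.sum_sub_distrib, sum_eq_smul_mean hn]
    simp [← Nat.cast_smul_eq_nsmul ℝ]
  unfold dev msq
  simp_rw [h1]
  rw [mul_left_comm]
  gcongr
  exact hW.contract _ h0

theorem dev_mixing_le (hW : IsGossip H W ρ) (hn : 0 < n) (v : Fin n → H) :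
    dev (mixing W v) ≤ dev v :=
  (hW.dev_mixing_le_sq hn v).trans <| by
    have : ρ ^ 2 ≤ 1 := by nlinarith [hW.nonneg, hW.lt_one]
    nlinarith [dev_nonneg v]

/-- Young's inequality with weight 1 - ρ. The first factor is (2 - ρ) ρ² ≤ ρ, because ρ (2 - ρ) = 1
- (1 - ρ)² ≤ 1; the second is 1 + 1/(1 - ρ) ≤ 2/(1 - ρ). -/
theorem dev_mixing_add_le (hW : IsGossip H W ρ) (hn : 0 < n) (u q : Fin n → H) :
    dev (fun i => mixing W u i + q i) ≤ ρ * dev u + 2 / (1 - ρ) * dev q := by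
  have h0 := hW.nonneg
  have h1 : 0 < 1 - ρ := by linarith [hW.lt_one]
  have h := dev_add_le (mixing W u) q h1
  have h2 : (1 + (1 - ρ)) * dev (mixing W u) ≤ ρ * dev u := by
    calc _ ≤ (1 + (1 - ρ)) * (ρ ^ 2 * dev u) := by gcongr; exact hW.dev_mixing_le_sq hn u
      _ = ((2 - ρ) * ρ) * (ρ * dev u) := by ring
      _ ≤ 1 * (ρ * dev u) := by
        have := dev_nonneg u
        gcongr; nlinarith [sq_nonneg (1 - ρ)]
      _ = _ := one_mul _
  have h3 : (1 + 1 / (1 - ρ)) * dev q ≤ 2 / (1 - ρ) * dev q := by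
    have := dev_nonneg q
    gcongr
    rw [← sub_nonneg]
    have : 2 / (1 - ρ) - (1 + 1 / (1 - ρ)) = ρ / (1 - ρ) := by field_simp; ring
    rw [this]; positivity
  linarith

end IsGossip

/-! ### Spectral contraction -/

theorem connectivity_nonneg {W : Matrix (Fin n) (Fin n) ℝ} (hW : W.IsHermitian) :
    0 ≤ connectivity hW := Real.iSup_nonneg fun _ => abs_nonneg _

/-- Expand in an orthonormal eigenbasis. Every coordinate except the first is shrunk by the bound on
the eigenvalues, and a vector of mean zero has no first coordinate. -/
theorem contract_real {W : Matrix (Fin n) (Fin n) ℝ} (hW : W.IsHermitian)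
    (hrow : ∀ i, ∑ j, W i j = 1) (hρ : connectivity hW < 1) (v : Fin n → ℝ) (hv : ∑ i, v i = 0) :
    ∑ i, (∑ j, W i j * v j) ^ 2 ≤ connectivity hW ^ 2 * ∑ i, v i ^ 2 := by
  classical
  set T := Matrix.toEuclideanLin W with hT
  have hs : T.IsSymmetric := Matrix.isSymmetric_toEuclideanLin_iff.mpr hW
  set b := hs.eigenvectorBasis finrank_euclideanSpace with hb
  have hTb : ∀ j, T (b j) = hW.eigenvalues₀ j • b j := fun j =>
    hs.apply_eigenvectorBasis finrank_euclideanSpace j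
  have hbd : ∀ j : Fin (Fintype.card (Fin n)), 1 ≤ (j : ℕ) →
      |hW.eigenvalues₀ j| ≤ connectivity hW := fun j hj =>
    le_ciSup (f := fun j : {j : Fin (Fintype.card (Fin n)) // 1 ≤ (j : ℕ)} =>
      |hW.eigenvalues₀ j|) (Set.finite_range _).bddAbove ⟨j, hj⟩
  have hin : ∀ (x : EuclideanSpace ℝ (Fin n)) j,
      inner ℝ (b j) (T x) = hW.eigenvalues₀ j * inner ℝ (b j) x := fun x j => by
    rw [← hs (b j) x, hTb, inner_smul_left]; simp
  let e : EuclideanSpace ℝ (Fin n) := WithLp.toLp 2 fun _ => 1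
  let x : EuclideanSpace ℝ (Fin n) := WithLp.toLp 2 v
  have hTe : T e = e := by
    ext i
    simp [hT, e, Matrix.toLpLin_apply, Matrix.mulVec, dotProduct, hrow]
  -- The constant vector `e` has eigenvalue 1 and these eigenvectors have eigenvalue less than 1, so
  -- they are orthogonal to `e`.
  have he : ∀ j : Fin (Fintype.card (Fin n)), 1 ≤ (j : ℕ) → inner ℝ (b j) e = 0 := fun j hj => by
    have h1 := hin e j
    rw [hTe] at h1
    have h2 : hW.eigenvalues₀ j < 1 := lt_of_le_of_lt (le_abs_self _) (lt_of_le_of_lt (hbd j hj) hρ)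
    have h3 : (1 - hW.eigenvalues₀ j) * inner ℝ (b j) e = 0 := by linarith
    rcases mul_eq_zero.mp h3 with h | h
    · linarith
    · exact h
  have hex : inner ℝ e x = 0 := by
    simp [e, x, PiLp.inner_apply, hv]
  have key : ∀ j, (inner ℝ (b j) (T x)) ^ 2 ≤ connectivity hW ^ 2 * (inner ℝ (b j) x) ^ 2 := by
    intro j
    by_cases hj : 1 ≤ (j : ℕ)
    · rw [hin, mul_pow]
      gcongr ?_ * _
      rw [← sq_abs (hW.eigenvalues₀ j)]
      gcongr
      exact hbd j hj
    -- Only the first eigenvector meets `e`, so ⟪e, x⟫ = 0 reduces to a single vanishing product.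
    -- Were the factor of `e` zero, all coordinates of `e` would vanish, forcing n = 0 although `j`
    -- is an index. Thus the factor of `x` is zero, and the value of the first eigenvalue plays no
    -- role.
    · have hj0 : (j : ℕ) = 0 := by omega
      have hsum : inner ℝ e x = ∑ i, inner ℝ e (b i) * inner ℝ (b i) x :=
        (b.sum_inner_mul_inner e x).symm
      rw [Finset.sum_eq_single j] at hsum
      · rw [hex] at hsum
        rcases mul_eq_zero.mp hsum.symm with h | h
        · have h0 : ‖e‖ ^ 2 = 0 := by
            rw [← b.sum_sq_norm_inner_right e]
            refine Finset.sum_eq_zero fun i _ => ?_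
            by_cases hi : 1 ≤ (i : ℕ)
            · simp [he i hi]
            · have : i = j := Fin.ext (by omega)
              subst this
              rw [real_inner_comm] at h; simp [h]
          exfalso
          have hj' := j.2
          simp only [Fintype.card_fin] at hj'
          have h3 : ‖e‖ ^ 2 = n := by
            simp [e, EuclideanSpace.norm_sq_eq]
          rw [h3] at h0
          have : n = 0 := by exact_mod_cast h0
          omega
        · rw [hin, h]; simp
      · intro i _ hij
        have hi : 1 ≤ (i : ℕ) := by
          by_contra hc
          exact hij (Fin.ext (by omega))
        rw [real_inner_comm, he i hi, zero_mul]
      · simp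
  have h1 : ‖T x‖ ^ 2 ≤ connectivity hW ^ 2 * ‖x‖ ^ 2 := by
    rw [← b.sum_sq_norm_inner_right, ← b.sum_sq_norm_inner_right x, Finset.mul_sum]
    refine Finset.sum_le_sum fun j _ => ?_
    simpa using key j
  simpa [EuclideanSpace.norm_sq_eq, hT, x, Matrix.toLpLin_apply, Matrix.mulVec, dotProduct]
    using h1

/-- The scalar contraction is applied to each coordinate in an orthonormal basis of `H`. -/
theorem isGossip_of_doublyStochastic [FiniteDimensional ℝ H] {W : Matrix (Fin n) (Fin n) ℝ}
    (hW : W.IsHermitian) (hds : W ∈ doublyStochastic ℝ (Fin n)) (hρ : connectivity hW < 1) :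
    IsGossip H W (connectivity hW) := by
  obtain ⟨-, hrow, hcol⟩ := mem_doublyStochastic_iff_sum.mp hds
  refine ⟨hrow, hcol, connectivity_nonneg hW, hρ, fun v hv => ?_⟩
  let b := stdOrthonormalBasis ℝ H
  simp_rw [← b.sum_sq_norm_inner_right]
  rw [Finset.sum_comm, Finset.sum_comm (s := Finset.univ (α := Fin n)), Finset.mul_sum]
  refine Finset.sum_le_sum fun e _ => ?_
  have := contract_real hW hrow hρ (fun i => inner ℝ (b e) (v i))
    (by rw [← inner_sum, hv, inner_zero_right])
  simpa [mixing, inner_sum, inner_smul_right] using this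

end Consensus

/-! ### Descent along sample paths -/

section Paths

variable {n : ℕ} {H : Type*} [NormedAddCommGroup H] [InnerProductSpace ℝ H]

/-- Summing the recursion directly bounds the total of the sequence without unrolling powers of ρ.
The final term `a K` is kept because the tracker estimate needs it. -/
theorem sum_contraction {a c : ℕ → ℝ} {ρ : ℝ} (h : ∀ k, a (k + 1) ≤ ρ * a k + c k) (K : ℕ) :
    (1 - ρ) * ∑ k ∈ Finset.range K, a k + a K ≤ a 0 + ∑ k ∈ Finset.range K, c k := by
  induction K with
  | zero => simp
  | succ K ih => rw [Finset.sum_range_succ, Finset.sum_range_succ]; linarith [h K]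

/-- Smooth nonincreasing potentials `Φ k`, with gradients `gΦ k`, for which the averages of the
Lipschitz fields `b k i` are ascent directions; the stationarity measure is `R k`. -/
structure Landscape (Φ : ℕ → H → ℝ) (gΦ : ℕ → H → H) (R : ℕ → H → ℝ) (b : ℕ → Fin n → H → H)
    (κ C ℓ L : ℝ) : Prop where
  nonneg : ∀ k w, 0 ≤ Φ k w
  anti : ∀ k w, Φ (k + 1) w ≤ Φ k w
  smooth : ∀ k w w', Φ k w' ≤ Φ k w + inner ℝ (gΦ k w) (w' - w) + L * ‖w' - w‖ ^ 2
  R_nonneg : ∀ k w, 0 ≤ R k w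
  dom : ∀ k w, κ * R k w ≤ inner ℝ (gΦ k w) (mean fun i => b k i w)
  grad_le : ∀ k w, ‖gΦ k w‖ ^ 2 ≤ C * R k w
  dir_le : ∀ k w, ‖mean fun i => b k i w‖ ^ 2 ≤ C * R k w
  lip : ∀ k i w w', ‖b k i w - b k i w'‖ ≤ ℓ * ‖w - w'‖

theorem msq_lip_sub_le {a : Fin n → H → H} {ℓ : ℝ}
    (ha : ∀ i w w', ‖a i w - a i w'‖ ≤ ℓ * ‖w - w'‖) (w w' : Fin n → H) :
    msq (fun i => a i (w i) - a i (w' i)) ≤ ℓ ^ 2 * msq fun i => w i - w' i :=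
  msq_le_msq fun i => by rw [← mul_pow]; gcongr; exact ha _ _ _

/-- Compare each local field with its value at the common average: the change is Lipschitz in the
disagreement, and only the values at one common point need the bound σ. Two applications of the
factor-two inequality give the 4. -/
theorem dev_direction_le (hn : 0 < n) {a : Fin n → H → H} {ℓ σ : ℝ}
    (ha : ∀ i w w', ‖a i w - a i w'‖ ≤ ℓ * ‖w - w'‖)
    (hσ : ∀ z, dev (fun i => a i z) ≤ σ) (w ε : Fin n → H) :
    dev (fun i => a i (w i) + ε i) ≤ 4 * (ℓ ^ 2 * dev w + σ + msq ε) := by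
  have h1 : (fun i => a i (w i) + ε i)
      = fun i => ((a i (w i) - a i (mean w)) + ε i) + a i (mean w) := by ext i; abel
  rw [h1]
  have h2 := dev_add_le_two (fun i => (a i (w i) - a i (mean w)) + ε i) (fun i => a i (mean w))
  have h3 := (dev_le_msq hn (fun i => (a i (w i) - a i (mean w)) + ε i)).trans
    (msq_add_le_two (fun i => a i (w i) - a i (mean w)) ε)
  have h4 := msq_lip_sub_le ha w (fun _ => mean w)
  have h5 := hσ (mean w)
  have h6 : dev w = msq fun i => w i - mean w := rfl
  have h7 := dev_nonneg (fun i => a i (mean w))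
  rw [h6]
  linarith

namespace Landscape

variable {Φ : ℕ → H → ℝ} {gΦ : ℕ → H → H} {R : ℕ → H → ℝ} {b : ℕ → Fin n → H → H} {κ C ℓ L : ℝ}

theorem bias_le (h : Landscape Φ gΦ R b κ C ℓ L) (hn : 0 < n) (k : ℕ) (w : Fin n → H) :
    ‖mean (fun i => b k i (w i)) - mean (fun i => b k i (mean w))‖ ^ 2 ≤ ℓ ^ 2 * dev w := by
  rw [← mean_sub]
  exact (norm_mean_sq_le_msq hn _).trans (msq_lip_sub_le (h.lip k) w fun _ => mean w)

theorem norm_mean_direction_le (h : Landscape Φ gΦ R b κ C ℓ L) (hn : 0 < n) (k : ℕ)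
    (w : Fin n → H) :
    ‖mean (fun i => b k i (w i))‖ ^ 2 ≤ 2 * C * R k (mean w) + 2 * ℓ ^ 2 * dev w := by
  have h1 := h.bias_le hn k w
  have h2 := h.dir_le k (mean w)
  have h3 := parallelogram_law_with_norm ℝ
    (mean (fun i => b k i (w i)) - mean (fun i => b k i (mean w)))
    (mean (fun i => b k i (mean w)))
  rw [sub_add_cancel] at h3
  nlinarith [sq_nonneg ‖mean (fun i => b k i (w i)) - mean (fun i => b k i (mean w))
    - mean (fun i => b k i (mean w))‖]

theorem norm_add_sq_le_two (u v : H) : ‖u + v‖ ^ 2 ≤ 2 * ‖u‖ ^ 2 + 2 * ‖v‖ ^ 2 := by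
  nlinarith [parallelogram_law_with_norm ℝ u v, sq_nonneg ‖u - v‖]

/-- Smoothness is applied at the average z, whose displacement is -lam (d + mean ε). Of the decrease
κ R, one quarter pays for evaluating the fields at the agents' own points and one quarter for the
second-order term, leaving κ/2. The product of gradient and noise is kept, since it vanishes only in
expectation. -/
theorem descent_step (h : Landscape Φ gΦ R b κ C ℓ L) (hn : 0 < n) (hκ : 0 < κ) (hC : 0 < C)
    (hL : 0 ≤ L) {lam : ℝ} (hlam : 0 < lam) (hlam1 : lam ≤ 1) (hlamC : 16 * L * C * lam ≤ κ)
    (k : ℕ) (w ε : Fin n → H) {w' : H}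
    (hw' : w' = mean w - lam • mean (fun i => b k i (w i) + ε i)) :
    Φ (k + 1) w' + lam * (κ / 2) * R k (mean w) + lam * inner ℝ (gΦ k (mean w)) (mean ε)
      ≤ Φ k (mean w) + lam * ((C / κ + 4 * L) * ℓ ^ 2) * dev w
        + 2 * L * lam ^ 2 * ‖mean ε‖ ^ 2 := by
  set z := mean w
  set d := mean (fun i => b k i (w i)) with hd
  set d0 := mean (fun i => b k i z) with hd0
  have hbias : ‖d - d0‖ ^ 2 ≤ ℓ ^ 2 * dev w := h.bias_le hn k w
  have hnd : ‖d‖ ^ 2 ≤ 2 * C * R k z + 2 * ℓ ^ 2 * dev w := h.norm_mean_direction_le hn k w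
  have hR := h.R_nonneg k z
  have hΔ := dev_nonneg w
  have hstep : w' - z = -(lam • (d + mean ε)) := by rw [hw', mean_add]; abel
  have h1 := (h.anti k w').trans (h.smooth k z w')
  have h2 : inner ℝ (gΦ k z) (w' - z)
      = -lam * inner ℝ (gΦ k z) d0 - lam * inner ℝ (gΦ k z) (d - d0)
        - lam * inner ℝ (gΦ k z) (mean ε) := by
    rw [hstep, inner_neg_right, inner_smul_right, inner_add_right, inner_sub_right]; ring
  have h3 : ‖w' - z‖ ^ 2 ≤ lam ^ 2 * (2 * ‖d‖ ^ 2 + 2 * ‖mean ε‖ ^ 2) := by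
    rw [hstep, norm_neg, norm_smul, mul_pow, Real.norm_eq_abs, sq_abs]
    gcongr
    exact norm_add_sq_le_two _ _
  have h4 : -inner ℝ (gΦ k z) (d - d0) ≤ κ / 4 * R k z + C / κ * (ℓ ^ 2 * dev w) := by
    have e1 : -inner ℝ (gΦ k z) (d - d0) ≤ ‖gΦ k z‖ * ‖d - d0‖ :=
      (neg_le_abs _).trans (abs_real_inner_le_norm _ _)
    -- The Young weight κ/(4C) is chosen so that `grad_le` turns the gradient term into exactly κ/4
    -- · R.
    have e2 : ‖gΦ k z‖ * ‖d - d0‖ ≤ κ / (4 * C) * ‖gΦ k z‖ ^ 2 + C / κ * ‖d - d0‖ ^ 2 := by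
      have : κ / (4 * C) * ‖gΦ k z‖ ^ 2 + C / κ * ‖d - d0‖ ^ 2 - ‖gΦ k z‖ * ‖d - d0‖
          = C / κ * (κ / (2 * C) * ‖gΦ k z‖ - ‖d - d0‖) ^ 2 := by field_simp; ring
      nlinarith [show 0 ≤ C / κ * (κ / (2 * C) * ‖gΦ k z‖ - ‖d - d0‖) ^ 2 by positivity]
    have e3 : κ / (4 * C) * ‖gΦ k z‖ ^ 2 ≤ κ / (4 * C) * (C * R k z) := by
      gcongr; exact h.grad_le k z
    have e4 : κ / (4 * C) * (C * R k z) = κ / 4 * R k z := by field_simp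
    have e5 : C / κ * ‖d - d0‖ ^ 2 ≤ C / κ * (ℓ ^ 2 * dev w) := by gcongr
    linarith
  have h5 : L * ‖w' - z‖ ^ 2 ≤ lam * (κ / 4) * R k z + lam * (4 * L) * (ℓ ^ 2 * dev w)
      + 2 * L * lam ^ 2 * ‖mean ε‖ ^ 2 := by
    have e1 : L * ‖w' - z‖ ^ 2 ≤ L * (lam ^ 2 *
        (2 * (2 * C * R k z + 2 * ℓ ^ 2 * dev w) + 2 * ‖mean ε‖ ^ 2)) := by
      refine mul_le_mul_of_nonneg_left (h3.trans ?_) hL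
      gcongr
    -- The step restriction 16 L C lam ≤ κ makes the second-order term cost another κ/4 · R.
    have e2 : lam * (4 * L * C * lam) * R k z ≤ lam * (κ / 4) * R k z := by
      gcongr; linarith
    have e3 : lam * lam * (4 * L * (ℓ ^ 2 * dev w)) ≤ lam * 1 * (4 * L * (ℓ ^ 2 * dev w)) := by
      gcongr
    nlinarith
  have h6 := mul_le_mul_of_nonneg_left (h.dom k z) hlam.le
  have h7 := mul_le_mul_of_nonneg_left h4 hlam.le
  rw [h2] at h1
  nlinarith

theorem descent_sum (h : Landscape Φ gΦ R b κ C ℓ L) (hn : 0 < n) (hκ : 0 < κ) (hC : 0 < C)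
    (hL : 0 ≤ L) {lam : ℝ} (hlam : 0 < lam) (hlam1 : lam ≤ 1) (hlamC : 16 * L * C * lam ≤ κ)
    (w ε : ℕ → Fin n → H)
    (hw : ∀ k, mean (w (k + 1)) = mean (w k) - lam • mean (fun i => b k i (w k i) + ε k i))
    (K : ℕ) :
    lam * (κ / 2) * ∑ k ∈ Finset.range K, R k (mean (w k))
      + lam * ∑ k ∈ Finset.range K, inner ℝ (gΦ k (mean (w k))) (mean (ε k))
      ≤ Φ 0 (mean (w 0))
        + lam * ((C / κ + 4 * L) * ℓ ^ 2) * ∑ k ∈ Finset.range K, dev (w k)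
        + 2 * L * lam ^ 2 * ∑ k ∈ Finset.range K, ‖mean (ε k)‖ ^ 2 := by
  have key : ∀ K : ℕ, Φ K (mean (w K)) + lam * (κ / 2) * ∑ k ∈ Finset.range K, R k (mean (w k))
      + lam * ∑ k ∈ Finset.range K, inner ℝ (gΦ k (mean (w k))) (mean (ε k))
      ≤ Φ 0 (mean (w 0))
        + lam * ((C / κ + 4 * L) * ℓ ^ 2) * ∑ k ∈ Finset.range K, dev (w k)
        + 2 * L * lam ^ 2 * ∑ k ∈ Finset.range K, ‖mean (ε k)‖ ^ 2 := by
    intro K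
    induction K with
    | zero => simp
    | succ K ih =>
      have := h.descent_step hn hκ hC hL hlam hlam1 hlamC K (w K) (ε K) (hw K)
      simp only [Finset.sum_range_succ, mul_add]
      linarith
  linarith [key K, h.nonneg K (mean (w K))]

variable {W : Matrix (Fin n) (Fin n) ℝ} {ρ : ℝ}

/-- Decentralized stochastic gradient descent, along a sample path. -/
theorem path_bound_se (h : Landscape Φ gΦ R b κ C ℓ L) (hW : IsGossip H W ρ) (hn : 0 < n)
    (hκ : 0 < κ) (hC : 0 < C) (hL : 0 ≤ L) {σ : ℝ} (hσ : ∀ k z, dev (fun i => b k i z) ≤ σ)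
    {lam lb : ℝ} (hlam : 0 < lam) (hlb : lam ≤ lb * (1 - ρ)) (hlb1 : lb ≤ 1)
    (hlbC : 16 * L * C * lb ≤ κ) (hlbℓ : 16 * ℓ ^ 2 * lb ≤ 1)
    (w ε : ℕ → Fin n → H)
    (hw : ∀ k, w (k + 1) = mixing W fun i => w k i - lam • (b k i (w k i) + ε k i)) (K : ℕ) :
    lam * (κ / 2) * ∑ k ∈ Finset.range K, R k (mean (w k))
      + lam * ∑ k ∈ Finset.range K, inner ℝ (gΦ k (mean (w k))) (mean (ε k))
      ≤ Φ 0 (mean (w 0)) + 2 * ((C / κ + 4 * L) * ℓ ^ 2) * dev (w 0)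
        + 16 * ((C / κ + 4 * L) * ℓ ^ 2) * (lam ^ 3 / (1 - ρ) ^ 2)
          * ∑ k ∈ Finset.range K, (σ + msq (ε k))
        + 2 * L * lam ^ 2 * ∑ k ∈ Finset.range K, ‖mean (ε k)‖ ^ 2 := by
  have hρ : 0 < 1 - ρ := by linarith [hW.lt_one]
  have hρ1 : 1 - ρ ≤ 1 := by linarith [hW.nonneg]
  have hlb0 : 0 < lb := by
    by_contra hc
    have : lb * (1 - ρ) ≤ 0 := mul_nonpos_of_nonpos_of_nonneg (not_lt.mp hc) hρ.le
    linarith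
  have hlamlb : lam ≤ lb := hlb.trans (by nlinarith)
  set M := (C / κ + 4 * L) * ℓ ^ 2 with hM
  have hM0 : 0 ≤ M := by positivity
  have hd := h.descent_sum hn hκ hC hL hlam (hlamlb.trans hlb1)
    ((mul_le_mul_of_nonneg_left hlamlb (by positivity)).trans hlbC) w ε (fun k => by
      rw [hw, hW.mean_mixing, mean_sub, mean_smul]) K
  have hrec : ∀ k, dev (w (k + 1)) ≤ ((1 + ρ) / 2) * dev (w k)
      + 8 * lam ^ 2 / (1 - ρ) * (σ + msq (ε k)) := by
    intro k
    have e1 : w (k + 1) = fun i => mixing W (w k) i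
        + (-lam) • mixing W (fun i => b k i (w k i) + ε k i) i := by
      rw [hw, mixing_sub, mixing_smul]; ext i; simp [sub_eq_add_neg]
    have e2 := hW.dev_mixing_add_le hn (w k)
      (fun i => (-lam) • mixing W (fun i => b k i (w k i) + ε k i) i)
    rw [← e1, dev_smul, neg_sq] at e2
    have e3 := (hW.dev_mixing_le hn (fun i => b k i (w k i) + ε k i)).trans
      (dev_direction_le hn (h.lip k) (hσ k) (w k) (ε k))
    have e4 : 2 / (1 - ρ) * (lam ^ 2 * dev (mixing W (fun i => b k i (w k i) + ε k i)))
        ≤ 2 / (1 - ρ) * (lam ^ 2 * (4 * (ℓ ^ 2 * dev (w k) + σ + msq (ε k)))) := by gcongr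
    -- The Lipschitz feedback may use half of the spectral gap: lam² ≤ lb (1 - ρ)² because lb ≤ 1,
    -- and 16 ℓ² lb ≤ 1. The contraction factor worsens from ρ to (1 + ρ)/2.
    have e5 : 8 * ℓ ^ 2 * lam ^ 2 / (1 - ρ) ≤ (1 - ρ) / 2 := by
      rw [div_le_iff₀ hρ]
      have : lam * lam ≤ (lb * (1 - ρ)) * (1 * (1 - ρ)) := by
        refine mul_le_mul hlb (hlb.trans ?_) hlam.le (by positivity)
        gcongr
      have e6 := mul_le_mul_of_nonneg_left this (show 0 ≤ 8 * ℓ ^ 2 by positivity)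
      have e7 : 8 * ℓ ^ 2 * (lb * (1 - ρ) * (1 * (1 - ρ)))
        = (16 * ℓ ^ 2 * lb) * ((1 - ρ) * (1 - ρ) / 2) := by ring
      have e8 : (16 * ℓ ^ 2 * lb) * ((1 - ρ) * (1 - ρ) / 2) ≤ 1 * ((1 - ρ) * (1 - ρ) / 2) := by
        gcongr
      nlinarith
    have e9 := mul_le_mul_of_nonneg_right e5 (dev_nonneg (w k))
    have e10 : 2 / (1 - ρ) * (lam ^ 2 * (4 * (ℓ ^ 2 * dev (w k) + σ + msq (ε k))))
        = 8 * ℓ ^ 2 * lam ^ 2 / (1 - ρ) * dev (w k)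
          + 8 * lam ^ 2 / (1 - ρ) * (σ + msq (ε k)) := by ring
    linarith
  have hs := sum_contraction (a := fun k => dev (w k))
    (c := fun k => 8 * lam ^ 2 / (1 - ρ) * (σ + msq (ε k))) hrec K
  rw [← Finset.mul_sum] at hs
  set SΔ := ∑ k ∈ Finset.range K, dev (w k)
  set SE := ∑ k ∈ Finset.range K, (σ + msq (ε k))
  have hs' : lam * M * SΔ ≤ 2 * M * dev (w 0) + 16 * M * (lam ^ 3 / (1 - ρ) ^ 2) * SE := by
    have e1 : (1 - ρ) * SΔ ≤ 2 * dev (w 0) + 16 * lam ^ 2 / (1 - ρ) * SE := by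
      have := dev_nonneg (w K)
      have : 16 * lam ^ 2 / (1 - ρ) * SE = 2 * (8 * lam ^ 2 / (1 - ρ) * SE) := by ring
      linarith
    have e2 : SΔ ≤ (2 * dev (w 0) + 16 * lam ^ 2 / (1 - ρ) * SE) / (1 - ρ) := by
      rw [le_div_iff₀ hρ]; linarith
    have e3 := mul_le_mul_of_nonneg_left e2 (show 0 ≤ lam * M by positivity)
    have e4 : lam * M * ((2 * dev (w 0) + 16 * lam ^ 2 / (1 - ρ) * SE) / (1 - ρ))
        = (lam / (1 - ρ)) * (2 * M * dev (w 0)) + 16 * M * (lam ^ 3 / (1 - ρ) ^ 2) * SE := by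
      field_simp
    -- The step restriction cancels the factor 1/(1 - ρ) in front of the initial disagreement, which
    -- therefore enters the bound without ρ.
    have e5 : lam / (1 - ρ) ≤ 1 := by
      rw [div_le_one hρ]; nlinarith
    have e6 := mul_le_mul_of_nonneg_right e5
      (show 0 ≤ 2 * M * dev (w 0) by have := dev_nonneg (w 0); positivity)
    linarith
  linarith

end Landscape
end Paths

/-! ### Gradient tracking along sample paths -/

section Tracking

variable {n : ℕ} {H : Type*} [NormedAddCommGroup H] [InnerProductSpace ℝ H]
variable {W : Matrix (Fin n) (Fin n) ℝ} {ρ : ℝ}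

/-- Mixing preserves averages and the increments of the directions telescope, so the averaged
tracker follows the averaged direction exactly. -/
theorem mean_tracker (hW : IsGossip H W ρ) {D Dh : ℕ → Fin n → H} (h0 : D 0 = mixing W (Dh 0))
    (hD : ∀ k, D (k + 1) = mixing W fun i => D k i + Dh (k + 1) i - Dh k i) (k : ℕ) :
    mean (D k) = mean (Dh k) := by
  induction k with
  | zero => rw [h0, hW.mean_mixing]
  | succ k ih => rw [hD, hW.mean_mixing, mean_sub, mean_add, ih]; abel

/-- The heterogeneity of a fixed Lipschitz field along a slowly moving sequence of points, weighted
by `1 / ((k + 1) (k + 2))`, is controlled by its initial value and the squared increments. -/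
theorem sum_heterogeneity_le (hW : IsGossip H W ρ) (hn : 0 < n) {a : Fin n → H → H} {ℓ : ℝ}
    (ha : ∀ i w w', ‖a i w - a i w'‖ ≤ ℓ * ‖w - w'‖) (z : ℕ → H) (K : ℕ) :
    ∑ k ∈ Finset.range K, dev (mixing W fun i => a i (z k)) / (((k : ℝ) + 1) * (k + 2))
      ≤ 2 * dev (mixing W fun i => a i (z 0))
        + 4 * ℓ ^ 2 * ∑ k ∈ Finset.range K, ‖z (k + 1) - z k‖ ^ 2 := by
  set φ : ℕ → ℝ := fun k => dev (mixing W fun i => a i (z k)) with hφ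
  have hφ0 : ∀ k, 0 ≤ φ k := fun k => dev_nonneg _
  have hstep : ∀ k : ℕ, φ (k + 1) / ((k : ℝ) + 2) ≤ φ k / ((k : ℝ) + 1)
      - φ k / (((k : ℝ) + 1) * (k + 2)) / 2 + 2 * ℓ ^ 2 * ‖z (k + 1) - z k‖ ^ 2 := by
    intro k
    have hk : (0 : ℝ) < (k : ℝ) + 1 := by positivity
    have e1 : (mixing W fun i => a i (z (k + 1))) = fun i => mixing W (fun i => a i (z k)) i
        + mixing W (fun i => a i (z (k + 1)) - a i (z k)) i := by
      rw [mixing_sub]; ext i; exact (add_sub_cancel _ _).symm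
    -- The weight 1/(2(k+1)) satisfies (1 + 1/(2(k+1)))/(k+2) = 1/(k+1) - (1/2)/((k+1)(k+2)). So φ
    -- k/(k+1) telescopes and releases half of each weighted summand, while the increments get the
    -- bounded coefficient (2k+3)/(k+2) ≤ 2.
    have e2 := dev_add_le (mixing W fun i => a i (z k))
      (mixing W fun i => a i (z (k + 1)) - a i (z k)) (show 0 < 1 / (2 * ((k : ℝ) + 1)) by positivity)
    rw [← e1] at e2
    have e3 : dev (mixing W fun i => a i (z (k + 1)) - a i (z k))
        ≤ ℓ ^ 2 * ‖z (k + 1) - z k‖ ^ 2 := by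
      refine ((hW.dev_mixing_le hn _).trans (dev_le_msq hn _)).trans ?_
      refine (msq_lip_sub_le ha (fun _ => z (k + 1)) (fun _ => z k)).trans ?_
      rw [msq_const hn]
    have e4 : φ (k + 1) ≤ (1 + 1 / (2 * ((k : ℝ) + 1))) * φ k
        + (1 + 1 / (1 / (2 * ((k : ℝ) + 1)))) * (ℓ ^ 2 * ‖z (k + 1) - z k‖ ^ 2) := by
      refine e2.trans ?_
      gcongr
    have e5 : ((1 + 1 / (2 * ((k : ℝ) + 1))) * φ k
        + (1 + 1 / (1 / (2 * ((k : ℝ) + 1)))) * (ℓ ^ 2 * ‖z (k + 1) - z k‖ ^ 2)) / ((k : ℝ) + 2)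
        = φ k / ((k : ℝ) + 1) - φ k / (((k : ℝ) + 1) * (k + 2)) / 2
          + (2 * k + 3) / (k + 2) * (ℓ ^ 2 * ‖z (k + 1) - z k‖ ^ 2) := by
      field_simp; ring
    have e6 : (2 * (k : ℝ) + 3) / (k + 2) ≤ 2 := by
      rw [div_le_iff₀ (by positivity)]; linarith
    have e7 := mul_le_mul_of_nonneg_right e6
      (show 0 ≤ ℓ ^ 2 * ‖z (k + 1) - z k‖ ^ 2 by positivity)
    have e8 : φ (k + 1) / ((k : ℝ) + 2) ≤ _ :=
      div_le_div_of_nonneg_right e4 (show (0 : ℝ) ≤ (k : ℝ) + 2 by positivity)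
    rw [e5] at e8
    linarith
  have hsum : ∀ K : ℕ, φ K / ((K : ℝ) + 1)
      + ∑ k ∈ Finset.range K, φ k / (((k : ℝ) + 1) * (k + 2)) / 2
      ≤ φ 0 + 2 * ℓ ^ 2 * ∑ k ∈ Finset.range K, ‖z (k + 1) - z k‖ ^ 2 := by
    intro K
    induction K with
    | zero => simp
    | succ K ih =>
      have := hstep K
      rw [Finset.sum_range_succ, Finset.sum_range_succ]
      push_cast
      rw [show (K : ℝ) + 1 + 1 = K + 2 by ring]
      linarith
  have := hsum K
  rw [← Finset.sum_div] at this
  have : 0 ≤ φ K / ((K : ℝ) + 1) := div_nonneg (hφ0 K) (by positivity)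
  linarith

theorem msq_increment_le (hn : 0 < n) (w w' : Fin n → H) :
    msq (fun i => w' i - w i) ≤ 4 * (dev w' + dev w + ‖mean w' - mean w‖ ^ 2) := by
  have e : (fun i => w' i - w i)
      = fun i => ((w' i - mean w') + (mean w' - mean w)) - (w i - mean w) := by ext i; abel
  rw [e]
  have h1 := msq_sub_le_two (fun i => (w' i - mean w') + (mean w' - mean w))
    (fun i => w i - mean w)
  have h2 := msq_add_le_two (fun i => w' i - mean w') (fun _ => mean w' - mean w)
  rw [msq_const hn] at h2
  have h3 : msq (fun i => w i - mean w) = dev w := rfl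
  have h4 : msq (fun i => w' i - mean w') = dev w' := rfl
  rw [h3] at h1
  rw [h4] at h2
  have := dev_nonneg w
  linarith

/-- One step of the tracker recursion. -/
theorem dev_tracker_step (hW : IsGossip H W ρ) (hn : 0 < n) {a c : Fin n → H → H} {m m' m₀ ℓ : ℝ}
    {κ : ℝ} (hκ : 1 ≤ κ)
    (ha : ∀ i w w', ‖a i w - a i w'‖ ≤ ℓ * ‖w - w'‖)
    (hb : ∀ i w w', ‖(m • a i w + c i w) - (m • a i w' + c i w')‖ ≤ ℓ * ‖w - w'‖)
    (hm : |m' - m| ≤ m₀ / κ) (D w w' ε ε' : Fin n → H) :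
    dev (mixing W fun i => D i + (m' • a i (w' i) + c i (w' i) + ε' i)
        - (m • a i (w i) + c i (w i) + ε i))
      ≤ ρ * dev D + 2 / (1 - ρ) *
        (2 * m₀ ^ 2 * (dev (mixing W fun i => a i (mean w')) / κ ^ 2)
          + 8 * ((m₀ ^ 2 * ℓ ^ 2 + 4 * ℓ ^ 2) * dev w' + 4 * ℓ ^ 2 * dev w
            + 4 * ℓ ^ 2 * ‖mean w' - mean w‖ ^ 2 + msq ε' + msq ε)) := by
  have hρ : 0 < 1 - ρ := by linarith [hW.lt_one]
  have hm2 : (m' - m) ^ 2 ≤ m₀ ^ 2 / κ ^ 2 := by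
    rw [← sq_abs, ← div_pow]; gcongr
  have hm3 : (m' - m) ^ 2 ≤ m₀ ^ 2 := hm2.trans (div_le_self (by positivity) (by nlinarith))
  -- Only the change of the penalty at the averaged point involves the heterogeneity of `a`. The
  -- remainder `r` consists of Lipschitz increments and noise, so its mean square suffices.
  set r : Fin n → H := fun i => ((m' - m) • (a i (w' i) - a i (mean w'))
    + ((m • a i (w' i) + c i (w' i)) - (m • a i (w i) + c i (w i)))) + (ε' i - ε i) with hr
  have e1 : (mixing W fun i => D i + (m' • a i (w' i) + c i (w' i) + ε' i)
        - (m • a i (w i) + c i (w i) + ε i))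
      = fun i => mixing W D i + ((m' - m) • mixing W (fun i => a i (mean w')) i
        + mixing W r i) := by
    have : (fun i => D i + (m' • a i (w' i) + c i (w' i) + ε' i)
        - (m • a i (w i) + c i (w i) + ε i))
        = fun i => D i + ((m' - m) • a i (mean w') + r i) := by
      ext i; simp only [hr, smul_sub, sub_smul]; abel
    rw [this, mixing_add, mixing_add, mixing_smul]
  rw [e1]
  refine (hW.dev_mixing_add_le hn D _).trans ?_
  gcongr
  refine (dev_add_le_two _ _).trans ?_
  rw [dev_smul]
  have f1 : (m' - m) ^ 2 * dev (mixing W fun i => a i (mean w'))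
      ≤ m₀ ^ 2 / κ ^ 2 * dev (mixing W fun i => a i (mean w')) := by
    have := dev_nonneg (mixing W fun i => a i (mean w'))
    gcongr
  have f2 : dev (mixing W r) ≤ msq r := (hW.dev_mixing_le hn r).trans (dev_le_msq hn r)
  have f3 := msq_add_le_two (fun i => (m' - m) • (a i (w' i) - a i (mean w'))
    + ((m • a i (w' i) + c i (w' i)) - (m • a i (w i) + c i (w i)))) (fun i => ε' i - ε i)
  have f4 := msq_add_le_two (fun i => (m' - m) • (a i (w' i) - a i (mean w')))
    (fun i => (m • a i (w' i) + c i (w' i)) - (m • a i (w i) + c i (w i)))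
  have f5 := msq_sub_le_two ε' ε
  have f6 : msq (fun i => (m' - m) • (a i (w' i) - a i (mean w')))
      ≤ m₀ ^ 2 * (ℓ ^ 2 * dev w') := by
    rw [msq_smul]
    refine mul_le_mul hm3 (msq_lip_sub_le ha w' fun _ => mean w') (msq_nonneg _) (by positivity)
  have f7 := msq_lip_sub_le (a := fun i z => m • a i z + c i z) hb w' w
  have f8 := mul_le_mul_of_nonneg_left (msq_increment_le hn w w') (sq_nonneg ℓ)
  have f9 : m₀ ^ 2 / κ ^ 2 * dev (mixing W fun i => a i (mean w'))
      = m₀ ^ 2 * (dev (mixing W fun i => a i (mean w')) / κ ^ 2) := by ring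
  have f10 : msq r ≤ 2 * msq (fun i => (m' - m) • (a i (w' i) - a i (mean w'))
    + ((m • a i (w' i) + c i (w' i)) - (m • a i (w i) + c i (w i))))
    + 2 * msq fun i => ε' i - ε i := f3
  nlinarith

namespace Landscape

variable {Φ : ℕ → H → ℝ} {gΦ : ℕ → H → H} {R : ℕ → H → ℝ} {b : ℕ → Fin n → H → H} {κ C ℓ L : ℝ}

set_option maxHeartbeats 1000000 in
/-- Consensus error of gradient tracking, along a sample path. -/
theorem consensus_sum_gt (h : Landscape Φ gΦ R b κ C ℓ L) (hW : IsGossip H W ρ) (hn : 0 < n)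
    {a c : Fin n → H → H} {m : ℕ → ℝ} {m₀ : ℝ}
    (hb : ∀ k i z, b k i z = m k • a i z + c i z)
    (ha : ∀ i w w', ‖a i w - a i w'‖ ≤ ℓ * ‖w - w'‖)
    (hm : ∀ k : ℕ, |m (k + 1) - m k| ≤ m₀ / ((k : ℝ) + 2))
    {lam q : ℝ} (hlam : 0 < lam) (hlam1 : lam ≤ 1)
    (hq : q = 32 * m₀ ^ 2 * ℓ ^ 2 + 128 * ℓ ^ 2)
    (hlamq : 4 * (q * (1 + 4 * ℓ ^ 2)) * lam ^ 2 ≤ (1 - ρ) ^ 4)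
    (w D ε : ℕ → Fin n → H)
    (hw : ∀ k, w (k + 1) = mixing W fun i => w k i - lam • D k i)
    (hD0 : D 0 = mixing W fun i => b 0 i (w 0 i) + ε 0 i)
    (hD : ∀ k, D (k + 1) = mixing W fun i => D k i + (b (k + 1) i (w (k + 1) i) + ε (k + 1) i)
      - (b k i (w k i) + ε k i)) (K : ℕ) :
    (1 - ρ) ^ 4 * ∑ k ∈ Finset.range (K + 1), dev (w k)
      ≤ 2 * (1 - ρ) ^ 3 * dev (w 0) + 4 * lam ^ 2 *
        (dev (D 0) + 16 * m₀ ^ 2 * dev (mixing W fun i => a i (mean (w 0)))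
          + (32 + 2 * q) * ∑ k ∈ Finset.range (K + 1), msq (ε k)
          + 4 * q * C * lam ^ 2 * ∑ k ∈ Finset.range (K + 1), R k (mean (w k))) := by
  have hρ : 0 < 1 - ρ := by linarith [hW.lt_one]
  have hρ1 : 1 - ρ ≤ 1 := by linarith [hW.nonneg]
  have hmean := mean_tracker hW (D := D) (Dh := fun k i => b k i (w k i) + ε k i) hD0 hD
  have hinc : ∀ k, mean (w (k + 1)) - mean (w k) = -(lam • mean (D k)) := fun k => by
    rw [hw, hW.mean_mixing, mean_sub, mean_smul]; abel
  have hinc2 : ∀ k, ‖mean (w (k + 1)) - mean (w k)‖ ^ 2 = lam ^ 2 * ‖mean (D k)‖ ^ 2 := fun k => by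
    rw [hinc, norm_neg, norm_smul, mul_pow, Real.norm_eq_abs, sq_abs]
  have hN : ∀ k, ‖mean (D k)‖ ^ 2
      ≤ 4 * C * R k (mean (w k)) + 4 * ℓ ^ 2 * dev (w k) + 2 * msq (ε k) := fun k => by
    rw [hmean, mean_add]
    have := norm_add_sq_le_two (mean fun i => b k i (w k i)) (mean (ε k))
    have := h.norm_mean_direction_le hn k (w k)
    have := norm_mean_sq_le_msq hn (ε k)
    linarith
  have hΔ : ∀ k, dev (w (k + 1)) ≤ ρ * dev (w k) + 2 * lam ^ 2 / (1 - ρ) * dev (D k) := by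
    intro k
    have e1 : w (k + 1) = fun i => mixing W (w k) i + (-lam) • mixing W (D k) i := by
      rw [hw, mixing_sub, mixing_smul]; ext i; simp [sub_eq_add_neg]
    have e2 := hW.dev_mixing_add_le hn (w k) (fun i => (-lam) • mixing W (D k) i)
    rw [← e1, dev_smul, neg_sq] at e2
    refine e2.trans ?_
    rw [show 2 * lam ^ 2 / (1 - ρ) * dev (D k) = 2 / (1 - ρ) * (lam ^ 2 * dev (D k)) by ring]
    gcongr
    exact hW.dev_mixing_le hn _
  set φ : ℕ → ℝ := fun k => dev (mixing W fun i => a i (mean (w k))) with hφ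
  set ψ : ℕ → ℝ := fun k => φ k / (((k : ℝ) + 1) * (k + 2)) with hψ
  have hψ0 : ∀ k, 0 ≤ ψ k := fun k => div_nonneg (dev_nonneg _) (by positivity)
  have hY : ∀ k, dev (D (k + 1)) ≤ ρ * dev (D k) + 2 / (1 - ρ) * (4 * m₀ ^ 2 * ψ (k + 1)
      + 8 * ((m₀ ^ 2 * ℓ ^ 2 + 4 * ℓ ^ 2) * dev (w (k + 1)) + 4 * ℓ ^ 2 * dev (w k)
        + 4 * ℓ ^ 2 * lam ^ 2 * ‖mean (D k)‖ ^ 2 + msq (ε (k + 1)) + msq (ε k))) := by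
    intro k
    have e1 := dev_tracker_step hW hn (c := c) (κ := (k : ℝ) + 2)
      (by have : (0 : ℝ) ≤ k := k.cast_nonneg
          linarith) ha
      (fun i z z' => by rw [← hb, ← hb]; exact h.lip k i z z') (hm k) (D k) (w k) (w (k + 1))
      (ε k) (ε (k + 1))
    rw [hD]
    simp_rw [hb]
    refine e1.trans ?_
    -- The squared penalty increment 1/(k+2)² is at most 2/((k+2)(k+3)), which is twice the weight
    -- of index k + 1 in `sum_heterogeneity_le`.
    have e2 : φ (k + 1) / ((k : ℝ) + 2) ^ 2 ≤ 2 * ψ (k + 1) := by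
      have : 0 ≤ φ (k + 1) := dev_nonneg _
      rw [hψ, ← mul_div_assoc, div_le_div_iff₀ (by positivity) (by positivity)]
      push_cast
      have : (0 : ℝ) ≤ k := k.cast_nonneg
      have e3 : ((k : ℝ) + 1 + 1) * (k + 1 + 2) ≤ 2 * ((k : ℝ) + 2) ^ 2 := by nlinarith
      have := mul_le_mul_of_nonneg_left e3 (show 0 ≤ φ (k + 1) by assumption)
      linarith
    rw [hinc2]
    gcongr ρ * _ + _ * ?_
    have := mul_le_mul_of_nonneg_left e2 (show 0 ≤ 2 * m₀ ^ 2 by positivity)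
    linarith
  set T := Finset.range (K + 1)
  set SΔ := ∑ k ∈ T, dev (w k) with hSΔ
  set SY := ∑ k ∈ T, dev (D k)
  set SE := ∑ k ∈ T, msq (ε k) with hSE
  set SR := ∑ k ∈ T, R k (mean (w k))
  set SN := ∑ k ∈ T, ‖mean (D k)‖ ^ 2 with hSN
  set Sψ := ∑ k ∈ T, ψ k with hSψ
  have shift : ∀ f : ℕ → ℝ, (∀ k, 0 ≤ f k) → ∑ k ∈ Finset.range K, f (k + 1) ≤ ∑ k ∈ T, f k :=
    fun f hf => by rw [Finset.sum_range_succ']; linarith [hf 0]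
  have trunc : ∀ f : ℕ → ℝ, (∀ k, 0 ≤ f k) → ∑ k ∈ Finset.range K, f k ≤ ∑ k ∈ T, f k :=
    fun f hf => by rw [Finset.sum_range_succ]; linarith [hf K]
  -- Two nested contractions, one for the states and one for the trackers, each lose (1 - ρ)²: one
  -- factor from the summation and one from the forcing term. This is the origin of (1 - ρ)⁴.
  have s1 : (1 - ρ) * SΔ ≤ dev (w 0) + 2 * lam ^ 2 / (1 - ρ) * SY := by
    have := sum_contraction (a := fun k => dev (w k))
      (c := fun k => 2 * lam ^ 2 / (1 - ρ) * dev (D k)) hΔ (K + 1)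
    rw [← Finset.mul_sum] at this
    linarith [dev_nonneg (w (K + 1))]
  have s2 : (1 - ρ) * SY ≤ dev (D 0) + 2 / (1 - ρ) * (4 * m₀ ^ 2 * Sψ
      + 8 * ((m₀ ^ 2 * ℓ ^ 2 + 8 * ℓ ^ 2) * SΔ + 4 * ℓ ^ 2 * lam ^ 2 * SN + 2 * SE)) := by
    have e1 := sum_contraction (a := fun k => dev (D k)) (c := fun k =>
      2 / (1 - ρ) * (4 * m₀ ^ 2 * ψ (k + 1)
      + 8 * ((m₀ ^ 2 * ℓ ^ 2 + 4 * ℓ ^ 2) * dev (w (k + 1)) + 4 * ℓ ^ 2 * dev (w k)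
        + 4 * ℓ ^ 2 * lam ^ 2 * ‖mean (D k)‖ ^ 2 + msq (ε (k + 1)) + msq (ε k)))) hY K
    -- The tracker recursion is summed over K steps while `SY` has K + 1 terms. The boundary term of
    -- `sum_contraction` supplies the last one.
    have e2 : (1 - ρ) * dev (D K) ≤ dev (D K) := by
      nlinarith [dev_nonneg (D K)]
    have e3 : SY = ∑ k ∈ Finset.range K, dev (D k) + dev (D K) := Finset.sum_range_succ _ _
    have e4 : (1 - ρ) * SY ≤ (1 - ρ) * ∑ k ∈ Finset.range K, dev (D k) + dev (D K) := by
      rw [e3, mul_add]; linarith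
    refine (e4.trans e1).trans ?_
    rw [← Finset.mul_sum, Finset.sum_add_distrib, ← Finset.mul_sum, ← Finset.mul_sum,
      Finset.sum_add_distrib, Finset.sum_add_distrib, Finset.sum_add_distrib,
      Finset.sum_add_distrib, ← Finset.mul_sum, ← Finset.mul_sum, ← Finset.mul_sum]
    have g1 := shift ψ hψ0
    have g2 := shift (fun k => dev (w k)) fun k => dev_nonneg _
    have g3 := trunc (fun k => dev (w k)) fun k => dev_nonneg _
    have g4 := trunc (fun k => ‖mean (D k)‖ ^ 2) fun k => by positivity
    have g5 := shift (fun k => msq (ε k)) fun k => msq_nonneg _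
    have g6 := trunc (fun k => msq (ε k)) fun k => msq_nonneg _
    gcongr dev (D 0) + 2 / (1 - ρ) * (4 * m₀ ^ 2 * ?_ + 8 * ?_)
    have g7 := mul_le_mul_of_nonneg_left g2 (show 0 ≤ m₀ ^ 2 * ℓ ^ 2 + 4 * ℓ ^ 2 by positivity)
    have g8 := mul_le_mul_of_nonneg_left g3 (show 0 ≤ 4 * ℓ ^ 2 by positivity)
    have g9 := mul_le_mul_of_nonneg_left g4 (show 0 ≤ 4 * ℓ ^ 2 * lam ^ 2 by positivity)
    rw [← hSΔ] at g7 g8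
    rw [← hSN] at g9
    rw [← hSE] at g5 g6
    linarith
  have s3 : Sψ ≤ 2 * φ 0 + 4 * ℓ ^ 2 * (lam ^ 2 * SN) := by
    have := sum_heterogeneity_le hW hn ha (fun k => mean (w k)) (K + 1)
    simp_rw [hinc2] at this
    rw [← Finset.mul_sum] at this
    exact this
  have s4 : SN ≤ 4 * C * SR + 4 * ℓ ^ 2 * SΔ + 2 * SE := by
    rw [Finset.mul_sum, Finset.mul_sum, Finset.mul_sum, ← Finset.sum_add_distrib,
      ← Finset.sum_add_distrib]
    exact Finset.sum_le_sum fun k _ => hN k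
  have hSΔ0 : 0 ≤ SΔ := Finset.sum_nonneg fun k _ => dev_nonneg _
  have hSE0 : 0 ≤ SE := Finset.sum_nonneg fun k _ => msq_nonneg _
  have hSN0 : 0 ≤ SN := Finset.sum_nonneg fun k _ => by positivity
  have hD00 := dev_nonneg (D 0)
  have hq0 : 0 ≤ q := by rw [hq]; positivity
  have hlam2 : lam ^ 2 ≤ 1 := by nlinarith
  -- The constant q dominates both coefficients that arise: 16 m₀² ℓ² + 128 ℓ² for `SΔ` and 32 m₀²
  -- ℓ² + 64 ℓ² for lam² · `SN`.
  have t1 : (1 - ρ) ^ 2 * SY ≤ dev (D 0) + 16 * m₀ ^ 2 * φ 0 + 32 * SE + q * SΔ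
      + q * lam ^ 2 * SN := by
    have e1 := mul_le_mul_of_nonneg_left s2 hρ.le
    have e2 : (1 - ρ) * (dev (D 0) + 2 / (1 - ρ) * (4 * m₀ ^ 2 * Sψ
      + 8 * ((m₀ ^ 2 * ℓ ^ 2 + 8 * ℓ ^ 2) * SΔ + 4 * ℓ ^ 2 * lam ^ 2 * SN + 2 * SE)))
      = (1 - ρ) * dev (D 0) + 2 * (4 * m₀ ^ 2 * Sψ
      + 8 * ((m₀ ^ 2 * ℓ ^ 2 + 8 * ℓ ^ 2) * SΔ + 4 * ℓ ^ 2 * lam ^ 2 * SN + 2 * SE)) := by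
      field_simp
    have e3 := mul_le_mul_of_nonneg_left s3 (show 0 ≤ m₀ ^ 2 by positivity)
    have e4 := mul_le_mul_of_nonneg_right hρ1 hD00
    have e5 : 0 ≤ m₀ ^ 2 * ℓ ^ 2 * SΔ := by positivity
    have e6 : 0 ≤ ℓ ^ 2 * lam ^ 2 * SN := by positivity
    rw [hq]
    linarith
  have t2 : q * lam ^ 2 * SN ≤ 4 * q * C * lam ^ 2 * SR + q * (4 * ℓ ^ 2) * SΔ + 2 * q * SE := by
    have e1 := mul_le_mul_of_nonneg_left s4 (show 0 ≤ q * lam ^ 2 by positivity)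
    have e2 := mul_le_mul_of_nonneg_right hlam2
      (show 0 ≤ q * (4 * ℓ ^ 2 * SΔ + 2 * SE) by positivity)
    linarith
  have t3 : (1 - ρ) ^ 4 * SΔ ≤ (1 - ρ) ^ 3 * dev (w 0) + 2 * lam ^ 2 * ((1 - ρ) ^ 2 * SY) := by
    have e1 := mul_le_mul_of_nonneg_left s1 (show 0 ≤ (1 - ρ) ^ 3 by positivity)
    have e2 : (1 - ρ) ^ 3 * (dev (w 0) + 2 * lam ^ 2 / (1 - ρ) * SY)
      = (1 - ρ) ^ 3 * dev (w 0) + 2 * lam ^ 2 * ((1 - ρ) ^ 2 * SY) := by field_simp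
    linarith
  have t4 := mul_le_mul_of_nonneg_left (t1.trans (add_le_add_right t2 _))
    (show 0 ≤ 2 * lam ^ 2 by positivity)
  -- The disagreement returns on the right with coefficient 2 lam² q (1 + 4ℓ²), which is at most
  -- half of (1 - ρ)⁴. Absorbing it doubles the other constants.
  have t5 := mul_le_mul_of_nonneg_right hlamq hSΔ0
  have t6 : dev (mixing W fun i => a i (mean (w 0))) = φ 0 := rfl
  rw [t6]
  linarith

set_option maxHeartbeats 1000000 in
/-- Decentralized gradient tracking, along a sample path. -/
theorem path_bound_gt (h : Landscape Φ gΦ R b κ C ℓ L) (hW : IsGossip H W ρ) (hn : 0 < n)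
    (hκ : 0 < κ) (hC : 0 < C) (hL : 0 ≤ L) {a c : Fin n → H → H} {m : ℕ → ℝ} {m₀ : ℝ}
    (hb : ∀ k i z, b k i z = m k • a i z + c i z)
    (ha : ∀ i w w', ‖a i w - a i w'‖ ≤ ℓ * ‖w - w'‖)
    (hm : ∀ k : ℕ, |m (k + 1) - m k| ≤ m₀ / ((k : ℝ) + 2))
    {lam lb q M : ℝ} (hlam : 0 < lam) (hlb : lam ≤ lb * (1 - ρ) ^ 4) (hlb1 : lb ≤ 1)
    (hlbC : 16 * L * C * lb ≤ κ)
    (hq : q = 32 * m₀ ^ 2 * ℓ ^ 2 + 128 * ℓ ^ 2) (hM : M = (C / κ + 4 * L) * ℓ ^ 2)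
    (hlbq : 4 * (q * (1 + 4 * ℓ ^ 2)) * lb ≤ 1) (hlbM : 64 * (M * q * C) * lb ≤ κ)
    (w D ε : ℕ → Fin n → H)
    (hw : ∀ k, w (k + 1) = mixing W fun i => w k i - lam • D k i)
    (hD0 : D 0 = mixing W fun i => b 0 i (w 0 i) + ε 0 i)
    (hD : ∀ k, D (k + 1) = mixing W fun i => D k i + (b (k + 1) i (w (k + 1) i) + ε (k + 1) i)
      - (b k i (w k i) + ε k i)) (K : ℕ) :
    lam * (κ / 4) * ∑ k ∈ Finset.range (K + 1), R k (mean (w k))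
      + lam * ∑ k ∈ Finset.range (K + 1), inner ℝ (gΦ k (mean (w k))) (mean (ε k))
      ≤ Φ 0 (mean (w 0)) + 2 * M * dev (w 0)
        + 4 * M * (dev (D 0) + 16 * m₀ ^ 2 * dev (mixing W fun i => a i (mean (w 0))))
        + 4 * M * (32 + 2 * q) * (lam ^ 3 / (1 - ρ) ^ 4) * ∑ k ∈ Finset.range (K + 1), msq (ε k)
        + 2 * L * lam ^ 2 * ∑ k ∈ Finset.range (K + 1), ‖mean (ε k)‖ ^ 2 := by
  have hρ : 0 < 1 - ρ := by linarith [hW.lt_one]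
  have hρ1 : 1 - ρ ≤ 1 := by linarith [hW.nonneg]
  have hp4 : 0 < (1 - ρ) ^ 4 := by positivity
  have hp41 : (1 - ρ) ^ 4 ≤ 1 := pow_le_one₀ hρ.le hρ1
  have hlb0 : 0 < lb := by
    by_contra hc
    have : lb * (1 - ρ) ^ 4 ≤ 0 := mul_nonpos_of_nonpos_of_nonneg (not_lt.mp hc) hp4.le
    linarith
  have hlamlb : lam ≤ lb := hlb.trans (by nlinarith)
  have hlam1 : lam ≤ 1 := hlamlb.trans hlb1
  have hM0 : 0 ≤ M := by rw [hM]; positivity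
  have hq0 : 0 ≤ q := by rw [hq]; positivity
  have hmean := mean_tracker hW (D := D) (Dh := fun k i => b k i (w k i) + ε k i) hD0 hD
  have hd := h.descent_sum hn hκ hC hL hlam hlam1
    ((mul_le_mul_of_nonneg_left hlamlb (by positivity)).trans hlbC) w ε (fun k => by
      rw [hw, hW.mean_mixing, mean_sub, mean_smul, hmean]) (K + 1)
  rw [← hM] at hd
  have hlamq : 4 * (q * (1 + 4 * ℓ ^ 2)) * lam ^ 2 ≤ (1 - ρ) ^ 4 := by
    have e1 : lam ^ 2 ≤ lb * (1 - ρ) ^ 4 := by nlinarith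
    have e2 := mul_le_mul_of_nonneg_left e1 (show 0 ≤ 4 * (q * (1 + 4 * ℓ ^ 2)) by positivity)
    have e3 := mul_le_mul_of_nonneg_right hlbq hp4.le
    linarith
  have hc := h.consensus_sum_gt hW hn hb ha hm hlam hlam1 hq hlamq w D ε hw hD0 hD K
  set SΔ := ∑ k ∈ Finset.range (K + 1), dev (w k)
  set SE := ∑ k ∈ Finset.range (K + 1), msq (ε k) with hSE
  set SR := ∑ k ∈ Finset.range (K + 1), R k (mean (w k)) with hSR
  set φ0 := dev (mixing W fun i => a i (mean (w 0))) with hφ0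
  have hSE0 : 0 ≤ SE := Finset.sum_nonneg fun k _ => msq_nonneg _
  have hSR0 : 0 ≤ SR := Finset.sum_nonneg fun k _ => h.R_nonneg _ _
  have hφ00 : 0 ≤ φ0 := dev_nonneg _
  have hD00 := dev_nonneg (D 0)
  have hw00 := dev_nonneg (w 0)
  -- Multiplying the consensus bound by t recovers lam · `SΔ` on the left. As t ≤ lb ≤ 1, the
  -- initial terms lose their dependence on ρ and only the noise keeps lam³/(1 - ρ)⁴.
  set t := lam / (1 - ρ) ^ 4 with ht
  have ht0 : 0 < t := by positivity
  have htlb : t ≤ lb := by rw [ht, div_le_iff₀ hp4]; exact hlb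
  have ht1 : t ≤ 1 := htlb.trans hlb1
  have hc' : lam * SΔ ≤ 2 * dev (w 0) + 4 * (dev (D 0) + 16 * m₀ ^ 2 * φ0)
      + 4 * (32 + 2 * q) * (lam ^ 3 / (1 - ρ) ^ 4) * SE + 16 * q * C * lb * lam * SR := by
    have e1 := mul_le_mul_of_nonneg_left hc ht0.le
    have e2 : t * ((1 - ρ) ^ 4 * SΔ) = lam * SΔ := by rw [ht]; field_simp
    have e3 : t * (2 * (1 - ρ) ^ 3 * dev (w 0)) ≤ 2 * dev (w 0) := by
      have : t * (1 - ρ) ^ 3 ≤ 1 * 1 :=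
        mul_le_mul ht1 (pow_le_one₀ hρ.le hρ1) (by positivity) zero_le_one
      linarith [mul_le_mul_of_nonneg_right this (show 0 ≤ 2 * dev (w 0) by positivity)]
    have e4 : t * lam ^ 2 ≤ 1 := by
      have : t * lam ^ 2 ≤ 1 * 1 :=
        mul_le_mul ht1 (pow_le_one₀ hlam.le hlam1) (by positivity) zero_le_one
      linarith
    have e5 := mul_le_mul_of_nonneg_right e4
      (show 0 ≤ 4 * (dev (D 0) + 16 * m₀ ^ 2 * φ0) by positivity)
    have e6 : t * lam ^ 2 = lam ^ 3 / (1 - ρ) ^ 4 := by rw [ht]; ring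
    have e7 : t * lam ^ 4 ≤ lb * lam := by
      have : lam ^ 4 ≤ lam := by
        have : lam ^ 3 ≤ 1 := pow_le_one₀ hlam.le hlam1
        nlinarith
      exact mul_le_mul htlb this (by positivity) hlb0.le
    have e8 := mul_le_mul_of_nonneg_right e7 (show 0 ≤ 16 * q * C * SR by positivity)
    rw [e2] at e1
    rw [← e6]
    linarith
  have e1 := mul_le_mul_of_nonneg_left hc' hM0
  -- Tracking feeds part of the residual sum back. The restriction 64 M q C lb ≤ κ limits it to lam
  -- κ/4, so κ/2 drops to κ/4.
  have e2 := mul_le_mul_of_nonneg_right hlbM (show 0 ≤ lam * SR / 4 by positivity)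
  linarith

end Landscape
end Tracking

/-! ### Independence of the noise from the past -/

section Noise

variable {Ω : Type*} [mΩ : MeasurableSpace Ω] {Pr : Measure Ω} [IsProbabilityMeasure Pr]
variable {H : Type*} [NormedAddCommGroup H] [InnerProductSpace ℝ H] [FiniteDimensional ℝ H]
  [MeasurableSpace H] [BorelSpace H]

theorem integrable_inner_of_sq {U V : Ω → H} (hU : Measurable U) (hV : Measurable V)
    (hU2 : Integrable (fun ω => ‖U ω‖ ^ 2) Pr) (hV2 : Integrable (fun ω => ‖V ω‖ ^ 2) Pr) :
    Integrable (fun ω => inner ℝ (U ω) (V ω)) Pr := by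
  have : CompleteSpace H := FiniteDimensional.complete ℝ H
  refine (hU2.add hV2).mono' (hU.inner hV).aestronglyMeasurable (ae_of_all _ fun ω => ?_)
  have := norm_inner_le_norm (𝕜 := ℝ) (U ω) (V ω)
  simp only [Pi.add_apply]
  nlinarith [sq_nonneg (‖U ω‖ - ‖V ω‖), norm_nonneg (U ω), norm_nonneg (V ω)]

/-- By independence the joint law is a product, so Fubini integrates a bound valid for every frozen
value of X. -/
theorem second_moment_le {A B : Type*} [MeasurableSpace A] [MeasurableSpace B] {X : Ω → A}
    {Y : Ω → B} (hX : Measurable X) (hY : Measurable Y) (hXY : IndepFun X Y Pr) {e : A × B → H}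
    (he : Measurable e) {v : ℝ}
    (hint : ∀ x, Integrable (fun y => ‖e (x, y)‖ ^ 2) (Pr.map Y))
    (hv : ∀ x, ∫ y, ‖e (x, y)‖ ^ 2 ∂(Pr.map Y) ≤ v) :
    Integrable (fun ω => ‖e (X ω, Y ω)‖ ^ 2) Pr ∧ ∫ ω, ‖e (X ω, Y ω)‖ ^ 2 ∂Pr ≤ v := by
  have : IsProbabilityMeasure (Pr.map X) := Measure.isProbabilityMeasure_map hX.aemeasurable
  have : IsProbabilityMeasure (Pr.map Y) := Measure.isProbabilityMeasure_map hY.aemeasurable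
  have hprod := (indepFun_iff_map_prod_eq_prod_map_map hX.aemeasurable hY.aemeasurable).mp hXY
  have hm : Measurable fun q : A × B => ‖e q‖ ^ 2 := he.norm.pow_const 2
  have hp : Integrable (fun q : A × B => ‖e q‖ ^ 2) ((Pr.map X).prod (Pr.map Y)) := by
    rw [integrable_prod_iff hm.aestronglyMeasurable]
    refine ⟨ae_of_all _ hint, ?_⟩
    refine (integrable_const v).mono'
      hm.norm.stronglyMeasurable.integral_prod_right.aestronglyMeasurable
      (ae_of_all _ fun x => ?_)
    rw [Real.norm_of_nonneg (integral_nonneg fun _ => norm_nonneg _)]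
    simpa using hv x
  constructor
  · rw [← hprod] at hp
    exact hp.comp_measurable (hX.prodMk hY)
  · have h1 : ∫ ω, ‖e (X ω, Y ω)‖ ^ 2 ∂Pr
        = ∫ q, ‖e q‖ ^ 2 ∂(Pr.map fun ω => (X ω, Y ω)) :=
      (integral_map (hX.prodMk hY).aemeasurable hm.aestronglyMeasurable).symm
    rw [h1, hprod, integral_prod _ hp]
    calc _ ≤ ∫ _, v ∂(Pr.map X) := integral_mono hp.integral_prod_left (integrable_const v) hv
      _ = v := by simp

/-- Freeze the pair (U, X) and integrate over Y first: the inner integral is ⟪U, 0⟫. U is separate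
from X because the gradient of the potential is taken at the average while the noise is taken at an
agent's own state. -/
theorem integral_inner_eq_zero {A B : Type*} [MeasurableSpace A] [MeasurableSpace B] {X : Ω → A}
    {Y : Ω → B} {U : Ω → H} (hX : Measurable X) (hY : Measurable Y) (hU : Measurable U)
    (hXY : IndepFun (fun ω => (U ω, X ω)) Y Pr) {e : A × B → H} (he : Measurable e)
    (hint : ∀ x, Integrable (fun y => e (x, y)) (Pr.map Y))
    (h0 : ∀ x, ∫ y, e (x, y) ∂(Pr.map Y) = 0)
    (hU2 : Integrable (fun ω => ‖U ω‖ ^ 2) Pr)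
    (he2 : Integrable (fun ω => ‖e (X ω, Y ω)‖ ^ 2) Pr) :
    ∫ ω, inner ℝ (U ω) (e (X ω, Y ω)) ∂Pr = 0 := by
  have : CompleteSpace H := FiniteDimensional.complete ℝ H
  have hUX := hU.prodMk hX
  have : IsProbabilityMeasure (Pr.map fun ω => (U ω, X ω)) :=
    Measure.isProbabilityMeasure_map hUX.aemeasurable
  have : IsProbabilityMeasure (Pr.map Y) := Measure.isProbabilityMeasure_map hY.aemeasurable
  have hprod := (indepFun_iff_map_prod_eq_prod_map_map hUX.aemeasurable hY.aemeasurable).mp hXY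
  have hm : Measurable fun q : (H × A) × B => inner ℝ q.1.1 (e (q.1.2, q.2)) :=
    (by fun_prop : Measurable fun q : (H × A) × B => q.1.1).inner
      (he.comp (by fun_prop))
  have hp : Integrable (fun q : (H × A) × B => inner ℝ q.1.1 (e (q.1.2, q.2)))
      ((Pr.map fun ω => (U ω, X ω)).prod (Pr.map Y)) := by
    rw [← hprod, integrable_map_measure hm.aestronglyMeasurable (hUX.prodMk hY).aemeasurable]
    exact integrable_inner_of_sq hU (he.comp (hX.prodMk hY)) hU2 he2
  have h1 : ∫ ω, inner ℝ (U ω) (e (X ω, Y ω)) ∂Pr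
      = ∫ q : (H × A) × B, inner ℝ q.1.1 (e (q.1.2, q.2))
        ∂(Pr.map fun ω => ((U ω, X ω), Y ω)) :=
    (integral_map (hUX.prodMk hY).aemeasurable hm.aestronglyMeasurable).symm
  rw [h1, hprod, integral_prod _ hp]
  simp_rw [integral_inner (hint _), h0, inner_zero_right, integral_zero]

/-- The `σ`-algebra of the samples drawn before iteration `k`. -/
abbrev past {n : ℕ} {S : Type*} [MeasurableSpace S] (ξ : Fin n × ℕ → Ω → S) (k : ℕ) :
    MeasurableSpace Ω :=
  ⨆ q ∈ {q : Fin n × ℕ | q.2 < k}, MeasurableSpace.comap (ξ q) inferInstance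

/-! ### The filtration of the samples and the moments of the averaged noise -/

section Past

variable {n : ℕ} {S : Type*} [mS : MeasurableSpace S] {ξ : Fin n × ℕ → Ω → S}

theorem past_mono {k l : ℕ} (h : k ≤ l) : past ξ k ≤ past ξ l :=
  biSup_mono fun _ hq => lt_of_lt_of_le hq h

theorem measurable_past_sample (i : Fin n) (k : ℕ) : Measurable[past ξ (k + 1)] (ξ (i, k)) :=
  Measurable.of_comap_le (le_biSup (fun q => MeasurableSpace.comap (ξ q) mS)
    (show (i, k) ∈ {q : Fin n × ℕ | q.2 < k + 1} from Nat.lt_succ_self k))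

theorem past_le (hξ : ∀ q, Measurable (ξ q)) (k : ℕ) : past ξ k ≤ mΩ :=
  iSup₂_le fun q _ => (hξ q).comap_le

/-- Independence is taken from all other samples, not only from the earlier ones: the cross terms
between agents need the samples of the same iteration as well. -/
theorem indepFun_of_measurable_rest (hξ : ∀ q, Measurable (ξ q)) (hind : iIndepFun ξ Pr)
    (q : Fin n × ℕ) {A : Type*} [MeasurableSpace A] {X : Ω → A}
    (hX : Measurable[⨆ r ∈ {r : Fin n × ℕ | r ≠ q}, MeasurableSpace.comap (ξ r) mS] X) :
    IndepFun X (ξ q) Pr := by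
  rw [IndepFun_iff_Indep]
  have h := indep_iSup_of_disjoint (fun r => (hξ r).comap_le) hind.iIndep
    (show Disjoint {r : Fin n × ℕ | r ≠ q} {q} by simp)
  simp only [Set.mem_singleton_iff, iSup_iSup_eq_left] at h
  exact indep_of_indep_of_le_left h hX.comap_le

theorem past_le_rest {k : ℕ} (i : Fin n) :
    past ξ k ≤ ⨆ r ∈ {r : Fin n × ℕ | r ≠ (i, k)}, MeasurableSpace.comap (ξ r) mS :=
  biSup_mono fun r hr => by
    rintro rfl; exact lt_irrefl k hr

theorem measurable_rest_sample {i j : Fin n} {k : ℕ} (hij : j ≠ i) :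
    Measurable[⨆ r ∈ {r : Fin n × ℕ | r ≠ (i, k)}, MeasurableSpace.comap (ξ r) mS] (ξ (j, k)) :=
  Measurable.of_comap_le (le_biSup (fun q => MeasurableSpace.comap (ξ q) mS)
    (show (j, k) ∈ {r : Fin n × ℕ | r ≠ (i, k)} by simp [hij]))

/-- Unbiased noise `e k i z s`, of second moment at most `v`, at the point `z` and sample `s`. -/
structure IsNoise (Pr : Measure Ω) (ξ : Fin n × ℕ → Ω → S) (e : ℕ → Fin n → H → S → H) (v : ℝ) :
    Prop where
  meas_sample : ∀ q, Measurable (ξ q)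
  indep : iIndepFun ξ Pr
  meas : ∀ k i, Measurable fun q : H × S => e k i q.1 q.2
  integrable : ∀ k i z, Integrable (e k i z) (Pr.map (ξ (i, k)))
  mean_zero : ∀ k i z, ∫ s, e k i z s ∂(Pr.map (ξ (i, k))) = 0
  sq_integrable : ∀ k i z, Integrable (fun s => ‖e k i z s‖ ^ 2) (Pr.map (ξ (i, k)))
  sq_le : ∀ k i z, ∫ s, ‖e k i z s‖ ^ 2 ∂(Pr.map (ξ (i, k))) ≤ v

namespace IsNoise

variable {e : ℕ → Fin n → H → S → H} {v : ℝ}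

theorem second_moment (hN : IsNoise Pr ξ e v) {k : ℕ} (i : Fin n) {X : Ω → H}
    (hX : Measurable[past ξ k] X) :
    Integrable (fun ω => ‖e k i (X ω) (ξ (i, k) ω)‖ ^ 2) Pr ∧
      ∫ ω, ‖e k i (X ω) (ξ (i, k) ω)‖ ^ 2 ∂Pr ≤ v :=
  second_moment_le (e := fun q : H × S => e k i q.1 q.2)
    (hX.mono (past_le hN.meas_sample k) le_rfl) (hN.meas_sample _)
    (indepFun_of_measurable_rest hN.meas_sample hN.indep (i, k)
      (hX.mono (past_le_rest i) le_rfl)) (hN.meas k i) (hN.sq_integrable k i) (hN.sq_le k i)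

theorem inner_past (hN : IsNoise Pr ξ e v) {k : ℕ} (i : Fin n) {X U : Ω → H}
    (hX : Measurable[past ξ k] X) (hU : Measurable[past ξ k] U)
    (hU2 : Integrable (fun ω => ‖U ω‖ ^ 2) Pr) :
    ∫ ω, inner ℝ (U ω) (e k i (X ω) (ξ (i, k) ω)) ∂Pr = 0 :=
  integral_inner_eq_zero (e := fun q : H × S => e k i q.1 q.2)
    (hX.mono (past_le hN.meas_sample k) le_rfl) (hN.meas_sample _)
    (hU.mono (past_le hN.meas_sample k) le_rfl)
    (indepFun_of_measurable_rest hN.meas_sample hN.indep (i, k)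
      ((hU.mono (past_le_rest i) le_rfl).prodMk (hX.mono (past_le_rest i) le_rfl)))
    (hN.meas k i) (hN.integrable k i) (hN.mean_zero k i) hU2 (hN.second_moment i hX).1

/-- The noise of agent j is treated as known: it depends on the past and on a sample other than that
of agent i, so it can play the role of U. -/
theorem inner_other (hN : IsNoise Pr ξ e v) {k : ℕ} {i j : Fin n} (hij : j ≠ i) {X Y : Ω → H}
    (hX : Measurable[past ξ k] X) (hY : Measurable[past ξ k] Y) :
    ∫ ω, inner ℝ (e k j (Y ω) (ξ (j, k) ω)) (e k i (X ω) (ξ (i, k) ω)) ∂Pr = 0 := by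
  have hX' := hX.mono (past_le hN.meas_sample k) le_rfl
  have hY' := hY.mono (past_le hN.meas_sample k) le_rfl
  have hU : Measurable[⨆ r ∈ {r : Fin n × ℕ | r ≠ (i, k)}, MeasurableSpace.comap (ξ r) mS]
      (fun ω => e k j (Y ω) (ξ (j, k) ω)) :=
    (hN.meas k j).comp ((hY.mono (past_le_rest i) le_rfl).prodMk (measurable_rest_sample hij))
  exact integral_inner_eq_zero (e := fun q : H × S => e k i q.1 q.2)
    hX' (hN.meas_sample _)
    ((hN.meas k j).comp (hY'.prodMk (hN.meas_sample _)))
    (indepFun_of_measurable_rest hN.meas_sample hN.indep (i, k)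
      (hU.prodMk (hX.mono (past_le_rest i) le_rfl)))
    (hN.meas k i) (hN.integrable k i) (hN.mean_zero k i) (hN.second_moment j hY).1
    (hN.second_moment i hX).1

/-- Expanding the square leaves only the n diagonal terms out of n². This factor 1/n is the source
of the speedup in the number of agents. -/
theorem mean_sq (hN : IsNoise Pr ξ e v) {k : ℕ} {X : Fin n → Ω → H}
    (hX : ∀ i, Measurable[past ξ k] (X i)) :
    Integrable (fun ω => ‖mean fun i => e k i (X i ω) (ξ (i, k) ω)‖ ^ 2) Pr ∧
      ∫ ω, ‖mean fun i => e k i (X i ω) (ξ (i, k) ω)‖ ^ 2 ∂Pr ≤ v / n := by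
  have hX' := fun i => (hX i).mono (past_le hN.meas_sample k) le_rfl
  have hme : ∀ i, Measurable fun ω => e k i (X i ω) (ξ (i, k) ω) := fun i =>
    (hN.meas k i).comp ((hX' i).prodMk (hN.meas_sample _))
  have hexp : (fun ω => ‖mean fun i => e k i (X i ω) (ξ (i, k) ω)‖ ^ 2)
      = fun ω => (1 / (n : ℝ)) ^ 2 * ∑ i, ∑ j,
        inner ℝ (e k i (X i ω) (ξ (i, k) ω)) (e k j (X j ω) (ξ (j, k) ω)) := by
    ext ω
    simp only [mean]
    rw [norm_smul, mul_pow, ← real_inner_self_eq_norm_sq (∑ i, _), sum_inner]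
    simp_rw [inner_sum]
    simp
  have hint : ∀ i j, Integrable (fun ω =>
      inner ℝ (e k i (X i ω) (ξ (i, k) ω)) (e k j (X j ω) (ξ (j, k) ω))) Pr := fun i j =>
    integrable_inner_of_sq (hme i) (hme j) (hN.second_moment i (hX i)).1
      (hN.second_moment j (hX j)).1
  rw [hexp]
  refine ⟨Integrable.const_mul (integrable_finsetSum _ fun i _ =>
    integrable_finsetSum _ fun j _ => hint i j) _, ?_⟩
  rw [integral_const_mul, integral_finsetSum _ fun i _ =>
    integrable_finsetSum _ fun j _ => hint i j]
  have h1 : ∀ i, ∫ ω, ∑ j, inner ℝ (e k i (X i ω) (ξ (i, k) ω)) (e k j (X j ω) (ξ (j, k) ω)) ∂Pr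
      ≤ v := by
    intro i
    rw [integral_finsetSum _ fun j _ => hint i j, Finset.sum_eq_single i]
    · simp_rw [real_inner_self_eq_norm_sq]
      exact (hN.second_moment i (hX i)).2
    · intro j _ hji
      exact hN.inner_other hji.symm (hX j) (hX i)
    · simp
  calc (1 / (n : ℝ)) ^ 2 * ∑ i, _ ≤ (1 / (n : ℝ)) ^ 2 * ∑ _i : Fin n, v := by
        gcongr with i; exact h1 i
    _ = v / n := by
        simp only [Finset.sum_const, Finset.card_univ, Fintype.card_fin, nsmul_eq_mul]
        rcases eq_or_ne (n : ℝ) 0 with h | h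
        · simp [h]
        · field_simp

theorem inner_mean (hN : IsNoise Pr ξ e v) {k : ℕ} {X : Fin n → Ω → H} {U : Ω → H}
    (hX : ∀ i, Measurable[past ξ k] (X i)) (hU : Measurable[past ξ k] U)
    (hU2 : Integrable (fun ω => ‖U ω‖ ^ 2) Pr) :
    Integrable (fun ω => inner ℝ (U ω) (mean fun i => e k i (X i ω) (ξ (i, k) ω))) Pr ∧
      ∫ ω, inner ℝ (U ω) (mean fun i => e k i (X i ω) (ξ (i, k) ω)) ∂Pr = 0 := by
  have hX' := fun i => (hX i).mono (past_le hN.meas_sample k) le_rfl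
  have hme : ∀ i, Measurable fun ω => e k i (X i ω) (ξ (i, k) ω) := fun i =>
    (hN.meas k i).comp ((hX' i).prodMk (hN.meas_sample _))
  have hint : ∀ i, Integrable (fun ω => inner ℝ (U ω) (e k i (X i ω) (ξ (i, k) ω))) Pr := fun i =>
    integrable_inner_of_sq (hU.mono (past_le hN.meas_sample k) le_rfl) (hme i) hU2
      (hN.second_moment i (hX i)).1
  simp only [mean, inner_smul_right, inner_sum]
  refine ⟨(integrable_finsetSum _ fun i _ => hint i).const_mul _, ?_⟩
  rw [integral_const_mul, integral_finsetSum _ fun i _ => hint i]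
  simp [hN.inner_past _ (hX _) hU hU2]

theorem msq_noise (hN : IsNoise Pr ξ e v) (hn : 0 < n) {k : ℕ} {X : Fin n → Ω → H}
    (hX : ∀ i, Measurable[past ξ k] (X i)) :
    Integrable (fun ω => msq fun i => e k i (X i ω) (ξ (i, k) ω)) Pr ∧
      ∫ ω, msq (fun i => e k i (X i ω) (ξ (i, k) ω)) ∂Pr ≤ v := by
  have hint := fun i => (hN.second_moment i (hX i)).1
  simp only [msq]
  refine ⟨(integrable_finsetSum _ fun i _ => hint i).const_mul _, ?_⟩
  rw [integral_const_mul, integral_finsetSum _ fun i _ => hint i]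
  calc (1 / (n : ℝ)) * ∑ i, _ ≤ (1 / (n : ℝ)) * ∑ _i : Fin n, v := by
        gcongr with i; exact (hN.second_moment i (hX i)).2
    _ = v := by
        have : (n : ℝ) ≠ 0 := by positivity
        simp; field_simp

end IsNoise
end Past
end Noise

/-! ### Smooth functions on pairs and the Moreau envelope -/

section Pairs

variable {dx dy : ℕ}

theorem pair_fst_snd (z : Pair dx dy) : pair z.fst z.snd = z := rfl

@[simp] theorem fst_pair (x : Vec dx) (y : Vec dy) : (pair x y).fst = x := rfl

@[simp] theorem snd_pair (x : Vec dx) (y : Vec dy) : (pair x y).snd = y := rfl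

theorem pair_sub_pair (x x' : Vec dx) (y y' : Vec dy) :
    pair x y - pair x' y' = pair (x - x') (y - y') := rfl

theorem inner_eq_fst_add_snd (z w : Pair dx dy) :
    inner ℝ z w = inner ℝ z.fst w.fst + inner ℝ z.snd w.snd := WithLp.prod_inner_apply z w

theorem norm_sq_eq_fst_add_snd (z : Pair dx dy) : ‖z‖ ^ 2 = ‖z.fst‖ ^ 2 + ‖z.snd‖ ^ 2 :=
  WithLp.prod_norm_sq_eq_of_L2 z

theorem norm_fst_le (z : Pair dx dy) : ‖z.fst‖ ≤ ‖z‖ :=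
  (pow_le_pow_iff_left₀ (norm_nonneg _) (norm_nonneg _) two_ne_zero).mp (by
    rw [norm_sq_eq_fst_add_snd z]; nlinarith [sq_nonneg ‖z.snd‖])

theorem norm_snd_le (z : Pair dx dy) : ‖z.snd‖ ≤ ‖z‖ :=
  (pow_le_pow_iff_left₀ (norm_nonneg _) (norm_nonneg _) two_ne_zero).mp (by
    rw [norm_sq_eq_fst_add_snd z]; nlinarith [sq_nonneg ‖z.fst‖])

theorem norm_le_fst_add_snd (z : Pair dx dy) : ‖z‖ ≤ ‖z.fst‖ + ‖z.snd‖ :=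
  (pow_le_pow_iff_left₀ (norm_nonneg _) (by positivity) two_ne_zero).mp (by
    rw [norm_sq_eq_fst_add_snd z]; nlinarith [norm_nonneg z.fst, norm_nonneg z.snd])

theorem sub_fst (z w : Pair dx dy) : (z - w).fst = z.fst - w.fst := rfl

theorem sub_snd (z w : Pair dx dy) : (z - w).snd = z.snd - w.snd := rfl

theorem norm_fst_sub_fst_le (z w : Pair dx dy) : ‖z.fst - w.fst‖ ≤ ‖z - w‖ := norm_fst_le (z - w)

theorem norm_snd_sub_snd_le (z w : Pair dx dy) : ‖z.snd - w.snd‖ ≤ ‖z - w‖ := norm_snd_le (z - w)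

end Pairs

section Smooth

variable {dx dy : ℕ} {h : Pair dx dy → ℝ} {L : ℝ}

namespace IsSmooth

theorem hasGradientAt (hh : IsSmooth L h) (z : Pair dx dy) : HasGradientAt h (gradient h z) z :=
  ((hh.contDiff.differentiable one_ne_zero) z).hasGradientAt

/-- Mean value inequality on the segment for h minus its linear part at z, whose derivative is at
most L‖w - z‖ there. The constant L instead of L/2 suffices, and both signs are needed later. -/
theorem taylor (hh : IsSmooth L h) (hL : 0 ≤ L) (z w : Pair dx dy) :
    |h w - h z - inner ℝ (gradient h z) (w - z)| ≤ L * ‖w - z‖ ^ 2 := by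
  let φ : Pair dx dy → ℝ := fun u => h u - inner ℝ (gradient h z) u
  have hφ : ∀ u ∈ segment ℝ z w, HasFDerivWithinAt φ
      (innerSL ℝ (gradient h u) - innerSL ℝ (gradient h z)) (segment ℝ z w) u := by
    intro u _
    have h1 := (hh.hasGradientAt u).hasFDerivAt
    have h2 : HasFDerivAt (fun u => inner ℝ (gradient h z) u) (innerSL ℝ (gradient h z)) u :=
      (innerSL ℝ (gradient h z)).hasFDerivAt
    exact (h1.sub h2).hasFDerivWithinAt
  have hb : ∀ u ∈ segment ℝ z w,
      ‖innerSL ℝ (gradient h u) - innerSL ℝ (gradient h z)‖ ≤ L * ‖w - z‖ := by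
    intro u hu
    rw [← map_sub, innerSL_apply_norm]
    refine (hh.lipschitz u z).trans ?_
    gcongr
    exact norm_sub_le_of_mem_segment hu
  have := (convex_segment z w).norm_image_sub_le_of_norm_hasFDerivWithin_le hφ hb
    (left_mem_segment ℝ z w) (right_mem_segment ℝ z w)
  have e : φ w - φ z = h w - h z - inner ℝ (gradient h z) (w - z) := by
    simp only [φ, inner_sub_right]; ring
  rw [e, Real.norm_eq_abs] at this
  linarith

theorem continuous_gradient (hh : IsSmooth L h) : Continuous (gradient h) := by
  refine (LipschitzWith.of_dist_le_mul (K := ⟨max L 0, le_max_right _ _⟩) fun z w => ?_).continuous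
  rw [dist_eq_norm, dist_eq_norm]
  exact (hh.lipschitz z w).trans (by gcongr; exact le_max_left _ _)

theorem continuous (hh : IsSmooth L h) : Continuous h := hh.contDiff.continuous

end IsSmooth

theorem hasGradientAt_average {n : ℕ} {f : Fin n → Pair dx dy → ℝ}
    (hf : ∀ i, IsSmooth L (f i)) (z : Pair dx dy) :
    HasGradientAt (fun z => (1 / (n : ℝ)) * ∑ i, f i z) (mean fun i => gradient (f i) z) z := by
  rw [hasGradientAt_iff_hasFDerivAt]
  have h1 := (HasFDerivAt.fun_sum (u := Finset.univ)
    fun i _ => ((hf i).hasGradientAt z).hasFDerivAt).const_mul (1 / (n : ℝ))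
  simpa [mean] using! h1

theorem isSmooth_average {n : ℕ} (hn : 0 < n) {f : Fin n → Pair dx dy → ℝ}
    (hf : ∀ i, IsSmooth L (f i)) : IsSmooth L fun z => (1 / (n : ℝ)) * ∑ i, f i z where
  contDiff := contDiff_const.mul (ContDiff.sum fun i _ => (hf i).contDiff)
  lipschitz z w := by
    rw [(hasGradientAt_average hf z).gradient, (hasGradientAt_average hf w).gradient, ← mean_sub]
    have hn' : (n : ℝ) ≠ 0 := by positivity
    unfold mean
    rw [norm_smul]
    calc ‖1 / (n : ℝ)‖ * ‖∑ i, (gradient (f i) z - gradient (f i) w)‖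
        ≤ ‖1 / (n : ℝ)‖ * ∑ _i : Fin n, L * ‖z - w‖ := by
          gcongr
          exact norm_sum_le_of_le _ fun i _ => (hf i).lipschitz z w
      _ = L * ‖z - w‖ := by simp; field_simp

end Smooth

/-! ### The Moreau envelope: minimizer, gradient and expansion -/

section Moreau

variable {dx dy : ℕ} {G : Pair dx dy → ℝ} {L γ : ℝ}

/-- The objective defining the Moreau envelope of `G` in its second variable. -/
def moreauObj (G : Pair dx dy → ℝ) (γ : ℝ) (z : Pair dx dy) (θ : Vec dy) : ℝ :=
  G (pair z.fst θ) + 1 / (2 * γ) * ‖θ - z.snd‖ ^ 2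

/-- Partial gradient of `moreauObj` with respect to `θ`. -/
def moreauGrad (G : Pair dx dy → ℝ) (γ : ℝ) (z : Pair dx dy) (θ : Vec dy) : Vec dy :=
  (gradient G (pair z.fst θ)).snd + (1 / γ) • (θ - z.snd)

/-- Partial gradient of `moreauObj` with respect to `z`. -/
def moreauGradBase (G : Pair dx dy → ℝ) (γ : ℝ) (z : Pair dx dy) (θ : Vec dy) : Pair dx dy :=
  pair (gradient G (pair z.fst θ)).fst ((1 / γ) • (z.snd - θ))

/-- The proximal term is quadratic and is expanded exactly, so the remainder is that of G alone at
the points (x, θ). One joint expansion in z and θ yields all one-sided bounds below. -/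
theorem moreauObj_taylor (hG : IsSmooth L G) (hL : 0 ≤ L) (hγ : 0 < γ) (z z' : Pair dx dy)
    (θ θ' : Vec dy) :
    |moreauObj G γ z' θ' - moreauObj G γ z θ - inner ℝ (moreauGradBase G γ z θ) (z' - z)
      - inner ℝ (moreauGrad G γ z θ) (θ' - θ)
      - 1 / (2 * γ) * ‖(θ' - θ) - (z'.snd - z.snd)‖ ^ 2|
      ≤ L * (‖z'.fst - z.fst‖ ^ 2 + ‖θ' - θ‖ ^ 2) := by
  have h1 := hG.taylor hL (pair z.fst θ) (pair z'.fst θ')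
  rw [pair_sub_pair, norm_sq_eq_fst_add_snd, inner_eq_fst_add_snd] at h1
  simp only [fst_pair, snd_pair] at h1
  convert h1 using 2
  have h2 : ‖θ' - z'.snd‖ ^ 2 = ‖θ - z.snd‖ ^ 2
      + 2 * inner ℝ (θ - z.snd) ((θ' - θ) - (z'.snd - z.snd))
      + ‖(θ' - θ) - (z'.snd - z.snd)‖ ^ 2 := by
    rw [← norm_add_sq_real]; congr 2; abel
  have h3 : inner ℝ (θ - z.snd) ((θ' - θ) - (z'.snd - z.snd))
      = inner ℝ (θ - z.snd) (θ' - θ) - inner ℝ (θ - z.snd) (z'.snd - z.snd) := inner_sub_right _ _ _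
  have h4 : inner ℝ (z.snd - θ) (z'.snd - z.snd) = - inner ℝ (θ - z.snd) (z'.snd - z.snd) := by
    rw [← inner_neg_left, neg_sub]
  unfold moreauObj moreauGrad moreauGradBase
  rw [h2, h3, inner_eq_fst_add_snd, inner_add_left, inner_smul_left]
  simp only [fst_pair, snd_pair, sub_fst, sub_snd, inner_smul_left]
  rw [h4]
  simp
  field_simp
  ring

/-- The proximal curvature 1/(2γ) outweighs the possible concavity of G in θ; the positivity of
1/(2γ) - L is where γ < 1/(2L₂) enters. -/
theorem moreauObj_lower (hG : IsSmooth L G) (hL : 0 ≤ L) (hγ : 0 < γ) (z : Pair dx dy)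
    (θ θ' : Vec dy) :
    moreauObj G γ z θ + inner ℝ (moreauGrad G γ z θ) (θ' - θ)
      + (1 / (2 * γ) - L) * ‖θ' - θ‖ ^ 2 ≤ moreauObj G γ z θ' := by
  have := (abs_le.mp (moreauObj_taylor hG hL hγ z z θ θ')).1
  simp only [sub_self, inner_zero_right, sub_zero, norm_zero] at this
  nlinarith

theorem moreauObj_upper (hG : IsSmooth L G) (hL : 0 ≤ L) (hγ : 0 < γ) (z : Pair dx dy)
    (θ θ' : Vec dy) :
    moreauObj G γ z θ' ≤ moreauObj G γ z θ + inner ℝ (moreauGrad G γ z θ) (θ' - θ)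
      + (L + 1 / γ) * ‖θ' - θ‖ ^ 2 := by
  have := (abs_le.mp (moreauObj_taylor hG hL hγ z z θ θ')).2
  simp only [sub_self, inner_zero_right, sub_zero, norm_zero] at this
  have h2 : 1 / (2 * γ) * ‖θ' - θ‖ ^ 2 ≤ 1 / γ * ‖θ' - θ‖ ^ 2 := by
    gcongr; linarith
  nlinarith

theorem moreauObj_upper_base (hG : IsSmooth L G) (hL : 0 ≤ L) (hγ : 0 < γ) (z z' : Pair dx dy)
    (θ : Vec dy) :
    moreauObj G γ z' θ ≤ moreauObj G γ z θ + inner ℝ (moreauGradBase G γ z θ) (z' - z)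
      + (L + 1 / γ) * ‖z' - z‖ ^ 2 := by
  have := (abs_le.mp (moreauObj_taylor hG hL hγ z z' θ θ)).2
  simp only [sub_self, inner_zero_right, sub_zero, norm_zero, zero_sub, norm_neg] at this
  have h1 := norm_sq_eq_fst_add_snd (z' - z)
  rw [sub_fst, sub_snd] at h1
  have h2 : 1 / (2 * γ) * ‖z'.snd - z.snd‖ ^ 2 ≤ 1 / γ * ‖z'.snd - z.snd‖ ^ 2 := by
    gcongr; linarith
  have h3 : 0 ≤ 1 / γ * ‖z'.fst - z.fst‖ ^ 2 := by positivity
  have h4 : 0 ≤ L * ‖z'.snd - z.snd‖ ^ 2 := by positivity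
  rw [h1]
  nlinarith

theorem exists_isMinOn_moreauObj (hG : IsSmooth L G) (hL : 0 ≤ L) (hγ : 0 < γ)
    (hm : 0 < 1 / (2 * γ) - L) (z : Pair dx dy) :
    ∃ θ, IsMinOn (moreauObj G γ z) Set.univ θ := by
  have hcont : Continuous (moreauObj G γ z) := by
    have hp : Continuous fun θ : Vec dy => pair z.fst θ := by
      unfold pair
      fun_prop
    unfold moreauObj
    exact (hG.continuous.comp hp).add (by fun_prop)
  -- By the quadratic lower bound, the objective is at least its value at 0 outside the ball of
  -- radius ‖gradient at 0‖/(1/(2γ) - L).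
  obtain ⟨θ, hθ⟩ := hcont.exists_forall_le' 0 (by
    filter_upwards [(tendsto_norm_cocompact_atTop (E := Vec dy)).eventually_ge_atTop
      (‖moreauGrad G γ z 0‖ / (1 / (2 * γ) - L))] with θ hθ
    have h1 := moreauObj_lower hG hL hγ z 0 θ
    rw [sub_zero] at h1
    have h2 := (abs_le.mp (abs_real_inner_le_norm (moreauGrad G γ z 0) θ)).1
    rw [div_le_iff₀ hm] at hθ
    nlinarith [norm_nonneg θ])
  exact ⟨θ, fun x _ => hθ x⟩

variable {ts : Pair dx dy → Vec dy}

/-- A gradient step of length 1/(2c) with c = L + 1/γ would lower the objective by at least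
‖v‖²/(4c), contradicting minimality unless v = 0. -/
theorem moreauGrad_minimizer (hG : IsSmooth L G) (hL : 0 ≤ L) (hγ : 0 < γ)
    (hts : ∀ z, IsMinOn (moreauObj G γ z) Set.univ (ts z)) (z : Pair dx dy) :
    moreauGrad G γ z (ts z) = 0 := by
  set v := moreauGrad G γ z (ts z)
  set c := L + 1 / γ with hc
  have hc0 : 0 < c := by positivity
  have h1 := moreauObj_upper hG hL hγ z (ts z) (ts z - (1 / (2 * c)) • v)
  have h2 : moreauObj G γ z (ts z) ≤ moreauObj G γ z (ts z - (1 / (2 * c)) • v) :=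
    hts z (Set.mem_univ _)
  rw [sub_sub_cancel_left, inner_neg_right, inner_smul_right, norm_neg, norm_smul, mul_pow,
    Real.norm_eq_abs, sq_abs, ← hc] at h1
  have h3 : inner ℝ v v = ‖v‖ ^ 2 := real_inner_self_eq_norm_sq v
  rw [h3] at h1
  have h4 : -(1 / (2 * c) * ‖v‖ ^ 2) + c * ((1 / (2 * c)) ^ 2 * ‖v‖ ^ 2)
      = -(1 / (4 * c)) * ‖v‖ ^ 2 := by field_simp; ring
  have h5 : 1 / (4 * c) * ‖v‖ ^ 2 ≤ 0 := by linarith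
  have h6 : ‖v‖ ^ 2 ≤ 0 := by
    by_contra hcon
    have : 0 < 1 / (4 * c) * ‖v‖ ^ 2 := by
      have := not_le.mp hcon
      positivity
    linarith
  have h7 : ‖v‖ = 0 := by nlinarith [norm_nonneg v]
  exact norm_eq_zero.mp h7

/-- The proximal part is monotone with modulus 1/γ and the gradient of G costs at most L;
Cauchy-Schwarz then cancels one factor ‖θ - θ'‖. -/
theorem moreauGrad_strongly_monotone (hG : IsSmooth L G) (z : Pair dx dy) (θ θ' : Vec dy) :
    (1 / γ - L) * ‖θ - θ'‖ ≤ ‖moreauGrad G γ z θ - moreauGrad G γ z θ'‖ := by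
  have h1 : moreauGrad G γ z θ - moreauGrad G γ z θ'
      = ((gradient G (pair z.fst θ)).snd - (gradient G (pair z.fst θ')).snd)
        + (1 / γ) • (θ - θ') := by
    unfold moreauGrad
    rw [smul_sub, smul_sub, smul_sub]; abel
  have h2 : ‖(gradient G (pair z.fst θ)).snd - (gradient G (pair z.fst θ')).snd‖
      ≤ L * ‖θ - θ'‖ := by
    refine (norm_snd_sub_snd_le _ _).trans ((hG.lipschitz _ _).trans_eq ?_)
    have : ‖pair z.fst θ - pair z.fst θ'‖ = ‖θ - θ'‖ := by
      rw [← sq_eq_sq₀ (norm_nonneg _) (norm_nonneg _), norm_sq_eq_fst_add_snd, pair_sub_pair]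
      simp
    rw [this]
  have h3 : inner ℝ (moreauGrad G γ z θ - moreauGrad G γ z θ') (θ - θ')
      ≤ ‖moreauGrad G γ z θ - moreauGrad G γ z θ'‖ * ‖θ - θ'‖ := real_inner_le_norm _ _
  have h4 : (1 / γ - L) * ‖θ - θ'‖ ^ 2
      ≤ inner ℝ (moreauGrad G γ z θ - moreauGrad G γ z θ') (θ - θ') := by
    rw [h1, inner_add_left, inner_smul_left, real_inner_self_eq_norm_sq]
    have := (abs_le.mp (abs_real_inner_le_norm
      ((gradient G (pair z.fst θ)).snd - (gradient G (pair z.fst θ')).snd) (θ - θ'))).1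
    have := mul_le_mul_of_nonneg_right h2 (norm_nonneg (θ - θ'))
    simp only [conj_trivial]
    nlinarith
  rcases (norm_nonneg (θ - θ')).eq_or_lt with h0 | h0
  · rw [← h0, mul_zero]; exact norm_nonneg _
  · refine le_of_mul_le_mul_right (le_trans (le_of_eq ?_) (h4.trans h3)) h0
    ring

theorem norm_sub_minimizer_le (hG : IsSmooth L G) (hL : 0 ≤ L) (hγ : 0 < γ)
    (hts : ∀ z, IsMinOn (moreauObj G γ z) Set.univ (ts z)) (z : Pair dx dy) (θ : Vec dy) :
    (1 / γ - L) * ‖θ - ts z‖ ≤ ‖moreauGrad G γ z θ‖ := by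
  have := moreauGrad_strongly_monotone (γ := γ) hG z θ (ts z)
  rwa [moreauGrad_minimizer hG hL hγ hts, sub_zero] at this

theorem norm_pair_le {x : Vec dx} {y : Vec dy} : ‖pair x y‖ ≤ ‖x‖ + ‖y‖ :=
  norm_le_fst_add_snd (pair x y)

/-- Evaluate the θ-gradient for z at the minimizer for z'. Since the one for z' vanishes there, it
equals a difference of gradients in z alone, and strong monotonicity converts its size into a
distance from the minimizer. -/
theorem minimizer_lipschitz (hG : IsSmooth L G) (hL : 0 ≤ L) (hγ : 0 < γ) (hm : 0 < 1 / γ - L)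
    (hts : ∀ z, IsMinOn (moreauObj G γ z) Set.univ (ts z)) (z z' : Pair dx dy) :
    ‖ts z - ts z'‖ ≤ (L + 1 / γ) / (1 / γ - L) * ‖z - z'‖ := by
  have h1 := norm_sub_minimizer_le hG hL hγ hts z (ts z')
  have h2 := moreauGrad_minimizer hG hL hγ hts z'
  have h3 : moreauGrad G γ z (ts z') = ((gradient G (pair z.fst (ts z'))).snd
      - (gradient G (pair z'.fst (ts z'))).snd) - (1 / γ) • (z.snd - z'.snd) := by
    rw [← sub_zero (moreauGrad G γ z (ts z')), ← h2]
    unfold moreauGrad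
    rw [smul_sub, smul_sub, smul_sub]; abel
  have h4 : ‖(gradient G (pair z.fst (ts z'))).snd
      - (gradient G (pair z'.fst (ts z'))).snd‖ ≤ L * ‖z - z'‖ := by
    refine (norm_snd_sub_snd_le _ _).trans ((hG.lipschitz _ _).trans ?_)
    gcongr
    rw [pair_sub_pair, sub_self]
    exact norm_pair_le.trans (by simpa using norm_fst_le (z - z'))
  have h5 : ‖(1 / γ) • (z.snd - z'.snd)‖ ≤ 1 / γ * ‖z - z'‖ := by
    rw [norm_smul, Real.norm_of_nonneg (by positivity)]
    gcongr
    exact norm_snd_le (z - z')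
  have h6 : ‖moreauGrad G γ z (ts z')‖ ≤ (L + 1 / γ) * ‖z - z'‖ := by
    rw [h3]
    exact (norm_sub_le _ _).trans (by linarith)
  rw [norm_sub_rev, div_mul_eq_mul_div, le_div_iff₀ hm]
  linarith

theorem moreauGradBase_lipschitz (hG : IsSmooth L G) (hL : 0 ≤ L) (hγ : 0 < γ)
    (hm : 0 < 1 / γ - L)
    (hts : ∀ z, IsMinOn (moreauObj G γ z) Set.univ (ts z)) (z z' : Pair dx dy) :
    ‖moreauGradBase G γ z (ts z) - moreauGradBase G γ z' (ts z')‖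
      ≤ (L + 1 / γ) * (1 + (L + 1 / γ) / (1 / γ - L)) * ‖z - z'‖ := by
  have h1 := minimizer_lipschitz hG hL hγ hm hts z z'
  set r := (L + 1 / γ) / (1 / γ - L)
  have h2 := norm_fst_le (z - z')
  have h3 := norm_snd_le (z - z')
  rw [sub_fst] at h2
  rw [sub_snd] at h3
  unfold moreauGradBase
  rw [pair_sub_pair]
  refine norm_pair_le.trans ?_
  have h4 : ‖(gradient G (pair z.fst (ts z))).fst - (gradient G (pair z'.fst (ts z'))).fst‖
      ≤ L * ((1 + r) * ‖z - z'‖) := by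
    refine (norm_fst_sub_fst_le _ _).trans ((hG.lipschitz _ _).trans ?_)
    gcongr
    rw [pair_sub_pair]
    exact norm_pair_le.trans (by linarith)
  have h5 : ‖(1 / γ) • (z.snd - ts z) - (1 / γ) • (z'.snd - ts z')‖
      ≤ 1 / γ * ((1 + r) * ‖z - z'‖) := by
    rw [← smul_sub, norm_smul, Real.norm_of_nonneg (by positivity)]
    gcongr
    rw [sub_sub_sub_comm]
    exact (norm_sub_le _ _).trans (by linarith)
  linarith

/-- The Moreau envelope of `G` in its second variable. -/
def moreauEnv (G : Pair dx dy → ℝ) (γ : ℝ) (z : Pair dx dy) : ℝ := ⨅ θ, moreauObj G γ z θ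

theorem moreauEnv_eq (hts : ∀ z, IsMinOn (moreauObj G γ z) Set.univ (ts z)) (z : Pair dx dy) :
    moreauEnv G γ z = moreauObj G γ z (ts z) :=
  le_antisymm (ciInf_le ⟨moreauObj G γ z (ts z), by rintro _ ⟨θ, rfl⟩; exact hts z (Set.mem_univ θ)⟩ _)
    (le_ciInf fun θ => hts z (Set.mem_univ θ))

theorem moreauEnv_le (hts : ∀ z, IsMinOn (moreauObj G γ z) Set.univ (ts z)) (z : Pair dx dy)
    (θ : Vec dy) : moreauEnv G γ z ≤ moreauObj G γ z θ := by
  rw [moreauEnv_eq hts]; exact hts z (Set.mem_univ θ)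

/-- The objective at θ = y equals G z, so quadratic growth around the minimizer applies to it. -/
theorem moreauEnv_gap_lower (hG : IsSmooth L G) (hL : 0 ≤ L) (hγ : 0 < γ)
    (hts : ∀ z, IsMinOn (moreauObj G γ z) Set.univ (ts z)) (z : Pair dx dy) :
    (1 / (2 * γ) - L) * ‖z.snd - ts z‖ ^ 2 ≤ G z - moreauEnv G γ z := by
  have h1 := moreauObj_lower hG hL hγ z (ts z) z.snd
  rw [moreauGrad_minimizer hG hL hγ hts, inner_zero_left, ← moreauEnv_eq hts] at h1
  have h2 : moreauObj G γ z z.snd = G z := by simp [moreauObj, pair_fst_snd]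
  linarith

theorem moreauEnv_gap_upper (hG : IsSmooth L G) (hL : 0 ≤ L) (hγ : 0 < γ)
    (hts : ∀ z, IsMinOn (moreauObj G γ z) Set.univ (ts z)) (z : Pair dx dy) (θ : Vec dy) :
    moreauObj G γ z θ - moreauEnv G γ z ≤ (L + 1 / γ) * ‖θ - ts z‖ ^ 2 := by
  have h1 := moreauObj_upper hG hL hγ z (ts z) θ
  rw [moreauGrad_minimizer hG hL hγ hts, inner_zero_left, ← moreauEnv_eq hts] at h1
  linarith

/-- For the upper bound, the minimizer at z competes at z'. The lower bound exchanges z and z' and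
replaces the gradient at z' by that at z, using its Lipschitz continuity. -/
theorem moreauEnv_taylor (hG : IsSmooth L G) (hL : 0 ≤ L) (hγ : 0 < γ) (hm : 0 < 1 / γ - L)
    (hts : ∀ z, IsMinOn (moreauObj G γ z) Set.univ (ts z)) (z z' : Pair dx dy) :
    |moreauEnv G γ z' - moreauEnv G γ z - inner ℝ (moreauGradBase G γ z (ts z)) (z' - z)|
      ≤ (L + 1 / γ) * (2 + (L + 1 / γ) / (1 / γ - L)) * ‖z' - z‖ ^ 2 := by
  have hr : 0 ≤ (L + 1 / γ) / (1 / γ - L) := by positivity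
  have up : ∀ z z', moreauEnv G γ z' ≤ moreauEnv G γ z
      + inner ℝ (moreauGradBase G γ z (ts z)) (z' - z) + (L + 1 / γ) * ‖z' - z‖ ^ 2 := fun z z' => by
    rw [moreauEnv_eq hts z]
    exact (moreauEnv_le hts z' _).trans (moreauObj_upper_base hG hL hγ z z' (ts z))
  have h1 := up z z'
  have h2 := up z' z
  have h3 := moreauGradBase_lipschitz hG hL hγ hm hts z' z
  have h4 := (abs_le.mp (abs_real_inner_le_norm
    (moreauGradBase G γ z' (ts z') - moreauGradBase G γ z (ts z)) (z' - z))).1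
  have h5 := mul_le_mul_of_nonneg_right h3 (norm_nonneg (z' - z))
  have h6 : inner ℝ (moreauGradBase G γ z' (ts z')) (z - z')
      = -inner ℝ (moreauGradBase G γ z (ts z)) (z' - z)
        - inner ℝ (moreauGradBase G γ z' (ts z') - moreauGradBase G γ z (ts z)) (z' - z) := by
    rw [inner_sub_left, ← neg_sub z' z, inner_neg_right]; ring
  rw [h6, norm_sub_rev z z'] at h2
  have h7 : 0 ≤ (L + 1 / γ) * (1 + (L + 1 / γ) / (1 / γ - L)) * ‖z' - z‖ ^ 2 := by positivity
  rw [abs_le]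
  constructor <;> nlinarith

theorem hasGradientAt_moreauEnv (hG : IsSmooth L G) (hL : 0 ≤ L) (hγ : 0 < γ)
    (hm : 0 < 1 / γ - L)
    (hts : ∀ z, IsMinOn (moreauObj G γ z) Set.univ (ts z)) (z : Pair dx dy) :
    HasGradientAt (moreauEnv G γ) (moreauGradBase G γ z (ts z)) z := by
  rw [hasGradientAt_iff_isLittleO]
  refine Asymptotics.IsBigO.trans_isLittleO (g := fun z' => ‖z' - z‖ ^ 2) ?_ ?_
  · refine Asymptotics.IsBigO.of_bound ((L + 1 / γ) * (2 + (L + 1 / γ) / (1 / γ - L)))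
      (Filter.Eventually.of_forall fun z' => ?_)
    rw [Real.norm_eq_abs, Real.norm_of_nonneg (by positivity)]
    exact moreauEnv_taylor hG hL hγ hm hts z z'
  · exact Asymptotics.isLittleO_pow_sub_sub z one_lt_two

end Moreau

/-! ### Bounds in expectation -/

section Expectation

variable {Ω : Type*} [mΩ : MeasurableSpace Ω] {Pr : Measure Ω} [IsProbabilityMeasure Pr]
variable {n : ℕ} {S : Type*} [mS : MeasurableSpace S] {ξ : Fin n × ℕ → Ω → S}
variable {H : Type*} [NormedAddCommGroup H] [InnerProductSpace ℝ H] [FiniteDimensional ℝ H]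
  [MeasurableSpace H] [BorelSpace H]

theorem continuous_of_lip {E E' : Type*} [NormedAddCommGroup E] [NormedAddCommGroup E']
    {u : E → E'} {c : ℝ} (hu : ∀ x y, ‖u x - u y‖ ≤ c * ‖x - y‖) : Continuous u := by
  refine (LipschitzWith.of_dist_le_mul (K := ⟨max c 0, le_max_right _ _⟩) fun x y => ?_).continuous
  rw [dist_eq_norm, dist_eq_norm]
  exact (hu x y).trans (by gcongr; exact le_max_left _ _)

theorem norm_sq_le_of_lip {E E' : Type*} [NormedAddCommGroup E] [NormedAddCommGroup E']
    {u : E → E'} {c : ℝ} (hu : ∀ x y, ‖u x - u y‖ ≤ c * ‖x - y‖) (x : E) :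
    ‖u x‖ ^ 2 ≤ (2 * ‖u 0‖ ^ 2 + 2 * c ^ 2) * (1 + ‖x‖ ^ 2) := by
  have h1 : ‖u x‖ ≤ ‖u 0‖ + c * ‖x‖ := by
    have h2 := hu x 0
    rw [sub_zero] at h2
    have h3 := norm_sub_norm_le (u x) (u 0)
    linarith
  have h4 : ‖u x‖ ^ 2 ≤ (‖u 0‖ + c * ‖x‖) ^ 2 := by gcongr
  nlinarith [sq_nonneg (‖u 0‖ - c * ‖x‖), sq_nonneg (‖u 0‖ * ‖x‖), sq_nonneg c]

theorem memLp_of_growth {E E' : Type*} [NormedAddCommGroup E] [MeasurableSpace E] [BorelSpace E]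
    [NormedAddCommGroup E'] [MeasurableSpace E'] [BorelSpace E'] [SecondCountableTopology E']
    {u : E → E'} (hu : Measurable u) {c : ℝ} (hc : ∀ x, ‖u x‖ ^ 2 ≤ c * (1 + ‖x‖ ^ 2)) {X : Ω → E}
    (hX : Measurable X) (hX2 : MemLp X 2 Pr) : MemLp (fun ω => u (X ω)) 2 Pr := by
  have hm : Measurable fun ω => u (X ω) := hu.comp hX
  rw [memLp_two_iff_integrable_sq_norm hm.aestronglyMeasurable]
  have h1 : Integrable (fun ω => c * (1 + ‖X ω‖ ^ 2)) Pr :=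
    ((integrable_const (1 : ℝ)).add
      ((memLp_two_iff_integrable_sq_norm hX2.1).mp hX2)).const_mul c
  refine h1.mono' (hm.norm.pow_const 2).aestronglyMeasurable (ae_of_all _ fun ω => ?_)
  rw [Real.norm_of_nonneg (by positivity)]
  exact hc _

theorem integrable_of_growth {E : Type*} [NormedAddCommGroup E] [MeasurableSpace E] [BorelSpace E]
    {r : E → ℝ} (hr : Measurable r) (hr0 : ∀ x, 0 ≤ r x) {c : ℝ}
    (hc : ∀ x, r x ≤ c * (1 + ‖x‖ ^ 2)) {X : Ω → E} (hX : Measurable X) (hX2 : MemLp X 2 Pr) :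
    Integrable (fun ω => r (X ω)) Pr := by
  have h1 : Integrable (fun ω => c * (1 + ‖X ω‖ ^ 2)) Pr :=
    ((integrable_const (1 : ℝ)).add
      ((memLp_two_iff_integrable_sq_norm hX2.1).mp hX2)).const_mul c
  refine h1.mono' (hr.comp hX).aestronglyMeasurable (ae_of_all _ fun ω => ?_)
  rw [Real.norm_of_nonneg (hr0 _)]
  exact hc _

/-- Measurable with respect to the samples before iteration `k`, and square integrable. -/
def Adapted (Pr : Measure Ω) (ξ : Fin n × ℕ → Ω → S) (k : ℕ) (X : Fin n → Ω → H) : Prop :=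
  ∀ i, Measurable[past ξ k] (X i) ∧ MemLp (X i) 2 Pr

namespace Adapted

variable {k : ℕ} {X Y : Fin n → Ω → H}

theorem mono (hX : Adapted Pr ξ k X) {l : ℕ} (h : k ≤ l) : Adapted Pr ξ l X := fun i =>
  ⟨(hX i).1.mono (past_mono h) le_rfl, (hX i).2⟩

theorem add (hX : Adapted Pr ξ k X) (hY : Adapted Pr ξ k Y) :
    Adapted Pr ξ k fun i ω => X i ω + Y i ω := fun i =>
  ⟨(hX i).1.add (hY i).1, (hX i).2.add (hY i).2⟩

theorem const_smul (hX : Adapted Pr ξ k X) (c : ℝ) :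
    Adapted Pr ξ k fun i ω => c • X i ω := fun i =>
  ⟨(hX i).1.const_smul c, (hX i).2.const_smul c⟩

theorem sub (hX : Adapted Pr ξ k X) (hY : Adapted Pr ξ k Y) :
    Adapted Pr ξ k fun i ω => X i ω - Y i ω := fun i =>
  ⟨(hX i).1.sub (hY i).1, (hX i).2.sub (hY i).2⟩

theorem mixing (hX : Adapted Pr ξ k X) (W : Matrix (Fin n) (Fin n) ℝ) :
    Adapted Pr ξ k fun i ω => SunDSBO.mixing W (fun j => X j ω) i := fun _ =>
  ⟨Finset.measurable_fun_sum _ fun j _ => (hX j).1.const_smul _,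
    memLp_finsetSum _ fun j _ => (hX j).2.const_smul _⟩

theorem measurable_mean (hX : Adapted Pr ξ k X) :
    Measurable[past ξ k] fun ω => mean fun i => X i ω :=
  (Finset.measurable_fun_sum _ fun j _ => (hX j).1).const_smul (1 / (n : ℝ))

theorem memLp_mean (hX : Adapted Pr ξ k X) : MemLp (fun ω => mean fun i => X i ω) 2 Pr :=
  (memLp_finsetSum _ fun j _ => (hX j).2).const_smul (1 / (n : ℝ))

theorem integrable_dev (hX : Adapted Pr ξ k X) : Integrable (fun ω => dev fun i => X i ω) Pr := by
  unfold dev msq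
  refine (integrable_finsetSum _ fun i _ => ?_).const_mul _
  have h := (hX i).2.sub hX.memLp_mean
  exact (memLp_two_iff_integrable_sq_norm h.1).mp h

theorem direction {e : ℕ → Fin n → H → S → H} {b : ℕ → Fin n → H → H} {v ℓ : ℝ}
    (hN : IsNoise Pr ξ e v) (hb : ∀ k i w w', ‖b k i w - b k i w'‖ ≤ ℓ * ‖w - w'‖)
    (hX : Adapted Pr ξ k X) :
    Adapted Pr ξ (k + 1) fun i ω => b k i (X i ω) + e k i (X i ω) (ξ (i, k) ω) := by
  have hX' := hX.mono k.le_succ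
  have hle := past_le hN.meas_sample (k + 1)
  have hbm : ∀ i, Measurable (b k i) := fun i => (continuous_of_lip (hb k i)).measurable
  have hem : ∀ i, Measurable[past ξ (k + 1)] fun ω => e k i (X i ω) (ξ (i, k) ω) := fun i =>
    (hN.meas k i).comp ((hX' i).1.prodMk (measurable_past_sample i k))
  intro i
  refine ⟨((hbm i).comp (hX' i).1).add (hem i), ?_⟩
  refine (memLp_of_growth (hbm i) (norm_sq_le_of_lip (hb k i)) ((hX' i).1.mono hle le_rfl)
    (hX i).2).add ?_
  rw [memLp_two_iff_integrable_sq_norm ((hem i).mono hle le_rfl).aestronglyMeasurable]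
  exact (hN.second_moment i (hX i).1).1

theorem const (x : Fin n → H) : Adapted Pr ξ k fun i _ => x i := fun _ =>
  ⟨measurable_const, memLp_const _⟩

end Adapted

variable {Φ : ℕ → H → ℝ} {gΦ : ℕ → H → H} {R : ℕ → H → ℝ} {b : ℕ → Fin n → H → H} {κ C ℓ L : ℝ}
  {e : ℕ → Fin n → H → S → H} {v : ℝ}

theorem integrable_R (h : Landscape Φ gΦ R b κ C ℓ L) (hξ : ∀ q, Measurable (ξ q))
    (hRm : ∀ k, Measurable (R k)) (hRg : ∀ k, ∃ c, ∀ w, R k w ≤ c * (1 + ‖w‖ ^ 2)) {k : ℕ}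
    {X : Fin n → Ω → H} (hX : Adapted Pr ξ k X) (l : ℕ) :
    Integrable (fun ω => R l (mean fun i => X i ω)) Pr := by
  obtain ⟨c, hc⟩ := hRg l
  exact integrable_of_growth (hRm l) (h.R_nonneg l) hc
    (hX.measurable_mean.mono (past_le hξ k) le_rfl) hX.memLp_mean

/-- The gradient at the averaged state is determined by the past, and `grad_le` together with the
growth of R makes it square integrable. -/
theorem noise_inner_gradient (h : Landscape Φ gΦ R b κ C ℓ L) (hN : IsNoise Pr ξ e v)
    (hgm : ∀ k, Measurable (gΦ k)) (hRm : ∀ k, Measurable (R k))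
    (hRg : ∀ k, ∃ c, ∀ w, R k w ≤ c * (1 + ‖w‖ ^ 2)) {k : ℕ}
    {X : Fin n → Ω → H} (hX : Adapted Pr ξ k X) :
    Integrable (fun ω => inner ℝ (gΦ k (mean fun i => X i ω))
        (mean fun i => e k i (X i ω) (ξ (i, k) ω))) Pr ∧
      ∫ ω, inner ℝ (gΦ k (mean fun i => X i ω))
        (mean fun i => e k i (X i ω) (ξ (i, k) ω)) ∂Pr = 0 := by
  have hg : Measurable[past ξ k] fun ω => gΦ k (mean fun i => X i ω) :=
    (hgm k).comp hX.measurable_mean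
  refine hN.inner_mean (fun i => (hX i).1) hg ?_
  refine ((integrable_R h hN.meas_sample hRm hRg hX k).const_mul C).mono'
    ((hg.mono (past_le hN.meas_sample k) le_rfl).norm.pow_const 2).aestronglyMeasurable
    (ae_of_all _ fun ω => ?_)
  rw [Real.norm_of_nonneg (by positivity)]
  exact h.grad_le _ _

/-- Taking expectations in a sample path bound. -/
theorem expected_bound (h : Landscape Φ gΦ R b κ C ℓ L) (hN : IsNoise Pr ξ e v) (hn : 0 < n)
    (hgm : ∀ k, Measurable (gΦ k)) (hRm : ∀ k, Measurable (R k))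
    (hRg : ∀ k, ∃ c, ∀ w, R k w ≤ c * (1 + ‖w‖ ^ 2))
    {X : ℕ → Fin n → Ω → H} (hX : ∀ k, Adapted Pr ξ k (X k)) {lam κ' c₁ c₂ : ℝ} (hc₁ : 0 ≤ c₁)
    (hc₂ : 0 ≤ c₂) {I : Ω → ℝ} (hI : Integrable I Pr) (K : ℕ)
    (hpath : ∀ ω, lam * κ' * ∑ k ∈ Finset.range K, R k (mean fun i => X k i ω)
      + lam * ∑ k ∈ Finset.range K, inner ℝ (gΦ k (mean fun i => X k i ω))
        (mean fun i => e k i (X k i ω) (ξ (i, k) ω))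
      ≤ I ω + c₁ * ∑ k ∈ Finset.range K, (msq fun i => e k i (X k i ω) (ξ (i, k) ω))
        + c₂ * ∑ k ∈ Finset.range K, ‖mean fun i => e k i (X k i ω) (ξ (i, k) ω)‖ ^ 2) :
    lam * κ' * ∑ k ∈ Finset.range K, ∫ ω, R k (mean fun i => X k i ω) ∂Pr
      ≤ ∫ ω, I ω ∂Pr + c₁ * (K * v) + c₂ * (K * (v / n)) := by
  have hR := fun k => integrable_R h hN.meas_sample hRm hRg (hX k) k
  have hin := fun k => noise_inner_gradient h hN hgm hRm hRg (hX k)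
  have hms := fun k => hN.msq_noise hn (k := k) fun i => (hX k i).1
  have hmn := fun k => hN.mean_sq (k := k) fun i => (hX k i).1
  have i1 : Integrable (fun ω => lam * κ' * ∑ k ∈ Finset.range K, R k (mean fun i => X k i ω)) Pr :=
    (integrable_finsetSum _ fun k _ => hR k).const_mul _
  have i2 : Integrable (fun ω => lam * ∑ k ∈ Finset.range K, inner ℝ (gΦ k (mean fun i => X k i ω))
        (mean fun i => e k i (X k i ω) (ξ (i, k) ω))) Pr :=
    (integrable_finsetSum _ fun k _ => (hin k).1).const_mul _
  have i3 : Integrable (fun ω => c₁ * ∑ k ∈ Finset.range K,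
      (msq fun i => e k i (X k i ω) (ξ (i, k) ω))) Pr :=
    (integrable_finsetSum _ fun k _ => (hms k).1).const_mul _
  have i4 : Integrable (fun ω => c₂ * ∑ k ∈ Finset.range K,
      ‖mean fun i => e k i (X k i ω) (ξ (i, k) ω)‖ ^ 2) Pr :=
    (integrable_finsetSum _ fun k _ => (hmn k).1).const_mul _
  have key := integral_mono (i1.add i2) ((hI.add i3).add i4) hpath
  -- The products of gradient and noise have mean zero, so only the residuals survive on the left.
  have e1 : ∫ ω, ((fun ω => lam * κ' * ∑ k ∈ Finset.range K, R k (mean fun i => X k i ω))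
      + (fun ω => lam * ∑ k ∈ Finset.range K, inner ℝ (gΦ k (mean fun i => X k i ω))
        (mean fun i => e k i (X k i ω) (ξ (i, k) ω)))) ω ∂Pr
      = lam * κ' * ∑ k ∈ Finset.range K, ∫ ω, R k (mean fun i => X k i ω) ∂Pr := by
    rw [integral_add' i1 i2, integral_const_mul, integral_const_mul,
      integral_finsetSum _ fun k _ => hR k, integral_finsetSum _ fun k _ => (hin k).1]
    simp [(hin _).2]
  rw [e1, integral_add' (hI.add i3) i4, integral_add' hI i3, integral_const_mul,
    integral_const_mul, integral_finsetSum _ fun k _ => (hms k).1,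
    integral_finsetSum _ fun k _ => (hmn k).1] at key
  refine key.trans ?_
  have s1 : ∑ k ∈ Finset.range K, ∫ ω, (msq fun i => e k i (X k i ω) (ξ (i, k) ω)) ∂Pr ≤ K * v :=
    (Finset.sum_le_sum fun k _ => (hms k).2).trans_eq (by simp)
  have s2 : ∑ k ∈ Finset.range K, ∫ ω, ‖mean fun i => e k i (X k i ω) (ξ (i, k) ω)‖ ^ 2 ∂Pr
      ≤ K * (v / n) :=
    (Finset.sum_le_sum fun k _ => (hmn k).2).trans_eq (by simp)
  gcongr

variable {W : Matrix (Fin n) (Fin n) ℝ} {ρ : ℝ}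

theorem adapted_se (hN : IsNoise Pr ξ e v)
    (hb : ∀ k i w w', ‖b k i w - b k i w'‖ ≤ ℓ * ‖w - w'‖) {lam : ℝ}
    {w : ℕ → Ω → Fin n → H} {w₀ : Fin n → H} (hw0 : ∀ ω, w 0 ω = w₀)
    (hw : ∀ k ω, w (k + 1) ω = mixing W fun i => w k ω i
      - lam • (b k i (w k ω i) + e k i (w k ω i) (ξ (i, k) ω))) (k : ℕ) :
    Adapted Pr ξ k fun i ω => w k ω i := by
  induction k with
  | zero => simp_rw [hw0]; exact Adapted.const w₀
  | succ k ih =>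
    simp_rw [hw]
    exact ((ih.mono k.le_succ).sub ((ih.direction hN hb).const_smul lam)).mixing W

/-- Decentralized stochastic gradient descent, in expectation. -/
theorem expected_bound_se (h : Landscape Φ gΦ R b κ C ℓ L) (hN : IsNoise Pr ξ e v) (hn : 0 < n)
    (hgm : ∀ k, Measurable (gΦ k)) (hRm : ∀ k, Measurable (R k))
    (hRg : ∀ k, ∃ c, ∀ w, R k w ≤ c * (1 + ‖w‖ ^ 2)) (hW : IsGossip H W ρ)
    (hκ : 0 < κ) (hC : 0 < C) (hL : 0 ≤ L) {σ : ℝ} (hσ : ∀ k z, dev (fun i => b k i z) ≤ σ)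
    {lam lb M : ℝ} (hlam : 0 < lam) (hlb : lam ≤ lb * (1 - ρ)) (hlb1 : lb ≤ 1)
    (hlbC : 16 * L * C * lb ≤ κ) (hlbℓ : 16 * ℓ ^ 2 * lb ≤ 1) (hM : M = (C / κ + 4 * L) * ℓ ^ 2)
    {w : ℕ → Ω → Fin n → H} {w₀ : Fin n → H} (hw0 : ∀ ω, w 0 ω = w₀)
    (hw : ∀ k ω, w (k + 1) ω = mixing W fun i => w k ω i
      - lam • (b k i (w k ω i) + e k i (w k ω i) (ξ (i, k) ω))) (K : ℕ) :
    lam * (κ / 2) * ∑ k ∈ Finset.range K, ∫ ω, R k (mean (w k ω)) ∂Pr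
      ≤ (Φ 0 (mean w₀) + 2 * M * dev w₀)
        + 16 * M * (K * (lam ^ 3 / (1 - ρ) ^ 2 * (σ + v)))
        + 2 * L * (K * (lam ^ 2 * (v / n))) := by
  have hρ : 0 < 1 - ρ := by linarith [hW.lt_one]
  have hM0 : 0 ≤ M := by rw [hM]; positivity
  have hX := adapted_se hN h.lip hw0 hw
  have key := expected_bound h hN hn hgm hRm hRg (X := fun k i ω => w k ω i) hX
    (lam := lam) (κ' := κ / 2) (c₁ := 16 * M * (lam ^ 3 / (1 - ρ) ^ 2))
    (c₂ := 2 * L * lam ^ 2) (by positivity) (by positivity)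
    -- The dissimilarity contribution K σ is deterministic and is put into the initial term.
    (I := fun _ => Φ 0 (mean w₀) + 2 * M * dev w₀
      + 16 * M * (lam ^ 3 / (1 - ρ) ^ 2) * (K * σ)) (integrable_const _) K (fun ω => by
      have := h.path_bound_se hW hn hκ hC hL hσ hlam hlb hlb1 hlbC hlbℓ (fun k => w k ω)
        (fun k i => e k i (w k ω i) (ξ (i, k) ω)) (fun k => hw k ω) K
      rw [← hM, hw0, Finset.sum_add_distrib, Finset.sum_const, Finset.card_range,
        nsmul_eq_mul] at this
      linarith)
  refine key.trans (le_of_eq ?_)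
  rw [integral_const]
  simp
  ring

/-- The tracker of iteration k already contains the samples of that iteration, hence its index k + 1
in the filtration. -/
theorem adapted_gt (hN : IsNoise Pr ξ e v)
    (hb : ∀ k i w w', ‖b k i w - b k i w'‖ ≤ ℓ * ‖w - w'‖) {lam : ℝ}
    {w D : ℕ → Ω → Fin n → H} {w₀ : Fin n → H} (hw0 : ∀ ω, w 0 ω = w₀)
    (hw : ∀ k ω, w (k + 1) ω = mixing W fun i => w k ω i - lam • D k ω i)
    (hD0 : ∀ ω, D 0 ω = mixing W fun i => b 0 i (w 0 ω i) + e 0 i (w 0 ω i) (ξ (i, 0) ω))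
    (hD : ∀ k ω, D (k + 1) ω = mixing W fun i => D k ω i
      + (b (k + 1) i (w (k + 1) ω i) + e (k + 1) i (w (k + 1) ω i) (ξ (i, k + 1) ω))
      - (b k i (w k ω i) + e k i (w k ω i) (ξ (i, k) ω))) (k : ℕ) :
    (Adapted Pr ξ k fun i ω => w k ω i) ∧ Adapted Pr ξ (k + 1) fun i ω => D k ω i := by
  induction k with
  | zero =>
    have h0 : Adapted Pr ξ 0 fun i ω => w 0 ω i := by simp_rw [hw0]; exact Adapted.const w₀
    refine ⟨h0, ?_⟩
    simp_rw [hD0]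
    exact (h0.direction hN hb).mixing W
  | succ k ih =>
    have h1 : Adapted Pr ξ (k + 1) fun i ω => w (k + 1) ω i := by
      simp_rw [hw]
      exact ((ih.1.mono k.le_succ).sub (ih.2.const_smul lam)).mixing W
    refine ⟨h1, ?_⟩
    simp_rw [hD]
    exact (((ih.2.mono (k + 1).le_succ).add (h1.direction hN hb)).sub
      ((ih.1.direction hN hb).mono (k + 1).le_succ)).mixing W

/-- Decentralized gradient tracking, in expectation. -/
theorem expected_bound_gt (h : Landscape Φ gΦ R b κ C ℓ L) (hN : IsNoise Pr ξ e v) (hn : 0 < n)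
    (hgm : ∀ k, Measurable (gΦ k)) (hRm : ∀ k, Measurable (R k))
    (hRg : ∀ k, ∃ c, ∀ w, R k w ≤ c * (1 + ‖w‖ ^ 2)) (hW : IsGossip H W ρ)
    (hκ : 0 < κ) (hC : 0 < C) (hL : 0 ≤ L) {a c : Fin n → H → H} {m : ℕ → ℝ} {m₀ : ℝ}
    (hb : ∀ k i z, b k i z = m k • a i z + c i z)
    (ha : ∀ i w w', ‖a i w - a i w'‖ ≤ ℓ * ‖w - w'‖)
    (hm : ∀ k : ℕ, |m (k + 1) - m k| ≤ m₀ / ((k : ℝ) + 2))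
    {lam lb q M : ℝ} (hlam : 0 < lam) (hlb : lam ≤ lb * (1 - ρ) ^ 4) (hlb1 : lb ≤ 1)
    (hlbC : 16 * L * C * lb ≤ κ)
    (hq : q = 32 * m₀ ^ 2 * ℓ ^ 2 + 128 * ℓ ^ 2) (hM : M = (C / κ + 4 * L) * ℓ ^ 2)
    (hlbq : 4 * (q * (1 + 4 * ℓ ^ 2)) * lb ≤ 1) (hlbM : 64 * (M * q * C) * lb ≤ κ)
    {w D : ℕ → Ω → Fin n → H} {w₀ : Fin n → H} (hw0 : ∀ ω, w 0 ω = w₀)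
    (hw : ∀ k ω, w (k + 1) ω = mixing W fun i => w k ω i - lam • D k ω i)
    (hD0 : ∀ ω, D 0 ω = mixing W fun i => b 0 i (w 0 ω i) + e 0 i (w 0 ω i) (ξ (i, 0) ω))
    (hD : ∀ k ω, D (k + 1) ω = mixing W fun i => D k ω i
      + (b (k + 1) i (w (k + 1) ω i) + e (k + 1) i (w (k + 1) ω i) (ξ (i, k + 1) ω))
      - (b k i (w k ω i) + e k i (w k ω i) (ξ (i, k) ω))) {K : ℕ} (hK : 0 < K) :
    lam * (κ / 4) * ∑ k ∈ Finset.range K, ∫ ω, R k (mean (w k ω)) ∂Pr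
      ≤ (Φ 0 (mean w₀) + 2 * M * dev w₀ + 4 * M * (∫ ω, dev (D 0 ω) ∂Pr
          + 16 * m₀ ^ 2 * dev (mixing W fun i => a i (mean w₀))))
        + 4 * M * (32 + 2 * q) * (K * (lam ^ 3 / (1 - ρ) ^ 4 * v))
        + 2 * L * (K * (lam ^ 2 * (v / n))) := by
  have hρ : 0 < 1 - ρ := by linarith [hW.lt_one]
  have hM0 : 0 ≤ M := by rw [hM]; positivity
  have hq0 : 0 ≤ q := by rw [hq]; positivity
  have hX := adapted_gt hN h.lip hw0 hw hD0 hD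
  have hDint : Integrable (fun ω => dev (D 0 ω)) Pr := (hX 0).2.integrable_dev
  set φ₀ := dev (mixing W fun i => a i (mean w₀)) with hφ₀
  -- The tracking bound is stated for K + 1 iterations, since its first tracker is an initial value
  -- and not the result of a recursion step.
  obtain ⟨K, rfl⟩ : ∃ K', K = K' + 1 := ⟨K - 1, by omega⟩
  have key := expected_bound h hN hn hgm hRm hRg (X := fun k i ω => w k ω i) (fun k => (hX k).1)
    (lam := lam) (κ' := κ / 4) (c₁ := 4 * M * (32 + 2 * q) * (lam ^ 3 / (1 - ρ) ^ 4))
    (c₂ := 2 * L * lam ^ 2) (by positivity) (by positivity)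
    (I := fun ω => (Φ 0 (mean w₀) + 2 * M * dev w₀ + 4 * M * (16 * m₀ ^ 2 * φ₀))
      + 4 * M * dev (D 0 ω)) ((integrable_const _).add (hDint.const_mul _)) (K + 1) (fun ω => by
      have := h.path_bound_gt hW hn hκ hC hL hb ha hm hlam hlb hlb1 hlbC hq hM hlbq hlbM
        (fun k => w k ω) (fun k => D k ω)
        (fun k i => e k i (w k ω i) (ξ (i, k) ω)) (fun k => hw k ω) (hD0 ω) (fun k => hD k ω) K
      rw [hw0, ← hφ₀] at this
      linarith)
  refine key.trans (le_of_eq ?_)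
  rw [integral_add (integrable_const _) (hDint.const_mul _), integral_const, integral_const_mul]
  simp
  ring

end Expectation

/-! ### The state space of one agent -/

section States

variable {n dx dy : ℕ}

/-- `ℝ^dx × ℝ^dy × ℝ^dy`, the space of the local variables `((x, y), θ)` of one agent. -/
abbrev State (dx dy : ℕ) : Type := WithLp 2 (Pair dx dy × Vec dy)

/-- The state `((x, y), θ)` with `z = (x, y)`. -/
def st (z : Pair dx dy) (θ : Vec dy) : State dx dy := WithLp.toLp 2 (z, θ)

@[simp] theorem fst_st (z : Pair dx dy) (θ : Vec dy) : (st z θ).fst = z := rfl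

@[simp] theorem snd_st (z : Pair dx dy) (θ : Vec dy) : (st z θ).snd = θ := rfl

theorem st_fst_snd (w : State dx dy) : st w.fst w.snd = w := rfl

theorem State.ext_iff' {w w' : State dx dy} : w = w' ↔ w.fst.fst = w'.fst.fst ∧
    w.fst.snd = w'.fst.snd ∧ w.snd = w'.snd := by
  refine ⟨by rintro rfl; simp, fun ⟨h1, h2, h3⟩ => ?_⟩
  have h4 : w.fst = w'.fst := by
    rw [← pair_fst_snd w.fst, ← pair_fst_snd w'.fst, h1, h2]
  rw [← st_fst_snd w, ← st_fst_snd w', h4, h3]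

theorem State.inner_eq (w w' : State dx dy) :
    inner ℝ w w' = inner ℝ w.fst w'.fst + inner ℝ w.snd w'.snd := WithLp.prod_inner_apply w w'

theorem State.norm_sq_eq (w : State dx dy) : ‖w‖ ^ 2 = ‖w.fst‖ ^ 2 + ‖w.snd‖ ^ 2 :=
  WithLp.prod_norm_sq_eq_of_L2 w

theorem State.norm_fst_le (w : State dx dy) : ‖w.fst‖ ≤ ‖w‖ :=
  (pow_le_pow_iff_left₀ (norm_nonneg _) (norm_nonneg _) two_ne_zero).mp (by
    rw [State.norm_sq_eq w]; nlinarith [sq_nonneg ‖w.snd‖])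

theorem State.norm_snd_le (w : State dx dy) : ‖w.snd‖ ≤ ‖w‖ :=
  (pow_le_pow_iff_left₀ (norm_nonneg _) (norm_nonneg _) two_ne_zero).mp (by
    rw [State.norm_sq_eq w]; nlinarith [sq_nonneg ‖w.fst‖])

theorem State.norm_st_le (z : Pair dx dy) (θ : Vec dy) : ‖st z θ‖ ≤ ‖z‖ + ‖θ‖ :=
  (pow_le_pow_iff_left₀ (norm_nonneg _) (by positivity) two_ne_zero).mp (by
    rw [State.norm_sq_eq]; simp only [fst_st, snd_st]; nlinarith [norm_nonneg z, norm_nonneg θ])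

/-- The point `(x, θ)`. -/
def lowerPoint (w : State dx dy) : Pair dx dy := pair w.fst.fst w.snd

theorem norm_lowerPoint_sub_le (w w' : State dx dy) :
    ‖lowerPoint w - lowerPoint w'‖ ≤ ‖w - w'‖ := by
  refine (pow_le_pow_iff_left₀ (norm_nonneg _) (norm_nonneg _) two_ne_zero).mp ?_
  rw [State.norm_sq_eq (w - w'), norm_sq_eq_fst_add_snd (w - w').fst, norm_sq_eq_fst_add_snd]
  have h1 : (lowerPoint w - lowerPoint w').fst = (w - w').fst.fst := rfl
  have h2 : (lowerPoint w - lowerPoint w').snd = (w - w').snd := rfl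
  rw [h1, h2]
  nlinarith [sq_nonneg ‖(w - w').fst.snd‖]

theorem continuous_lowerPoint : Continuous (lowerPoint : State dx dy → Pair dx dy) :=
  continuous_of_lip (c := 1) fun w w' => by simpa using norm_lowerPoint_sub_le w w'

/-- `z ↦ (c z, 0)`. -/
def liftPair (c : ℝ) : Pair dx dy →ₗ[ℝ] State dx dy where
  toFun z := st (c • z) 0
  map_add' z z' := by
    rw [State.ext_iff']; simp
  map_smul' r z := by
    rw [State.ext_iff']; simp [smul_smul, mul_comm]

/-- `(a, b) ↦ (-c a, 0, b)`. -/
def crossPair (c : ℝ) : Pair dx dy →ₗ[ℝ] State dx dy where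
  toFun z := st (-(c • pair z.fst 0)) z.snd
  map_add' z z' := by
    rw [State.ext_iff']; simp; abel
  map_smul' r z := by
    rw [State.ext_iff']; simp [smul_smul, mul_comm]

/-- `(x, y, θ) ↦ (0, - c (y - θ) / γ, (θ - y) / γ)`. -/
def proximal (c γ : ℝ) : State dx dy →ₗ[ℝ] State dx dy where
  toFun w := st (-(c • pair 0 ((1 / γ) • (w.fst.snd - w.snd)))) ((1 / γ) • (w.snd - w.fst.snd))
  map_add' w w' := by
    rw [State.ext_iff']; simp; constructor <;> module
  map_smul' r w := by
    rw [State.ext_iff']; simp; constructor <;> module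

theorem norm_liftPair_le {c : ℝ} (hc : 0 ≤ c) (z : Pair dx dy) :
    ‖liftPair c z‖ ≤ (1 + c) * ‖z‖ := by
  refine (State.norm_st_le _ _).trans ?_
  rw [norm_smul, Real.norm_of_nonneg hc, norm_zero]
  nlinarith [norm_nonneg z]

theorem norm_crossPair_le {c : ℝ} (hc : 0 ≤ c) (z : Pair dx dy) :
    ‖crossPair c z‖ ≤ (1 + c) * ‖z‖ := by
  refine (State.norm_st_le _ _).trans ?_
  rw [norm_neg, norm_smul, Real.norm_of_nonneg hc]
  have h1 : ‖pair z.fst (0 : Vec dy)‖ ≤ ‖z‖ :=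
    norm_pair_le.trans (by simpa using norm_fst_le z)
  have h2 := norm_snd_le z
  nlinarith

theorem norm_proximal_le {c γ : ℝ} (hc : 0 ≤ c) (hγ : 0 < γ) (w : State dx dy) :
    ‖proximal c γ w‖ ≤ (1 + c) * (1 / γ) * ‖w.fst.snd - w.snd‖ := by
  refine (State.norm_st_le _ _).trans ?_
  rw [norm_neg, norm_smul, Real.norm_of_nonneg hc, norm_smul (1 / γ), norm_sub_rev w.snd,
    Real.norm_of_nonneg (show 0 ≤ 1 / γ by positivity)]
  have h1 : ‖pair (0 : Vec dx) ((1 / γ) • (w.fst.snd - w.snd))‖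
      ≤ 1 / γ * ‖w.fst.snd - w.snd‖ :=
    norm_pair_le.trans (by rw [norm_zero, zero_add, norm_smul, Real.norm_of_nonneg (by positivity)])
  nlinarith

theorem norm_snd_sub_le_two (w : State dx dy) : ‖w.fst.snd - w.snd‖ ≤ 2 * ‖w‖ := by
  have h1 := norm_sub_le w.fst.snd w.snd
  have h2 := (SunDSBO.norm_snd_le w.fst).trans (State.norm_fst_le w)
  have h3 := State.norm_snd_le w
  linarith

variable (f g : Fin n → Pair dx dy → ℝ) (c γ : ℝ)

/-- The part of the scaled direction field coming from the upper-level objective. -/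
def upperField (i : Fin n) (w : State dx dy) : State dx dy := liftPair c (gradient (f i) w.fst)

/-- The part of the scaled direction field coming from the lower-level objective. -/
def lowerField (i : Fin n) (w : State dx dy) : State dx dy :=
  liftPair c (gradient (g i) w.fst) + crossPair c (gradient (g i) (lowerPoint w)) + proximal c γ w

variable {f g c γ} {L₁ L₂ : ℝ}

theorem upperField_lipschitz (hf : ∀ i, IsSmooth L₁ (f i)) (hL₁ : 0 ≤ L₁) (hc : 0 ≤ c) (i : Fin n)
    (w w' : State dx dy) :
    ‖upperField f c i w - upperField f c i w'‖ ≤ (1 + c) * L₁ * ‖w - w'‖ := by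
  unfold upperField
  rw [← map_sub, mul_assoc]
  refine (norm_liftPair_le hc _).trans ?_
  gcongr
  refine ((hf i).lipschitz _ _).trans ?_
  gcongr
  exact State.norm_fst_le (w - w')

theorem lowerField_lipschitz (hg : ∀ i, IsSmooth L₂ (g i)) (hL₂ : 0 ≤ L₂) (hc : 0 ≤ c)
    (hγ : 0 < γ) (i : Fin n) (w w' : State dx dy) :
    ‖lowerField g c γ i w - lowerField g c γ i w'‖
      ≤ (1 + c) * (2 * L₂ + 2 / γ) * ‖w - w'‖ := by
  have e : lowerField g c γ i w - lowerField g c γ i w'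
      = liftPair c (gradient (g i) w.fst - gradient (g i) w'.fst)
        + crossPair c (gradient (g i) (lowerPoint w) - gradient (g i) (lowerPoint w'))
        + proximal c γ (w - w') := by
    unfold lowerField
    rw [map_sub, map_sub, map_sub]; abel
  have h1 : ‖gradient (g i) w.fst - gradient (g i) w'.fst‖ ≤ L₂ * ‖w - w'‖ := by
    refine ((hg i).lipschitz _ _).trans ?_
    gcongr
    exact State.norm_fst_le (w - w')
  have h2 : ‖gradient (g i) (lowerPoint w) - gradient (g i) (lowerPoint w')‖ ≤ L₂ * ‖w - w'‖ := by
    refine ((hg i).lipschitz _ _).trans ?_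
    gcongr
    exact norm_lowerPoint_sub_le w w'
  have h3 := (norm_liftPair_le hc (gradient (g i) w.fst - gradient (g i) w'.fst)).trans
    (mul_le_mul_of_nonneg_left h1 (by positivity))
  have h4 := (norm_crossPair_le hc
    (gradient (g i) (lowerPoint w) - gradient (g i) (lowerPoint w'))).trans
    (mul_le_mul_of_nonneg_left h2 (by positivity))
  have h5 := (norm_proximal_le hc hγ (w - w')).trans
    (mul_le_mul_of_nonneg_left (norm_snd_sub_le_two (w - w')) (by positivity))
  rw [e]
  refine (norm_add₃_le).trans ?_
  have h6 : (1 + c) * (2 * L₂ + 2 / γ) * ‖w - w'‖ = (1 + c) * (L₂ * ‖w - w'‖)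
      + (1 + c) * (L₂ * ‖w - w'‖) + (1 + c) * (1 / γ) * (2 * ‖w - w'‖) := by ring
  linarith

end States

/-! ### The potential -/

section Potential

variable {n dx dy : ℕ}

theorem moreauGradBase_sub_le {G : Pair dx dy → ℝ} {L γ : ℝ} (hG : IsSmooth L G) (hγ : 0 < γ)
    (z : Pair dx dy) (θ θ' : Vec dy) :
    ‖moreauGradBase G γ z θ - moreauGradBase G γ z θ'‖ ≤ (L + 1 / γ) * ‖θ - θ'‖ := by
  unfold moreauGradBase
  rw [pair_sub_pair]
  refine norm_pair_le.trans ?_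
  have h1 : ‖(gradient G (pair z.fst θ)).fst - (gradient G (pair z.fst θ')).fst‖
      ≤ L * ‖θ - θ'‖ := by
    refine (norm_fst_sub_fst_le _ _).trans ((hG.lipschitz _ _).trans_eq ?_)
    have : ‖pair z.fst θ - pair z.fst θ'‖ = ‖θ - θ'‖ := by
      rw [← sq_eq_sq₀ (norm_nonneg _) (norm_nonneg _), norm_sq_eq_fst_add_snd, pair_sub_pair]
      simp
    rw [this]
  have h2 : ‖(1 / γ) • (z.snd - θ) - (1 / γ) • (z.snd - θ')‖ = 1 / γ * ‖θ - θ'‖ := by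
    rw [← smul_sub, norm_smul, Real.norm_of_nonneg (by positivity), sub_sub_sub_cancel_left,
      norm_sub_rev]
  linarith

theorem moreauGrad_sub_le {G : Pair dx dy → ℝ} {L γ : ℝ} (hG : IsSmooth L G) (hγ : 0 < γ)
    (z : Pair dx dy) (θ θ' : Vec dy) :
    ‖moreauGrad G γ z θ - moreauGrad G γ z θ'‖ ≤ (L + 1 / γ) * ‖θ - θ'‖ := by
  have e : moreauGrad G γ z θ - moreauGrad G γ z θ'
      = ((gradient G (pair z.fst θ)).snd - (gradient G (pair z.fst θ')).snd)
        + (1 / γ) • (θ - θ') := by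
    unfold moreauGrad
    module
  have h1 : ‖(gradient G (pair z.fst θ)).snd - (gradient G (pair z.fst θ')).snd‖
      ≤ L * ‖θ - θ'‖ := by
    refine (norm_snd_sub_snd_le _ _).trans ((hG.lipschitz _ _).trans_eq ?_)
    have : ‖pair z.fst θ - pair z.fst θ'‖ = ‖θ - θ'‖ := by
      rw [← sq_eq_sq₀ (norm_nonneg _) (norm_nonneg _), norm_sq_eq_fst_add_snd, pair_sub_pair]
      simp
    rw [this]
  have h2 : ‖(1 / γ) • (θ - θ')‖ = 1 / γ * ‖θ - θ'‖ := by
    rw [norm_smul, Real.norm_of_nonneg (by positivity)]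
  rw [e]
  refine (norm_add_le _ _).trans ?_
  linarith

variable (F G : Pair dx dy → ℝ) (γ Flow : ℝ) (ts : Pair dx dy → Vec dy)

/-- The gradient of `m F + G - V_γ`. -/
def psiGrad (m : ℝ) (z : Pair dx dy) : Pair dx dy :=
  m • gradient F z + gradient G z - moreauGradBase G γ z (ts z)

/-- `m (F - Flow) + (G - V_γ)` plus the gap of `θ` in the definition of `V_γ`. -/
def potential (m : ℝ) (w : State dx dy) : ℝ :=
  m * (F w.fst - Flow) + (G w.fst - moreauEnv G γ w.fst)
    + (moreauObj G γ w.fst w.snd - moreauEnv G γ w.fst)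

/-- The gradient of `potential`. -/
def potentialGrad (m : ℝ) (w : State dx dy) : State dx dy :=
  st (psiGrad F G γ ts m w.fst
      - (moreauGradBase G γ w.fst (ts w.fst) - moreauGradBase G γ w.fst w.snd))
    (moreauGrad G γ w.fst w.snd)

/-- `‖∇(m F + G - V_γ)‖² + ‖θ - θ*‖²`. -/
def residual (m : ℝ) (w : State dx dy) : ℝ :=
  ‖psiGrad F G γ ts m w.fst‖ ^ 2 + ‖w.snd - ts w.fst‖ ^ 2

variable {F G γ Flow ts} {L₁ L₂ μ₀ m : ℝ}

/-- The Taylor bounds of F, G, the envelope and the θ-objective are added; the envelope occurs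
twice, hence the factor 2. This one-sided expansion is all that is required of `potentialGrad`. -/
theorem potential_smooth (hF : IsSmooth L₁ F) (hG : IsSmooth L₂ G) (hL₁ : 0 ≤ L₁) (hL₂ : 0 ≤ L₂)
    (hγ : 0 < γ) (hm : 0 < 1 / γ - L₂)
    (hts : ∀ z, IsMinOn (moreauObj G γ z) Set.univ (ts z)) (hm0 : 0 ≤ m) (hmμ : m ≤ μ₀)
    (w w' : State dx dy) :
    potential F G γ Flow m w' ≤ potential F G γ Flow m w
      + inner ℝ (potentialGrad F G γ ts m w) (w' - w)
      + (μ₀ * L₁ + L₂ + 2 * ((L₂ + 1 / γ) * (2 + (L₂ + 1 / γ) / (1 / γ - L₂))) + (L₂ + 1 / γ))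
        * ‖w' - w‖ ^ 2 := by
  set E := (L₂ + 1 / γ) * (2 + (L₂ + 1 / γ) / (1 / γ - L₂)) with hE
  have hE0 : 0 ≤ E := by positivity
  have hsub : (w' - w).fst = w'.fst - w.fst := rfl
  have hsub2 : (w' - w).snd = w'.snd - w.snd := rfl
  have hz2 : ‖w'.fst - w.fst‖ ^ 2 ≤ ‖w' - w‖ ^ 2 := by
    gcongr; exact State.norm_fst_le (w' - w)
  have h1 := (abs_le.mp (hF.taylor hL₁ w.fst w'.fst)).2
  have h2 := (abs_le.mp (hG.taylor hL₂ w.fst w'.fst)).2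
  have h3 := (abs_le.mp (moreauEnv_taylor hG hL₂ hγ hm hts w.fst w'.fst)).1
  have h4 := (abs_le.mp (moreauObj_taylor hG hL₂ hγ w.fst w'.fst w.snd w'.snd)).2
  rw [← hE] at h3
  have q1 : m * (L₁ * ‖w'.fst - w.fst‖ ^ 2) ≤ μ₀ * L₁ * ‖w' - w‖ ^ 2 := by
    rw [← mul_assoc]
    exact mul_le_mul (mul_le_mul_of_nonneg_right hmμ hL₁) hz2 (by positivity)
      (mul_nonneg (hm0.trans hmμ) hL₁)
  have q2 : L₂ * ‖w'.fst - w.fst‖ ^ 2 ≤ L₂ * ‖w' - w‖ ^ 2 := by gcongr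
  have q3 : E * ‖w'.fst - w.fst‖ ^ 2 ≤ E * ‖w' - w‖ ^ 2 := by gcongr
  have q4 : 1 / (2 * γ) * ‖(w'.snd - w.snd) - (w'.fst.snd - w.fst.snd)‖ ^ 2
      + L₂ * (‖w'.fst.fst - w.fst.fst‖ ^ 2 + ‖w'.snd - w.snd‖ ^ 2)
      ≤ (L₂ + 1 / γ) * ‖w' - w‖ ^ 2 := by
    have n1 := State.norm_sq_eq (w' - w)
    have n2 := norm_sq_eq_fst_add_snd (w'.fst - w.fst)
    rw [hsub, hsub2, n2] at n1
    rw [sub_fst, sub_snd] at n1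
    have n3 : ‖(w'.snd - w.snd) - (w'.fst.snd - w.fst.snd)‖ ^ 2
        ≤ 2 * (‖w'.snd - w.snd‖ ^ 2 + ‖w'.fst.snd - w.fst.snd‖ ^ 2) := by
      nlinarith [parallelogram_law_with_norm ℝ (w'.snd - w.snd) (w'.fst.snd - w.fst.snd),
        sq_nonneg ‖(w'.snd - w.snd) + (w'.fst.snd - w.fst.snd)‖]
    have n4 := mul_le_mul_of_nonneg_left n3 (show 0 ≤ 1 / (2 * γ) by positivity)
    have n5 : 1 / (2 * γ) * (2 * (‖w'.snd - w.snd‖ ^ 2 + ‖w'.fst.snd - w.fst.snd‖ ^ 2))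
        = 1 / γ * (‖w'.snd - w.snd‖ ^ 2 + ‖w'.fst.snd - w.fst.snd‖ ^ 2) := by field_simp
    have n6 : 0 ≤ 1 / γ * ‖w'.fst.fst - w.fst.fst‖ ^ 2 := by positivity
    have n7 : 0 ≤ L₂ * ‖w'.fst.snd - w.fst.snd‖ ^ 2 := by positivity
    rw [n1]
    linarith
  have h1' := mul_le_mul_of_nonneg_left h1 hm0
  have hin : inner ℝ (potentialGrad F G γ ts m w) (w' - w)
      = m * inner ℝ (gradient F w.fst) (w'.fst - w.fst)
        + inner ℝ (gradient G w.fst) (w'.fst - w.fst)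
        - 2 * inner ℝ (moreauGradBase G γ w.fst (ts w.fst)) (w'.fst - w.fst)
        + inner ℝ (moreauGradBase G γ w.fst w.snd) (w'.fst - w.fst)
        + inner ℝ (moreauGrad G γ w.fst w.snd) (w'.snd - w.snd) := by
    rw [State.inner_eq, hsub, hsub2]
    simp only [potentialGrad, psiGrad, fst_st, snd_st]
    rw [inner_sub_left, inner_sub_left, inner_sub_left, inner_add_left, inner_smul_left]
    simp only [conj_trivial]
    ring
  rw [hin]
  unfold potential
  linarith

theorem norm_psi_sub_le (hG : IsSmooth L₂ G) (hγ : 0 < γ) (z : Pair dx dy) (θ : Vec dy) :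
    ‖moreauGradBase G γ z (ts z) - moreauGradBase G γ z θ‖ ^ 2
      ≤ (L₂ + 1 / γ) ^ 2 * ‖θ - ts z‖ ^ 2 := by
  rw [← mul_pow, norm_sub_rev θ]
  gcongr
  exact moreauGradBase_sub_le hG hγ z _ _

theorem norm_moreauGrad_sq_le (hG : IsSmooth L₂ G) (hL₂ : 0 ≤ L₂) (hγ : 0 < γ)
    (hts : ∀ z, IsMinOn (moreauObj G γ z) Set.univ (ts z)) (z : Pair dx dy) (θ : Vec dy) :
    ‖moreauGrad G γ z θ‖ ^ 2 ≤ (L₂ + 1 / γ) ^ 2 * ‖θ - ts z‖ ^ 2 := by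
  rw [← mul_pow]
  gcongr
  have := moreauGrad_sub_le hG hγ z θ (ts z)
  rwa [moreauGrad_minimizer hG hL₂ hγ hts, sub_zero] at this

theorem potentialGrad_sq_le (hG : IsSmooth L₂ G) (hL₂ : 0 ≤ L₂) (hγ : 0 < γ)
    (hts : ∀ z, IsMinOn (moreauObj G γ z) Set.univ (ts z)) (m : ℝ) (w : State dx dy) :
    ‖potentialGrad F G γ ts m w‖ ^ 2
      ≤ (2 + 3 * (L₂ + 1 / γ) ^ 2) * residual F G γ ts m w := by
  have h1 := norm_psi_sub_le (ts := ts) hG hγ w.fst w.snd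
  have h2 := norm_moreauGrad_sq_le hG hL₂ hγ hts w.fst w.snd
  rw [State.norm_sq_eq]
  simp only [potentialGrad, fst_st, snd_st]
  set a := psiGrad F G γ ts m w.fst with ha
  set e := moreauGradBase G γ w.fst (ts w.fst) - moreauGradBase G γ w.fst w.snd
  have h3 : ‖a - e‖ ^ 2 ≤ 2 * ‖a‖ ^ 2 + 2 * ‖e‖ ^ 2 := by
    nlinarith [parallelogram_law_with_norm ℝ a e, sq_nonneg ‖a + e‖]
  unfold residual
  rw [← ha]
  nlinarith [mul_nonneg (sq_nonneg (L₂ + 1 / γ)) (sq_nonneg ‖a‖), sq_nonneg ‖w.snd - ts w.fst‖]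

/-- The lifting maps are linear and commute with averaging. In the z-component the replacement of θ*
by θ enters with the sign opposite to that in `potentialGrad`. -/
theorem mean_field {f g : Fin n → Pair dx dy → ℝ} {c : ℝ} (hn : 0 < n)
    (hf : ∀ i, IsSmooth L₁ (f i)) (hg : ∀ i, IsSmooth L₂ (g i))
    (hF : F = fun z => (1 / (n : ℝ)) * ∑ i, f i z)
    (hG : G = fun z => (1 / (n : ℝ)) * ∑ i, g i z) (w : State dx dy) :
    (mean fun i => m • upperField f c i w + lowerField g c γ i w)
      = st (c • (psiGrad F G γ ts m w.fst
          + (moreauGradBase G γ w.fst (ts w.fst) - moreauGradBase G γ w.fst w.snd)))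
        (moreauGrad G γ w.fst w.snd) := by
  have hF' : ∀ z, gradient F z = mean fun i => gradient (f i) z := fun z => by
    rw [hF]; exact (hasGradientAt_average hf z).gradient
  have hG' : ∀ z, gradient G z = mean fun i => gradient (g i) z := fun z => by
    rw [hG]; exact (hasGradientAt_average hg z).gradient
  have h1 : (mean fun i => m • upperField f c i w + lowerField g c γ i w)
      = m • liftPair c (gradient F w.fst) + (liftPair c (gradient G w.fst)
        + crossPair c (gradient G (lowerPoint w)) + proximal c γ w) := by
    unfold upperField lowerField
    rw [mean_add, mean_smul, mean_add, mean_add, mean_map, mean_map, mean_map, mean_const hn,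
      ← hF', ← hG', ← hG']
  rw [h1, State.ext_iff']
  simp [liftPair, crossPair, proximal, psiGrad, moreauGradBase, moreauGrad, lowerPoint]
  constructor <;> module

/-- The objectives of the bilevel problem form a `Landscape`. -/
theorem landscape {f g : Fin n → Pair dx dy → ℝ} {c : ℝ} {m : ℕ → ℝ} (hn : 0 < n)
    (hf : ∀ i, IsSmooth L₁ (f i)) (hg : ∀ i, IsSmooth L₂ (g i))
    (hFe : F = fun z => (1 / (n : ℝ)) * ∑ i, f i z)
    (hGe : G = fun z => (1 / (n : ℝ)) * ∑ i, g i z) (hFlow : ∀ z, Flow ≤ F z)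
    (hL₁ : 0 ≤ L₁) (hL₂ : 0 ≤ L₂) (hγ : 0 < γ) (hm2 : 0 < 1 / (2 * γ) - L₂)
    (hts : ∀ z, IsMinOn (moreauObj G γ z) Set.univ (ts z))
    (hm0 : ∀ k, 0 ≤ m k) (hmμ : ∀ k, m k ≤ μ₀) (hanti : ∀ k, m (k + 1) ≤ m k)
    (hc : 0 < c) (hcc : c ≤ (1 / γ - L₂) ^ 2 / (2 * (L₂ + 1 / γ) ^ 2)) :
    Landscape (fun k => potential F G γ Flow (m k)) (fun k => potentialGrad F G γ ts (m k))
      (fun k => residual F G γ ts (m k))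
      (fun k i w => m k • upperField f c i w + lowerField g c γ i w)
      (min c ((1 / γ - L₂) ^ 2 / 2)) ((1 + c ^ 2) * (2 + 3 * (L₂ + 1 / γ) ^ 2))
      ((1 + c) * (L₁ + μ₀ * L₁ + (2 * L₂ + 2 / γ)))
      (μ₀ * L₁ + L₂ + 2 * ((L₂ + 1 / γ) * (2 + (L₂ + 1 / γ) / (1 / γ - L₂))) + (L₂ + 1 / γ)) := by
  have hF : IsSmooth L₁ F := by rw [hFe]; exact isSmooth_average hn hf
  have hG : IsSmooth L₂ G := by rw [hGe]; exact isSmooth_average hn hg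
  have hm : 0 < 1 / γ - L₂ := by
    have : 1 / (2 * γ) ≤ 1 / γ := by gcongr; linarith
    linarith
  have hc₀ : 0 < L₂ + 1 / γ := by positivity
  have hres : ∀ k w, 0 ≤ residual F G γ ts (m k) w := fun k w => by unfold residual; positivity
  refine ⟨?_, ?_, ?_, hres, ?_, ?_, ?_, ?_⟩
  · intro k w
    have h1 := mul_nonneg (hm0 k) (sub_nonneg.mpr (hFlow w.fst))
    have h2 := moreauEnv_gap_lower hG hL₂ hγ hts w.fst
    have h3 : 0 ≤ (1 / (2 * γ) - L₂) * ‖w.fst.snd - ts w.fst‖ ^ 2 := by positivity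
    have h4 := moreauEnv_le hts w.fst w.snd
    simp only [potential]
    linarith
  · intro k w
    have := mul_le_mul_of_nonneg_right (hanti k) (sub_nonneg.mpr (hFlow w.fst))
    simp only [potential]
    linarith
  · exact fun k w w' => potential_smooth hF hG hL₁ hL₂ hγ hm hts (hm0 k) (hmμ k) w w'
  · intro k w
    rw [mean_field (ts := ts) hn hf hg hFe hGe, State.inner_eq]
    simp only [potentialGrad, fst_st, snd_st, residual]
    have h1 := norm_psi_sub_le (ts := ts) hG hγ w.fst w.snd
    have h2 := norm_sub_minimizer_le hG hL₂ hγ hts w.fst w.snd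
    set a := psiGrad F G γ ts (m k) w.fst
    set e := moreauGradBase G γ w.fst (ts w.fst) - moreauGradBase G γ w.fst w.snd
    -- The opposite signs of e make the cross terms cancel, leaving a difference of squares.
    have h3 : inner ℝ (a - e) (c • (a + e)) = c * (‖a‖ ^ 2 - ‖e‖ ^ 2) := by
      rw [inner_smul_right, inner_sub_left, inner_add_right, inner_add_right,
        real_inner_self_eq_norm_sq, real_inner_self_eq_norm_sq, real_inner_comm e a]
      ring
    rw [h3, real_inner_self_eq_norm_sq]
    have h4 : (1 / γ - L₂) ^ 2 * ‖w.snd - ts w.fst‖ ^ 2 ≤ ‖moreauGrad G γ w.fst w.snd‖ ^ 2 := by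
      rw [← mul_pow]; gcongr
    -- This is the only use of the upper bound on c: the error takes at most half of the decrease
    -- provided by strong monotonicity in θ.
    have h5 : c * ‖e‖ ^ 2 ≤ (1 / γ - L₂) ^ 2 / 2 * ‖w.snd - ts w.fst‖ ^ 2 := by
      calc c * ‖e‖ ^ 2 ≤ (1 / γ - L₂) ^ 2 / (2 * (L₂ + 1 / γ) ^ 2)
            * ((L₂ + 1 / γ) ^ 2 * ‖w.snd - ts w.fst‖ ^ 2) := by gcongr
        _ = _ := by field_simp
    have h6 := mul_le_mul_of_nonneg_right (min_le_left c ((1 / γ - L₂) ^ 2 / 2))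
      (sq_nonneg ‖a‖)
    have h7 := mul_le_mul_of_nonneg_right (min_le_right c ((1 / γ - L₂) ^ 2 / 2))
      (sq_nonneg ‖w.snd - ts w.fst‖)
    linarith
  · intro k w
    refine (potentialGrad_sq_le hG hL₂ hγ hts (m k) w).trans ?_
    have := hres k w
    gcongr
    nlinarith [mul_nonneg (sq_nonneg c) (show 0 ≤ 2 + 3 * (L₂ + 1 / γ) ^ 2 by positivity)]
  · intro k w
    rw [mean_field (ts := ts) hn hf hg hFe hGe, State.norm_sq_eq]
    simp only [fst_st, snd_st]
    have h1 := norm_psi_sub_le (ts := ts) hG hγ w.fst w.snd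
    have h2 := norm_moreauGrad_sq_le hG hL₂ hγ hts w.fst w.snd
    unfold residual
    set a := psiGrad F G γ ts (m k) w.fst
    set e := moreauGradBase G γ w.fst (ts w.fst) - moreauGradBase G γ w.fst w.snd
    set κ := (L₂ + 1 / γ) ^ 2
    set Q := ‖w.snd - ts w.fst‖ ^ 2
    have hκ : 0 ≤ κ := sq_nonneg _
    have hQ : 0 ≤ Q := sq_nonneg _
    have h3 : ‖a + e‖ ^ 2 ≤ 2 * ‖a‖ ^ 2 + 2 * (κ * Q) := by
      nlinarith [parallelogram_law_with_norm ℝ a e, sq_nonneg ‖a - e‖]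
    rw [norm_smul, mul_pow, Real.norm_eq_abs, sq_abs]
    have h4 := mul_le_mul_of_nonneg_left h3 (sq_nonneg c)
    have p1 : 0 ≤ κ * Q := by positivity
    have p2 : 0 ≤ c ^ 2 * (κ * Q) := by positivity
    have p3 : 0 ≤ κ * ‖a‖ ^ 2 := by positivity
    have p4 : 0 ≤ c ^ 2 * (κ * ‖a‖ ^ 2) := by positivity
    have p5 : 0 ≤ c ^ 2 * Q := by positivity
    have p6 : 0 ≤ ‖a‖ ^ 2 := by positivity
    linarith
  · intro k i w w'
    have e : (m k • upperField f c i w + lowerField g c γ i w)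
        - (m k • upperField f c i w' + lowerField g c γ i w')
        = m k • (upperField f c i w - upperField f c i w')
          + (lowerField g c γ i w - lowerField g c γ i w') := by module
    rw [e]
    refine (norm_add_le _ _).trans ?_
    rw [norm_smul, Real.norm_of_nonneg (hm0 k)]
    have h1 := mul_le_mul (hmμ k) (upperField_lipschitz hf hL₁ hc.le i w w') (norm_nonneg _)
      ((hm0 k).trans (hmμ k))
    have h2 := lowerField_lipschitz hg hL₂ hc.le hγ i w w'
    have h3 : 0 ≤ (1 + c) * L₁ * ‖w - w'‖ := by positivity
    linarith

end Potential

/-! ### Stochastic gradients -/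

section Oracle

variable {n dx dy : ℕ} {S : Type*} [MeasurableSpace S] {D : Fin n → Measure S}
  {loss : Fin n → Pair dx dy → S → ℝ} {δ L : ℝ}

/-- The error of the stochastic gradient. -/
def gradError (D : Fin n → Measure S) (loss : Fin n → Pair dx dy → S → ℝ) (i : Fin n)
    (z : Pair dx dy) (s : S) : Pair dx dy :=
  gradient (fun w => loss i w s) z - gradient (expectedLoss D loss i) z

namespace IsOracle

theorem measurable_gradError (h : IsOracle D loss δ)
    (hs : ∀ i, IsSmooth L (expectedLoss D loss i)) (i : Fin n) :
    Measurable fun q : Pair dx dy × S => gradError D loss i q.1 q.2 :=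
  (h.measurable_grad i).sub ((hs i).continuous_gradient.measurable.comp measurable_fst)

theorem integrable_gradError [∀ i, IsProbabilityMeasure (D i)] (h : IsOracle D loss δ)
    (i : Fin n) (z : Pair dx dy) : Integrable (gradError D loss i z) (D i) :=
  (h.integrable_grad i z).sub (integrable_const _)

theorem integral_gradError [∀ i, IsProbabilityMeasure (D i)] (h : IsOracle D loss δ)
    (i : Fin n) (z : Pair dx dy) : ∫ s, gradError D loss i z s ∂(D i) = 0 := by
  unfold gradError
  rw [integral_sub (h.integrable_grad i z) (integrable_const _), h.unbiased]
  simp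

theorem integrable_gradError_sq (h : IsOracle D loss δ) (i : Fin n) (z : Pair dx dy) :
    Integrable (fun s => ‖gradError D loss i z s‖ ^ 2) (D i) := by
  simpa only [gradError, norm_sub_rev] using h.integrable_sq i z

theorem integral_gradError_sq_le (h : IsOracle D loss δ) (i : Fin n) (z : Pair dx dy) :
    ∫ s, ‖gradError D loss i z s‖ ^ 2 ∂(D i) ≤ δ ^ 2 := by
  simpa only [gradError, norm_sub_rev] using h.variance i z

end IsOracle

variable {Sf Sg : Type*} [MeasurableSpace Sf] [MeasurableSpace Sg]

/-- The noise of the scaled stochastic directions. -/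
def stochNoise (P : Problem n dx dy Sf Sg) (c m : ℝ) (i : Fin n) (w : State dx dy) (s : Sf × Sg) :
    State dx dy :=
  m • liftPair c (gradError P.Df P.lossF i w.fst s.1)
    + liftPair c (gradError P.Dg P.lossG i w.fst s.2)
    + crossPair c (gradError P.Dg P.lossG i (lowerPoint w) s.2)

theorem norm_add_three_sq_le {E : Type*} [NormedAddCommGroup E] (a b c : E) :
    ‖a + b + c‖ ^ 2 ≤ 3 * (‖a‖ ^ 2 + ‖b‖ ^ 2 + ‖c‖ ^ 2) := by
  have h1 : ‖a + b + c‖ ^ 2 ≤ (‖a‖ + ‖b‖ + ‖c‖) ^ 2 := by gcongr; exact norm_add₃_le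
  nlinarith [sq_nonneg (‖a‖ - ‖b‖), sq_nonneg (‖b‖ - ‖c‖), sq_nonneg (‖a‖ - ‖c‖)]

theorem linear_integrable {E E' A : Type*} [NormedAddCommGroup E] [InnerProductSpace ℝ E]
    [FiniteDimensional ℝ E] [NormedAddCommGroup E'] [InnerProductSpace ℝ E']
    [FiniteDimensional ℝ E'] [MeasurableSpace A] {ν : Measure A} (T : E →ₗ[ℝ] E') {φ : A → E}
    (hφ : Integrable φ ν) :
    Integrable (fun a => T (φ a)) ν ∧ ∫ a, T (φ a) ∂ν = T (∫ a, φ a ∂ν) := by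
  have := FiniteDimensional.complete ℝ E
  have := FiniteDimensional.complete ℝ E'
  exact ⟨(LinearMap.toContinuousLinearMap T).integrable_comp hφ,
    (LinearMap.toContinuousLinearMap T).integral_comp_comm hφ⟩

theorem moments_comp {E A T : Type*} [NormedAddCommGroup E] [InnerProductSpace ℝ E]
    [FiniteDimensional ℝ E] [MeasurableSpace E] [BorelSpace E] [MeasurableSpace A]
    [MeasurableSpace T] {μ : Measure A} {ν : Measure T} {φ : A → E} {p : T → A} {V : ℝ}
    (hφ : Measurable φ) (hp : Measurable p) (hν : ν.map p = μ) (h1 : Integrable φ μ)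
    (h2 : ∫ s, φ s ∂μ = 0) (h3 : Integrable (fun s => ‖φ s‖ ^ 2) μ) (h4 : ∫ s, ‖φ s‖ ^ 2 ∂μ ≤ V) :
    Integrable (fun t => φ (p t)) ν ∧ ∫ t, φ (p t) ∂ν = 0 ∧
      Integrable (fun t => ‖φ (p t)‖ ^ 2) ν ∧ ∫ t, ‖φ (p t)‖ ^ 2 ∂ν ≤ V := by
  subst hν
  rw [integral_map hp.aemeasurable hφ.aestronglyMeasurable] at h2
  rw [integral_map hp.aemeasurable (hφ.norm.pow_const 2).aestronglyMeasurable] at h4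
  exact ⟨h1.comp_measurable hp, h2, h3.comp_measurable hp, h4⟩

theorem measurable_section {A B E : Type*} [MeasurableSpace A] [MeasurableSpace B]
    [MeasurableSpace E] {φ : A → B → E} (hφ : Measurable fun q : A × B => φ q.1 q.2) (a : A) :
    Measurable (φ a) := hφ.comp (measurable_const.prodMk measurable_id)

theorem measurable_linear_comp {E E' A B Q : Type*} [NormedAddCommGroup E] [InnerProductSpace ℝ E]
    [FiniteDimensional ℝ E] [MeasurableSpace E] [BorelSpace E] [NormedAddCommGroup E']
    [InnerProductSpace ℝ E'] [MeasurableSpace E'] [BorelSpace E'] [MeasurableSpace A]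
    [MeasurableSpace B] [MeasurableSpace Q] (T : E →ₗ[ℝ] E') {φ : A → B → E}
    (hφ : Measurable fun q : A × B => φ q.1 q.2) {u : Q → A} {v : Q → B} (hu : Measurable u)
    (hv : Measurable v) : Measurable fun q => T (φ (u q) (v q)) :=
  T.continuous_of_finiteDimensional.measurable.comp (hφ.comp (hu.prodMk hv))

theorem measurable_smul_add_add {E Q : Type*} [NormedAddCommGroup E] [InnerProductSpace ℝ E]
    [FiniteDimensional ℝ E] [MeasurableSpace E] [BorelSpace E] [MeasurableSpace Q] {u v w : Q → E}
    (hu : Measurable u) (hv : Measurable v) (hw : Measurable w) (r : ℝ) :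
    Measurable fun q => r • u q + v q + w q := ((hu.const_smul r).add hv).add hw

/-- Moments of the gradient error at a sample `p` whose law is `D i`. -/
theorem IsOracle.gradError_moments [∀ i, IsProbabilityMeasure (D i)] (h : IsOracle D loss δ)
    (hs : ∀ i, IsSmooth L (expectedLoss D loss i)) {T : Type*} [MeasurableSpace T] {ν : Measure T}
    {p : T → S} (hp : Measurable p) {i : Fin n} (hν : ν.map p = D i) (z : Pair dx dy) :
    Integrable (fun t => gradError D loss i z (p t)) ν ∧
      ∫ t, gradError D loss i z (p t) ∂ν = 0 ∧
      Integrable (fun t => ‖gradError D loss i z (p t)‖ ^ 2) ν ∧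
      ∫ t, ‖gradError D loss i z (p t)‖ ^ 2 ∂ν ≤ δ ^ 2 :=
  moments_comp (measurable_section (h.measurable_gradError hs i) z) hp hν
    (h.integrable_gradError i z) (h.integral_gradError i z) (h.integrable_gradError_sq i z)
    (h.integral_gradError_sq_le i z)

variable {P : Problem n dx dy Sf Sg} {L₁ L₂ δf δg c μ₀ m : ℝ}

theorem measurable_stochNoise (hP : Smoothness P L₁ L₂)
    (hf : IsOracle P.Df P.lossF δf) (hg : IsOracle P.Dg P.lossG δg) (i : Fin n) :
    Measurable fun q : State dx dy × (Sf × Sg) => stochNoise P c m i q.1 q.2 := by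
  have hfst : Measurable fun q : State dx dy × (Sf × Sg) => q.1.fst :=
    (WithLp.fstL 2 ℝ (Pair dx dy) (Vec dy)).continuous.measurable.comp measurable_fst
  have hlow : Measurable fun q : State dx dy × (Sf × Sg) => lowerPoint q.1 :=
    continuous_lowerPoint.measurable.comp measurable_fst
  have hSf : Measurable fun q : State dx dy × (Sf × Sg) => q.2.1 :=
    measurable_fst.comp measurable_snd
  have hSg : Measurable fun q : State dx dy × (Sf × Sg) => q.2.2 :=
    measurable_snd.comp measurable_snd
  have m1 := measurable_linear_comp (liftPair c) (hf.measurable_gradError hP.f_smooth i) hfst hSf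
  have m2 := measurable_linear_comp (liftPair c) (hg.measurable_gradError hP.g_smooth i) hfst hSg
  have m3 := measurable_linear_comp (crossPair c) (hg.measurable_gradError hP.g_smooth i) hlow hSg
  exact measurable_smul_add_add m1 m2 m3 m

theorem norm_smul_lift_add_sq_le (hc : 0 ≤ c) (hm0 : 0 ≤ m) (hmμ : m ≤ μ₀) (u v v' : Pair dx dy) :
    ‖m • liftPair c u + liftPair c v + crossPair c v'‖ ^ 2
      ≤ 3 * (1 + c) ^ 2 * (μ₀ ^ 2 * ‖u‖ ^ 2 + ‖v‖ ^ 2 + ‖v'‖ ^ 2) := by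
  refine (norm_add_three_sq_le _ _ _).trans ?_
  rw [norm_smul, Real.norm_of_nonneg hm0, mul_pow]
  have e1 : ‖liftPair c u‖ ^ 2 ≤ (1 + c) ^ 2 * ‖u‖ ^ 2 := by
    rw [← mul_pow]; gcongr; exact norm_liftPair_le hc _
  have e2 : ‖liftPair c v‖ ^ 2 ≤ (1 + c) ^ 2 * ‖v‖ ^ 2 := by
    rw [← mul_pow]; gcongr; exact norm_liftPair_le hc _
  have e3 : ‖crossPair c v'‖ ^ 2 ≤ (1 + c) ^ 2 * ‖v'‖ ^ 2 := by
    rw [← mul_pow]; gcongr; exact norm_crossPair_le hc _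
  have e4 : m ^ 2 ≤ μ₀ ^ 2 := pow_le_pow_left₀ hm0 hmμ 2
  have e5 := mul_le_mul e4 e1 (by positivity) (by positivity)
  linarith

theorem norm_stochNoise_sq_le (hc : 0 ≤ c) (hm0 : 0 ≤ m) (hmμ : m ≤ μ₀) (i : Fin n)
    (w : State dx dy) (s : Sf × Sg) :
    ‖stochNoise P c m i w s‖ ^ 2
      ≤ 3 * (1 + c) ^ 2 * (μ₀ ^ 2 * ‖gradError P.Df P.lossF i w.fst s.1‖ ^ 2
        + ‖gradError P.Dg P.lossG i w.fst s.2‖ ^ 2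
        + ‖gradError P.Dg P.lossG i (lowerPoint w) s.2‖ ^ 2) :=
  norm_smul_lift_add_sq_le hc hm0 hmμ _ _ _

/-- Only the marginals of ν enter, so the two samples of a pair may depend on each other. The same
lower-level sample is used at two points, which gives the 2 in μ₀² + 2. -/
theorem stochNoise_moments [∀ i, IsProbabilityMeasure (P.Df i)]
    [∀ i, IsProbabilityMeasure (P.Dg i)] (hP : Smoothness P L₁ L₂)
    (hf : IsOracle P.Df P.lossF δf) (hg : IsOracle P.Dg P.lossG δg) (hc : 0 ≤ c) (hm0 : 0 ≤ m)
    (hmμ : m ≤ μ₀) {ν : Measure (Sf × Sg)} {i : Fin n} (hνf : ν.map Prod.fst = P.Df i)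
    (hνg : ν.map Prod.snd = P.Dg i) (w : State dx dy) :
    Integrable (stochNoise P c m i w) ν ∧ ∫ s, stochNoise P c m i w s ∂ν = 0 ∧
      Integrable (fun s => ‖stochNoise P c m i w s‖ ^ 2) ν ∧
      ∫ s, ‖stochNoise P c m i w s‖ ^ 2 ∂ν
        ≤ 3 * (1 + c) ^ 2 * (μ₀ ^ 2 + 2) * (δf ^ 2 + δg ^ 2) := by
  obtain ⟨f1, f2, f3, f4⟩ := hf.gradError_moments hP.f_smooth measurable_fst hνf w.fst
  obtain ⟨g1, g2, g3, g4⟩ := hg.gradError_moments hP.g_smooth measurable_snd hνg w.fst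
  obtain ⟨k1, k2, k3, k4⟩ := hg.gradError_moments hP.g_smooth measurable_snd hνg (lowerPoint w)
  obtain ⟨s1, t1⟩ := linear_integrable (liftPair c) f1
  obtain ⟨s2, t2⟩ := linear_integrable (liftPair c) g1
  obtain ⟨s3, t3⟩ := linear_integrable (crossPair c) k1
  rw [f2, map_zero] at t1
  rw [g2, map_zero] at t2
  rw [k2, map_zero] at t3
  have hint : Integrable (stochNoise P c m i w) ν := ((s1.smul m).add s2).add s3
  have hdom : Integrable (fun s : Sf × Sg => 3 * (1 + c) ^ 2 *
      (μ₀ ^ 2 * ‖gradError P.Df P.lossF i w.fst s.1‖ ^ 2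
        + ‖gradError P.Dg P.lossG i w.fst s.2‖ ^ 2
        + ‖gradError P.Dg P.lossG i (lowerPoint w) s.2‖ ^ 2)) ν :=
    (((f3.const_mul _).add g3).add k3).const_mul _
  have hsq : Integrable (fun s => ‖stochNoise P c m i w s‖ ^ 2) ν := by
    refine hdom.mono' (hint.1.norm.pow 2) (ae_of_all _ fun s => ?_)
    rw [Real.norm_of_nonneg (by positivity)]
    exact norm_stochNoise_sq_le hc hm0 hmμ i w s
  refine ⟨hint, ?_, hsq, ?_⟩
  · have t4 := integral_add ((s1.smul m).add s2) s3
    have t5 := integral_add (s1.smul m) s2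
    simp only [Pi.add_apply, Pi.smul_apply] at t4 t5
    unfold stochNoise
    rw [t4, t5, integral_smul, t1, t2, t3]
    simp
  · refine (integral_mono hsq hdom (norm_stochNoise_sq_le hc hm0 hmμ i w)).trans ?_
    have t6 := integral_add ((f3.const_mul (μ₀ ^ 2)).add g3) k3
    have t7 := integral_add (f3.const_mul (μ₀ ^ 2)) g3
    simp only [Pi.add_apply] at t6 t7
    rw [integral_const_mul, t6, t7, integral_const_mul]
    have q1 := mul_le_mul_of_nonneg_left f4 (sq_nonneg μ₀)
    rw [mul_assoc (3 * (1 + c) ^ 2)]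
    refine mul_le_mul_of_nonneg_left ?_ (by positivity)
    nlinarith [sq_nonneg δf, sq_nonneg δg, mul_nonneg (sq_nonneg μ₀) (sq_nonneg δg)]

theorem isNoise_stochNoise {Ω : Type*} [MeasurableSpace Ω] {Pr : Measure Ω} [IsProbabilityMeasure Pr]
    {ξf : Fin n → ℕ → Ω → Sf} {ξg : Fin n → ℕ → Ω → Sg} {m : ℕ → ℝ} (hP : Smoothness P L₁ L₂)
    (hf : IsOracle P.Df P.lossF δf) (hg : IsOracle P.Dg P.lossG δg)
    (hs : IsSampling P Pr ξf ξg) (hc : 0 ≤ c) (hm0 : ∀ k, 0 ≤ m k) (hmμ : ∀ k, m k ≤ μ₀) :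
    IsNoise Pr (fun (q : Fin n × ℕ) ω => (ξf q.1 q.2 ω, ξg q.1 q.2 ω))
      (fun k i w s => stochNoise P c (m k) i w s)
      (3 * (1 + c) ^ 2 * (μ₀ ^ 2 + 2) * (δf ^ 2 + δg ^ 2)) := by
  have hDf : ∀ i, IsProbabilityMeasure (P.Df i) := fun i => by
    rw [← hs.law_f i 0]
    exact Measure.isProbabilityMeasure_map (hs.measurable_f i 0).aemeasurable
  have hDg : ∀ i, IsProbabilityMeasure (P.Dg i) := fun i => by
    rw [← hs.law_g i 0]
    exact Measure.isProbabilityMeasure_map (hs.measurable_g i 0).aemeasurable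
  have hξ : ∀ q : Fin n × ℕ, Measurable fun ω => (ξf q.1 q.2 ω, ξg q.1 q.2 ω) := fun q =>
    (hs.measurable_f q.1 q.2).prodMk (hs.measurable_g q.1 q.2)
  have hmf : ∀ q : Fin n × ℕ,
      (Pr.map fun ω => (ξf q.1 q.2 ω, ξg q.1 q.2 ω)).map Prod.fst = P.Df q.1 := fun q => by
    rw [Measure.map_map measurable_fst (hξ q)]; exact hs.law_f q.1 q.2
  have hmg : ∀ q : Fin n × ℕ,
      (Pr.map fun ω => (ξf q.1 q.2 ω, ξg q.1 q.2 ω)).map Prod.snd = P.Dg q.1 := fun q => by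
    rw [Measure.map_map measurable_snd (hξ q)]; exact hs.law_g q.1 q.2
  have key := fun (k : ℕ) (i : Fin n) =>
    stochNoise_moments hP hf hg hc (hm0 k) (hmμ k) (hmf (i, k)) (hmg (i, k))
  exact
    { meas_sample := hξ
      indep := hs.indep
      meas := fun k i => measurable_stochNoise hP hf hg i
      integrable := fun k i z => (key k i z).1
      mean_zero := fun k i z => (key k i z).2.1
      sq_integrable := fun k i z => (key k i z).2.2.1
      sq_le := fun k i z => (key k i z).2.2.2 }

end Oracle

/-! ### The algorithms in the state space -/

section Conversion

variable {n dx dy : ℕ} {Sf Sg : Type*} [MeasurableSpace Sf] [MeasurableSpace Sg]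

/-- The local variables as states. -/
def Vars.toState (v : Vars n dx dy) (i : Fin n) : State dx dy := st (pair (v.x i) (v.y i)) (v.θ i)

/-- `(z, θ) ↦ (c z, θ)`. -/
def scaleState (c : ℝ) : State dx dy →ₗ[ℝ] State dx dy where
  toFun w := st (c • w.fst) w.snd
  map_add' w w' := by
    rw [State.ext_iff']; simp
  map_smul' r w := by
    rw [State.ext_iff']; simp [smul_smul, mul_comm]

/-- Directions as states, with the components `x`, `y` scaled by `c`. -/
def Vars.scaled (c : ℝ) (v : Vars n dx dy) (i : Fin n) : State dx dy := scaleState c (v.toState i)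

theorem norm_scaleState_le {c : ℝ} (hc : 0 ≤ c) (w : State dx dy) :
    ‖scaleState c w‖ ≤ (1 + c) * ‖w‖ := by
  refine (pow_le_pow_iff_left₀ (norm_nonneg _) (by positivity) two_ne_zero).mp ?_
  rw [mul_pow, State.norm_sq_eq, State.norm_sq_eq]
  simp only [scaleState, LinearMap.coe_mk, AddHom.coe_mk, fst_st, snd_st, norm_smul, mul_pow,
    Real.norm_eq_abs, sq_abs]
  nlinarith [sq_nonneg ‖w.fst‖, sq_nonneg ‖w.snd‖, mul_nonneg hc (sq_nonneg ‖w.fst‖),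
    mul_nonneg hc (sq_nonneg ‖w.snd‖), mul_nonneg (sq_nonneg c) (sq_nonneg ‖w.snd‖)]

theorem State.sum_fst {ι : Type*} (s : Finset ι) (u : ι → State dx dy) :
    (∑ j ∈ s, u j).fst = ∑ j ∈ s, (u j).fst :=
  map_sum (WithLp.fstL 2 ℝ (Pair dx dy) (Vec dy)) u s

theorem State.sum_snd {ι : Type*} (s : Finset ι) (u : ι → State dx dy) :
    (∑ j ∈ s, u j).snd = ∑ j ∈ s, (u j).snd :=
  map_sum (WithLp.sndL 2 ℝ (Pair dx dy) (Vec dy)) u s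

theorem sum_fst {ι : Type*} (s : Finset ι) (u : ι → Pair dx dy) :
    (∑ j ∈ s, u j).fst = ∑ j ∈ s, (u j).fst :=
  map_sum (WithLp.fstL 2 ℝ (Vec dx) (Vec dy)) u s

theorem sum_snd {ι : Type*} (s : Finset ι) (u : ι → Pair dx dy) :
    (∑ j ∈ s, u j).snd = ∑ j ∈ s, (u j).snd :=
  map_sum (WithLp.sndL 2 ℝ (Vec dx) (Vec dy)) u s

theorem toState_mix (W : Matrix (Fin n) (Fin n) ℝ) (v : Vars n dx dy) :
    (Vars.mix W v).toState = mixing W v.toState := by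
  ext1 i
  rw [State.ext_iff']
  simp [Vars.toState, Vars.mix, mixing, State.sum_fst, State.sum_snd, sum_fst, sum_snd]

theorem scaled_mix (W : Matrix (Fin n) (Fin n) ℝ) (c : ℝ) (v : Vars n dx dy) :
    (Vars.mix W v).scaled c = mixing W (v.scaled c) := by
  have : v.scaled c = fun i => scaleState c (v.toState i) := rfl
  rw [this, mixing_map, ← toState_mix]
  rfl

/-- Scaling the x and y directions by c replaces the two step sizes by the single step r. -/
theorem toState_descend (c r : ℝ) (v D : Vars n dx dy) :
    (Vars.descend (c * r) r v D).toState = fun i => v.toState i - r • D.scaled c i := by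
  ext1 i
  rw [State.ext_iff']
  simp [Vars.toState, Vars.scaled, scaleState, Vars.descend, smul_smul, mul_comm]

theorem scaled_addSub (c : ℝ) (a b d : Vars n dx dy) :
    (Vars.addSub a b d).scaled c = fun i => a.scaled c i + b.scaled c i - d.scaled c i := by
  ext1 i
  rw [State.ext_iff']
  simp [Vars.toState, Vars.scaled, scaleState, Vars.addSub, smul_add, smul_sub]

theorem mean_toState (v : Vars n dx dy) : mean v.toState = st v.mean (avg v.θ) := by
  rw [State.ext_iff']
  simp [mean, Vars.toState, Vars.mean, avg, State.sum_fst, State.sum_snd, sum_fst, sum_snd]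

theorem dev_toState (v : Vars n dx dy) : dev v.toState = v.disagreement := by
  unfold dev msq Vars.disagreement
  rw [mean_toState]
  congr 1
  refine Finset.sum_congr rfl fun i _ => ?_
  rw [State.norm_sq_eq, norm_sq_eq_fst_add_snd]
  rfl

/-- An exact splitting: the expected gradients in the fields cancel against those subtracted in the
gradient errors, and the proximal part carries no noise. -/
theorem scaled_direction (P : Problem n dx dy Sf Sg) (c γ m : ℝ) (sf : Fin n → Sf) (sg : Fin n → Sg)
    (v : Vars n dx dy) :
    (direction P γ m sf sg v).scaled c = fun i =>
      (m • upperField P.f c i (v.toState i) + lowerField P.g c γ i (v.toState i))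
        + stochNoise P c m i (v.toState i) (sf i, sg i) := by
  ext1 i
  have e : (m • upperField P.f c i (v.toState i) + lowerField P.g c γ i (v.toState i))
        + stochNoise P c m i (v.toState i) (sf i, sg i)
      = m • liftPair c (gradient (fun z => P.lossF i z (sf i)) (v.toState i).fst)
        + liftPair c (gradient (fun z => P.lossG i z (sg i)) (v.toState i).fst)
        + crossPair c (gradient (fun z => P.lossG i z (sg i)) (lowerPoint (v.toState i)))
        + proximal c γ (v.toState i) := by
    unfold upperField lowerField stochNoise gradError Problem.f Problem.g
    rw [map_sub, map_sub, map_sub]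
    module
  rw [e, State.ext_iff']
  simp only [Vars.scaled, scaleState, Vars.toState, direction, liftPair, crossPair, proximal,
    lowerPoint, LinearMap.coe_mk, AddHom.coe_mk, fst_st, snd_st, WithLp.add_fst, WithLp.add_snd,
    WithLp.smul_fst, WithLp.smul_snd, WithLp.neg_fst, WithLp.neg_snd, fst_pair, snd_pair]
  refine ⟨?_, ?_, ?_⟩ <;> module

end Conversion

/-! ### Heterogeneity of the initial point -/

section Heterogeneity

variable {n dx dy : ℕ} {f g : Fin n → Pair dx dy → ℝ} {c γ L₁ L₂ μ₀ ℓ ρ : ℝ}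
  {W : Matrix (Fin n) (Fin n) ℝ}

/-- `(z, θ) ↦ (z - c (0, θ), 0)`, which removes the lower-level part of a direction with `y = θ`. -/
def upperPart (c : ℝ) : State dx dy →ₗ[ℝ] State dx dy where
  toFun w := st (w.fst - c • pair 0 w.snd) 0
  map_add' w w' := by
    rw [State.ext_iff']; simp; module
  map_smul' r w := by
    rw [State.ext_iff']; simp; module

theorem norm_upperPart_le (hc : 0 ≤ c) (w : State dx dy) : ‖upperPart c w‖ ≤ (1 + c) * ‖w‖ := by
  refine (State.norm_st_le _ _).trans ?_
  rw [norm_zero, add_zero]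
  refine (norm_sub_le _ _).trans ?_
  rw [norm_smul, Real.norm_of_nonneg hc]
  have h1 : ‖pair (0 : Vec dx) w.snd‖ ≤ ‖w.snd‖ := norm_pair_le.trans (by simp)
  have h2 := State.norm_fst_le w
  have h3 := State.norm_snd_le w
  nlinarith

/-- Subtracting c times the θ-component from the y-component cancels the proximal terms. Of the
lower level only the change of ∇g_i between (x, y) and (x, θ) remains, and it is small when y is
near θ. -/
theorem smul_upperField_eq (m : ℝ) (i : Fin n) (w : State dx dy) :
    m • upperField f c i w = upperPart c (m • upperField f c i w + lowerField g c γ i w)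
      - liftPair c (gradient (g i) w.fst - gradient (g i) (lowerPoint w)) := by
  rw [State.ext_iff']
  simp only [upperField, lowerField, upperPart, liftPair, crossPair, proximal,
    LinearMap.coe_mk, AddHom.coe_mk, fst_st, snd_st, WithLp.add_fst, WithLp.add_snd, WithLp.sub_fst,
    WithLp.sub_snd, WithLp.smul_fst, WithLp.smul_snd, WithLp.neg_fst, WithLp.neg_snd, fst_pair,
    snd_pair]
  refine ⟨?_, ?_, ?_⟩ <;> module

theorem norm_fst_sub_lowerPoint (w : State dx dy) :
    ‖w.fst - lowerPoint w‖ ≤ ‖w.fst.snd - w.snd‖ := by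
  have : w.fst - lowerPoint w = pair 0 (w.fst.snd - w.snd) := by
    unfold lowerPoint
    rw [← pair_fst_snd w.fst, pair_sub_pair, fst_pair, snd_pair, sub_self]
  rw [this]
  exact norm_pair_le.trans (by simp)

/-- The heterogeneity of the upper-level gradients is controlled by the disagreement of the
trackers. -/
theorem initial_heterogeneity_le (hW : IsGossip (State dx dy) W ρ) (hn : 0 < n)
    (hg : ∀ i, IsSmooth L₂ (g i)) (hL₂ : 0 ≤ L₂) (hc : 0 ≤ c)
    (hb : ∀ i w w', ‖(μ₀ • upperField f c i w + lowerField g c γ i w)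
      - (μ₀ • upperField f c i w' + lowerField g c γ i w')‖ ≤ ℓ * ‖w - w'‖)
    (w e : Fin n → State dx dy) :
    μ₀ ^ 2 * dev (mixing W fun i => upperField f c i (mean w))
      ≤ (1 + c) ^ 2 * (4 * dev (mixing W fun i =>
            (μ₀ • upperField f c i (w i) + lowerField g c γ i (w i)) + e i)
          + 8 * ℓ ^ 2 * dev w + 8 * msq e
          + 2 * L₂ ^ 2 * ‖(mean w).fst.snd - (mean w).snd‖ ^ 2) := by
  set b : Fin n → State dx dy → State dx dy := fun i w =>
    μ₀ • upperField f c i w + lowerField g c γ i w with hbdef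
  set z := mean w
  have e1 : (fun i => μ₀ • mixing W (fun i => upperField f c i z) i)
      = fun i => upperPart c (mixing W (fun i => b i z) i)
        - mixing W (fun i => liftPair c (gradient (g i) z.fst - gradient (g i) (lowerPoint z))) i := by
    rw [← mixing_smul]
    calc (mixing W fun i => μ₀ • upperField f c i z)
        = mixing W fun i => upperPart c (b i z)
          - liftPair c (gradient (g i) z.fst - gradient (g i) (lowerPoint z)) := by
          congr 1
          ext1 i
          exact smul_upperField_eq μ₀ i z
      _ = _ := by rw [mixing_sub, mixing_map]
  rw [← dev_smul, e1]
  refine (dev_sub_le_two _ _).trans ?_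
  have h1 := dev_map_le (upperPart c) (norm_upperPart_le hc) (mixing W fun i => b i z)
  -- The directions at the common point are the noisy initial directions minus a Lipschitz
  -- correction and the noise, so their mixed disagreement is bounded through the trackers.
  have e2 : (mixing W fun i => b i z) = fun i => mixing W (fun i => b i (w i) + e i) i
      - mixing W (fun i => (b i (w i) - b i z) + e i) i := by
    rw [← mixing_sub]
    congr 1
    ext1 i
    abel
  have h2 := dev_sub_le_two (mixing W fun i => b i (w i) + e i)
    (mixing W (fun i => (b i (w i) - b i z) + e i))
  rw [← e2] at h2
  have h3 := ((hW.dev_mixing_le hn (fun i => (b i (w i) - b i z) + e i)).trans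
    (dev_le_msq hn _)).trans (msq_add_le_two (fun i => b i (w i) - b i z) e)
  have h4 : msq (fun i => b i (w i) - b i z) ≤ ℓ ^ 2 * dev w :=
    msq_lip_sub_le hb w fun _ => z
  have h5 := (hW.dev_mixing_le hn
    (fun i => liftPair c (gradient (g i) z.fst - gradient (g i) (lowerPoint z)))).trans
    (dev_le_msq hn _)
  have h6 : msq (fun i => liftPair c (gradient (g i) z.fst - gradient (g i) (lowerPoint z)))
      ≤ (1 + c) ^ 2 * (L₂ ^ 2 * ‖z.fst.snd - z.snd‖ ^ 2) := by
    have := msq_le_msq (u := fun i => liftPair c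
        (gradient (g i) z.fst - gradient (g i) (lowerPoint z)))
      (v := fun _ : Fin n => z.fst.snd - z.snd) (c := (1 + c) ^ 2 * L₂ ^ 2) fun i => by
        rw [← mul_pow, ← mul_pow, mul_assoc]
        gcongr
        refine (norm_liftPair_le hc _).trans ?_
        gcongr
        refine ((hg i).lipschitz _ _).trans ?_
        gcongr
        exact norm_fst_sub_lowerPoint z
    rw [msq_const hn] at this
    linarith
  have h7 : dev (mixing W fun i => b i z)
      ≤ 2 * dev (mixing W fun i => b i (w i) + e i) + 4 * (ℓ ^ 2 * dev w) + 4 * msq e := by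
    linarith
  have h8 := mul_le_mul_of_nonneg_left h7 (sq_nonneg (1 + c))
  linarith

end Heterogeneity

/-! ### Penalties and late iterates -/

section Parameters

theorem penalty_pos {μ₀ p : ℝ} (hμ : 0 < μ₀) (k : ℕ) : 0 < penalty μ₀ p k := by
  unfold penalty; positivity

theorem penalty_zero (μ₀ p : ℝ) : penalty μ₀ p 0 = μ₀ := by simp [penalty]

theorem penalty_anti {μ₀ p : ℝ} (hμ : 0 < μ₀) (hp : 0 ≤ p) {k l : ℕ} (hkl : k ≤ l) :
    penalty μ₀ p l ≤ penalty μ₀ p k := by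
  unfold penalty
  refine mul_le_mul_of_nonneg_left ?_ hμ.le
  refine Real.rpow_le_rpow_of_nonpos (by positivity) ?_ (by linarith)
  have : (k : ℝ) ≤ l := by exact_mod_cast hkl
  linarith

theorem penalty_le {μ₀ p : ℝ} (hμ : 0 < μ₀) (hp : 0 ≤ p) (k : ℕ) : penalty μ₀ p k ≤ μ₀ := by
  simpa only [penalty_zero] using penalty_anti hμ hp k.zero_le

/-- With x = (k+1)/(k+2), the decrement is μ₀ (k+1)^(-p) (1 - x^p). For p ≤ 1 one has x ≤ x^p, so 1
- x^p ≤ 1 - x = 1/(k+2). -/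
theorem abs_penalty_sub_le {μ₀ p : ℝ} (hμ : 0 < μ₀) (hp : 0 ≤ p) (hp1 : p ≤ 1) (k : ℕ) :
    |penalty μ₀ p (k + 1) - penalty μ₀ p k| ≤ μ₀ / ((k : ℝ) + 2) := by
  rw [abs_of_nonpos (by linarith [penalty_anti (p := p) hμ hp k.le_succ])]
  have hk : (0 : ℝ) < (k : ℝ) + 1 := by positivity
  have hk2 : (0 : ℝ) < (k : ℝ) + 2 := by positivity
  set a : ℝ := ((k : ℝ) + 1) ^ (-p) with ha
  have ha1 : a ≤ 1 := Real.rpow_le_one_of_one_le_of_nonpos (by linarith [k.cast_nonneg (α := ℝ)])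
    (by linarith)
  have ha0 : 0 < a := by positivity
  set x : ℝ := ((k : ℝ) + 1) / ((k : ℝ) + 2) with hx
  have hx1 : x ≤ 1 := by rw [hx, div_le_one hk2]; linarith
  have h1 : ((k : ℝ) + 2) ^ (-p) = a * x ^ p := by
    rw [ha, hx, Real.div_rpow hk.le hk2.le, Real.rpow_neg hk.le, Real.rpow_neg hk2.le]
    have := Real.rpow_pos_of_pos hk p
    field_simp
  have h2 : x ≤ x ^ p := by
    calc x = x ^ (1 : ℝ) := (Real.rpow_one x).symm
      _ ≤ x ^ p := Real.rpow_le_rpow_of_exponent_ge (by positivity) hx1 hp1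
  have h3 : 1 - x = 1 / ((k : ℝ) + 2) := by rw [hx]; field_simp; ring
  have h4 : ((k + 1 : ℕ) : ℝ) + 1 = (k : ℝ) + 2 := by push_cast; ring
  have h5 : -(penalty μ₀ p (k + 1) - penalty μ₀ p k) = μ₀ * (a * (1 - x ^ p)) := by
    unfold penalty
    rw [h4, h1]
    ring
  rw [h5, div_eq_mul_one_div, ← h3]
  have h6 : x ^ p ≤ 1 := Real.rpow_le_one (by positivity) hx1 hp
  refine mul_le_mul_of_nonneg_left ?_ hμ.le
  nlinarith

theorem penalty_late {μ₀ p : ℝ} (hμ : 0 < μ₀) (hp : 0 ≤ p) {K k : ℕ} (hK : 0 < K)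
    (hk : k ∈ lateIters K) : penalty μ₀ p k ≤ μ₀ * (2 / (K : ℝ)) ^ p := by
  obtain ⟨h1, -⟩ := Finset.mem_Icc.mp hk
  -- The floor in (K-1)/2 is compensated by the shift k + 1 in the penalty.
  have h2 : K ≤ 2 * (k + 1) := by omega
  have h3 : (K : ℝ) ≤ 2 * ((k : ℝ) + 1) := by exact_mod_cast h2
  have hK' : (0 : ℝ) < K := by exact_mod_cast hK
  unfold penalty
  refine mul_le_mul_of_nonneg_left ?_ hμ.le
  rw [Real.rpow_neg (by positivity), ← Real.inv_rpow (by positivity)]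
  refine Real.rpow_le_rpow (by positivity) ?_ hp
  rw [inv_eq_one_div, div_le_div_iff₀ (by positivity) hK']
  linarith

/-- The late block contains at least K/2 of the K indices, so its minimum times K/2 is at most the
whole sum. -/
theorem exists_late_le {E : ℕ → ℝ} (hE : ∀ k, 0 ≤ E k) {K : ℕ} (hK : 0 < K) :
    ∃ k ∈ lateIters K, (K : ℝ) / 2 * E k ≤ ∑ j ∈ Finset.range K, E j := by
  obtain ⟨k, hk, hmin⟩ := Finset.exists_min_image (lateIters K) E (lateIters_nonempty K)
  refine ⟨k, hk, ?_⟩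
  have h1 : (lateIters K).card • E k ≤ ∑ j ∈ lateIters K, E j :=
    Finset.card_nsmul_le_sum _ _ _ hmin
  have h2 : ∑ j ∈ lateIters K, E j ≤ ∑ j ∈ Finset.range K, E j := by
    refine Finset.sum_le_sum_of_subset_of_nonneg (fun j hj => ?_) fun j _ _ => hE j
    have := (Finset.mem_Icc.mp hj).2
    exact Finset.mem_range.mpr (by omega)
  have h3 : K ≤ 2 * (lateIters K).card := by
    rw [lateIters, Nat.card_Icc]; omega
  have h4 : (K : ℝ) ≤ 2 * ((lateIters K).card : ℝ) := by exact_mod_cast h3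
  rw [nsmul_eq_mul] at h1
  refine le_trans ?_ (h1.trans h2)
  exact mul_le_mul_of_nonneg_right (by linarith) (hE k)

/-- Divide by r K with r = cθ √n/√K: the terms I, K r³ J/d and K r² v/n become I/(cθ √n √K), cθ² n
J/(d K) and cθ v/(√n √K). Here d is a power of the spectral gap. -/
theorem exists_late_bound {E : ℕ → ℝ} (hE : ∀ k, 0 ≤ E k) {n K : ℕ} (hn : 0 < n) (hK : 0 < K)
    {cθ κ a₀ a₁ a₂ I J v d : ℝ} (hc : 0 < cθ) (hκ : 0 < κ) (hd : 0 < d)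
    (h : rate cθ n K * κ * ∑ k ∈ Finset.range K, E k
      ≤ a₀ * I + a₁ * (K * (rate cθ n K ^ 3 / d * J))
        + a₂ * (K * (rate cθ n K ^ 2 * (v / n)))) :
    ∃ k ∈ lateIters K, E k ≤ 2 / κ * (a₀ / cθ * (I / (Real.sqrt n * Real.sqrt K))
      + a₁ * cθ ^ 2 * (n * J / (d * K)) + a₂ * cθ * (v / (Real.sqrt n * Real.sqrt K))) := by
  obtain ⟨k, hk, hle⟩ := exists_late_le hE hK
  refine ⟨k, hk, ?_⟩
  have hn' : (0 : ℝ) < n := by exact_mod_cast hn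
  have hK' : (0 : ℝ) < K := by exact_mod_cast hK
  set s := Real.sqrt n with hs
  set t := Real.sqrt K with ht
  have hs0 : 0 < s := Real.sqrt_pos.mpr hn'
  have ht0 : 0 < t := Real.sqrt_pos.mpr hK'
  have hs2 : (n : ℝ) = s ^ 2 := (Real.sq_sqrt hn'.le).symm
  have ht2 : (K : ℝ) = t ^ 2 := (Real.sq_sqrt hK'.le).symm
  have hr : rate cθ n K = cθ * s / t := rfl
  have hpos : 0 < rate cθ n K * κ * ((K : ℝ) / 2) := by rw [hr]; positivity
  have h1 : rate cθ n K * κ * ((K : ℝ) / 2) * E k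
      ≤ a₀ * I + a₁ * (K * (rate cθ n K ^ 3 / d * J)) + a₂ * (K * (rate cθ n K ^ 2 * (v / n))) := by
    refine le_trans ?_ h
    rw [mul_assoc]
    exact mul_le_mul_of_nonneg_left hle (by rw [hr]; positivity)
  rw [← le_div_iff₀' hpos] at h1
  refine h1.trans (le_of_eq ?_)
  rw [hr, hs2, ht2]
  field_simp

/-- The witness min 1 κ/(1 + a + b + c + d) meets all restrictions at once. -/
theorem exists_small (a b c d : ℝ) {κ : ℝ} (hκ : 0 < κ) (ha : 0 ≤ a) (hb : 0 ≤ b) (hc : 0 ≤ c)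
    (hd : 0 ≤ d) : ∃ l : ℝ, 0 < l ∧ l ≤ 1 ∧ a * l ≤ κ ∧ b * l ≤ 1 ∧ c * l ≤ 1 ∧ d * l ≤ κ := by
  have hm : 0 < min 1 κ := lt_min one_pos hκ
  have hs : 0 < 1 + a + b + c + d := by positivity
  have key : ∀ x, 0 ≤ x → x ≤ 1 + a + b + c + d →
      x * (min 1 κ / (1 + a + b + c + d)) ≤ min 1 κ := fun x _ hx => by
    rw [mul_div_assoc', div_le_iff₀ hs]
    nlinarith
  refine ⟨min 1 κ / (1 + a + b + c + d), by positivity, ?_, ?_, ?_, ?_, ?_⟩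
  · simpa using (key 1 zero_le_one (by linarith)).trans (min_le_left _ _)
  · exact (key a ha (by linarith)).trans (min_le_right _ _)
  · exact (key b hb (by linarith)).trans (min_le_left _ _)
  · exact (key c hc (by linarith)).trans (min_le_left _ _)
  · exact (key d hd (by linarith)).trans (min_le_right _ _)

end Parameters

/-! ### Regularity of the penalized problem -/

section Regularity

variable {n dx dy : ℕ} {F G : Pair dx dy → ℝ} {L₁ L₂ γ m : ℝ} {ts : Pair dx dy → Vec dy}

theorem psiGrad_lipschitz (hF : IsSmooth L₁ F) (hG : IsSmooth L₂ G) (hL₂ : 0 ≤ L₂) (hγ : 0 < γ)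
    (hm2 : 0 < 1 / γ - L₂) (hts : ∀ z, IsMinOn (moreauObj G γ z) Set.univ (ts z)) (hm0 : 0 ≤ m)
    (z z' : Pair dx dy) :
    ‖psiGrad F G γ ts m z - psiGrad F G γ ts m z'‖
      ≤ (m * L₁ + L₂ + (L₂ + 1 / γ) * (1 + (L₂ + 1 / γ) / (1 / γ - L₂))) * ‖z - z'‖ := by
  have e : psiGrad F G γ ts m z - psiGrad F G γ ts m z'
      = m • (gradient F z - gradient F z') + (gradient G z - gradient G z')
        + -(moreauGradBase G γ z (ts z) - moreauGradBase G γ z' (ts z')) := by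
    unfold psiGrad; module
  have h1 := mul_le_mul_of_nonneg_left (hF.lipschitz z z') hm0
  have h2 := hG.lipschitz z z'
  have h3 := moreauGradBase_lipschitz hG hL₂ hγ hm2 hts z z'
  rw [e]
  refine norm_add₃_le.trans ?_
  rw [norm_smul, Real.norm_of_nonneg hm0, norm_neg]
  linarith

theorem lowerGap_lipschitz (hG : IsSmooth L₂ G) (hL₂ : 0 ≤ L₂) (hγ : 0 < γ)
    (hm2 : 0 < 1 / γ - L₂) (hts : ∀ z, IsMinOn (moreauObj G γ z) Set.univ (ts z))
    (w w' : State dx dy) :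
    ‖(w.snd - ts w.fst) - (w'.snd - ts w'.fst)‖
      ≤ (1 + (L₂ + 1 / γ) / (1 / γ - L₂)) * ‖w - w'‖ := by
  have h1 := minimizer_lipschitz hG hL₂ hγ hm2 hts w.fst w'.fst
  have h2 : ‖w.fst - w'.fst‖ ≤ ‖w - w'‖ := State.norm_fst_le (w - w')
  have h3 : ‖w.snd - w'.snd‖ ≤ ‖w - w'‖ := State.norm_snd_le (w - w')
  have h4 : 0 ≤ (L₂ + 1 / γ) / (1 / γ - L₂) := by positivity
  have h5 := mul_le_mul_of_nonneg_left h2 h4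
  rw [sub_sub_sub_comm]
  refine (norm_sub_le _ _).trans ?_
  linarith

theorem State.continuous_fst : Continuous fun w : State dx dy => w.fst :=
  (WithLp.fstL 2 ℝ (Pair dx dy) (Vec dy)).continuous

theorem continuous_residual (hF : IsSmooth L₁ F) (hG : IsSmooth L₂ G) (hL₂ : 0 ≤ L₂) (hγ : 0 < γ)
    (hm2 : 0 < 1 / γ - L₂) (hts : ∀ z, IsMinOn (moreauObj G γ z) Set.univ (ts z)) (hm0 : 0 ≤ m) :
    Continuous (residual F G γ ts m) := by
  have h1 := (continuous_of_lip (psiGrad_lipschitz hF hG hL₂ hγ hm2 hts hm0)).comp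
    (State.continuous_fst (dx := dx) (dy := dy))
  have h2 := continuous_of_lip (lowerGap_lipschitz hG hL₂ hγ hm2 hts)
  exact (h1.norm.pow 2).add (h2.norm.pow 2)

/-- Serves only integrability, so the constant may depend on the objectives. -/
theorem residual_growth (hF : IsSmooth L₁ F) (hG : IsSmooth L₂ G) (hL₂ : 0 ≤ L₂) (hγ : 0 < γ)
    (hm2 : 0 < 1 / γ - L₂) (hts : ∀ z, IsMinOn (moreauObj G γ z) Set.univ (ts z)) (hm0 : 0 ≤ m) :
    ∃ c, ∀ w, residual F G γ ts m w ≤ c * (1 + ‖w‖ ^ 2) := by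
  have h1 := norm_sq_le_of_lip (psiGrad_lipschitz hF hG hL₂ hγ hm2 hts hm0)
  have h2 := norm_sq_le_of_lip (lowerGap_lipschitz hG hL₂ hγ hm2 hts)
  refine ⟨_, fun w => (add_le_add ((h1 w.fst).trans
    (mul_le_mul_of_nonneg_left (b := 1 + ‖w.fst‖ ^ 2) (c := 1 + ‖w‖ ^ 2) ?_ (by positivity)))
    (h2 w)).trans_eq (add_mul _ _ _).symm⟩
  have := State.norm_sq_eq w
  nlinarith [sq_nonneg ‖w.snd‖]

theorem continuous_potentialGrad (hF : IsSmooth L₁ F) (hG : IsSmooth L₂ G) (hL₂ : 0 ≤ L₂)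
    (hγ : 0 < γ) (hm2 : 0 < 1 / γ - L₂)
    (hts : ∀ z, IsMinOn (moreauObj G γ z) Set.univ (ts z)) (hm0 : 0 ≤ m) :
    Continuous (potentialGrad F G γ ts m) := by
  have h1 := (continuous_of_lip (psiGrad_lipschitz hF hG hL₂ hγ hm2 hts hm0)).comp
    (State.continuous_fst (dx := dx) (dy := dy))
  have h2 := (continuous_of_lip (moreauGradBase_lipschitz hG hL₂ hγ hm2 hts)).comp
    (State.continuous_fst (dx := dx) (dy := dy))
  have h3 : Continuous fun w : State dx dy => gradient G (pair w.fst.fst w.snd) :=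
    hG.continuous_gradient.comp continuous_lowerPoint
  have h4 : Continuous fun w : State dx dy => moreauGradBase G γ w.fst w.snd := by
    unfold moreauGradBase pair
    fun_prop
  have h5 : Continuous fun w : State dx dy => moreauGrad G γ w.fst w.snd := by
    unfold moreauGrad
    fun_prop
  have h6 : Continuous fun q : Pair dx dy × Vec dy => st q.1 q.2 := by
    unfold st
    fun_prop
  exact h6.comp ((h1.sub (h2.sub h4)).prodMk h5)

theorem hasGradientAt_psi (hF : IsSmooth L₁ F) (hG : IsSmooth L₂ G) (hL₂ : 0 ≤ L₂) (hγ : 0 < γ)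
    (hm2 : 0 < 1 / γ - L₂) (hts : ∀ z, IsMinOn (moreauObj G γ z) Set.univ (ts z)) (m : ℝ)
    (z : Pair dx dy) :
    HasGradientAt (fun z => m * F z + G z - moreauEnv G γ z) (psiGrad F G γ ts m z) z := by
  rw [hasGradientAt_iff_hasFDerivAt]
  have h := (((hF.hasGradientAt z).hasFDerivAt.const_mul m).add
    (hG.hasGradientAt z).hasFDerivAt).sub (hasGradientAt_moreauEnv hG hL₂ hγ hm2 hts z).hasFDerivAt
  unfold psiGrad
  rw [map_sub, map_add, map_smul]
  exact h

end Regularity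

/-! ### The standing assumptions -/

section Standing

variable {n dx dy : ℕ} {Sf Sg : Type*} [MeasurableSpace Sf] [MeasurableSpace Sg]

/-- The standing assumptions on the problem and on the parameters. -/
structure Regular (P : Problem n dx dy Sf Sg) (Flow L₁ L₂ γ μ₀ p c : ℝ) : Prop where
  n_pos : 0 < n
  L₁_nonneg : 0 ≤ L₁
  L₂_pos : 0 < L₂
  γ_pos : 0 < γ
  γ_lt : γ < 1 / (2 * L₂)
  μ₀_pos : 0 < μ₀
  p_nonneg : 0 ≤ p
  p_le_one : p ≤ 1
  c_pos : 0 < c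
  c_le : c ≤ (1 / γ - L₂) ^ 2 / (2 * (L₂ + 1 / γ) ^ 2)
  lower : ∀ z, Flow ≤ P.F z
  smooth : Smoothness P L₁ L₂

/-- Rate of decrease of the potential. -/
def ascentConst (L₂ γ c : ℝ) : ℝ := min c ((1 / γ - L₂) ^ 2 / 2)

/-- Bound for gradients by the residual. -/
def gradConst (L₂ γ c : ℝ) : ℝ := (1 + c ^ 2) * (2 + 3 * (L₂ + 1 / γ) ^ 2)

/-- Lipschitz constant of the directions. -/
def lipConst (L₁ L₂ γ μ₀ c : ℝ) : ℝ := (1 + c) * (L₁ + μ₀ * L₁ + (2 * L₂ + 2 / γ))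

/-- Smoothness constant of the potential. -/
def smoothConst (L₁ L₂ γ μ₀ : ℝ) : ℝ :=
  μ₀ * L₁ + L₂ + 2 * ((L₂ + 1 / γ) * (2 + (L₂ + 1 / γ) / (1 / γ - L₂))) + (L₂ + 1 / γ)

/-- Constant of the bias caused by the disagreement of the agents. -/
def biasConst (L₁ L₂ γ μ₀ c : ℝ) : ℝ :=
  (gradConst L₂ γ c / ascentConst L₂ γ c + 4 * smoothConst L₁ L₂ γ μ₀) * lipConst L₁ L₂ γ μ₀ c ^ 2

/-- Constant of the growth of the disagreement of the trackers. -/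
def trackConst (L₁ L₂ γ μ₀ c : ℝ) : ℝ :=
  32 * μ₀ ^ 2 * lipConst L₁ L₂ γ μ₀ c ^ 2 + 128 * lipConst L₁ L₂ γ μ₀ c ^ 2

/-- Constant of the second moments of the directions. -/
def noiseConst (μ₀ c : ℝ) : ℝ := 3 * (1 + c) ^ 2 * (μ₀ ^ 2 + 2)

namespace Regular

variable {P : Problem n dx dy Sf Sg} {Flow L₁ L₂ γ μ₀ p c : ℝ}

theorem half_gap_pos (h : Regular P Flow L₁ L₂ γ μ₀ p c) : 0 < 1 / (2 * γ) - L₂ := by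
  have h1 := h.γ_lt
  have h2 := h.L₂_pos
  have h3 := h.γ_pos
  rw [lt_div_iff₀ (by positivity)] at h1
  rw [sub_pos, lt_div_iff₀ (by positivity)]
  linarith

theorem gap_pos (h : Regular P Flow L₁ L₂ γ μ₀ p c) : 0 < 1 / γ - L₂ := by
  have h1 := h.half_gap_pos
  have h2 := h.γ_pos
  have : 1 / (2 * γ) ≤ 1 / γ := by gcongr; linarith
  linarith

theorem F_smooth (h : Regular P Flow L₁ L₂ γ μ₀ p c) : IsSmooth L₁ P.F :=
  isSmooth_average h.n_pos h.smooth.f_smooth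

theorem G_smooth (h : Regular P Flow L₁ L₂ γ μ₀ p c) : IsSmooth L₂ P.G :=
  isSmooth_average h.n_pos h.smooth.g_smooth

/-- A minimizer exists, so the point chosen by `Classical.epsilon` is one; `Problem.proxObj` and
`moreauObj P.G` unfold to the same expression. -/
theorem isMinOn_thetaStar (h : Regular P Flow L₁ L₂ γ μ₀ p c) (z : Pair dx dy) :
    IsMinOn (moreauObj P.G γ z) Set.univ (P.thetaStar γ z) :=
  Classical.epsilon_spec
    (exists_isMinOn_moreauObj h.G_smooth h.L₂_pos.le h.γ_pos h.half_gap_pos z)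

theorem hasGradientAt_Psi (h : Regular P Flow L₁ L₂ γ μ₀ p c) (m : ℝ) (z : Pair dx dy) :
    HasGradientAt (P.Psi γ m) (psiGrad P.F P.G γ (P.thetaStar γ) m z) z :=
  hasGradientAt_psi h.F_smooth h.G_smooth h.L₂_pos.le h.γ_pos h.gap_pos h.isMinOn_thetaStar m z

theorem statSq_eq (h : Regular P Flow L₁ L₂ γ μ₀ p c) (m : ℝ) (z : Pair dx dy) :
    statSq P γ m z = ‖psiGrad P.F P.G γ (P.thetaStar γ) m z‖ ^ 2 := by
  rw [statSq, (h.hasGradientAt_Psi m z).gradient]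

theorem landscape (h : Regular P Flow L₁ L₂ γ μ₀ p c) :
    Landscape (fun k => potential P.F P.G γ Flow (penalty μ₀ p k))
      (fun k => potentialGrad P.F P.G γ (P.thetaStar γ) (penalty μ₀ p k))
      (fun k => residual P.F P.G γ (P.thetaStar γ) (penalty μ₀ p k))
      (fun k i w => penalty μ₀ p k • upperField P.f c i w + lowerField P.g c γ i w)
      (ascentConst L₂ γ c) (gradConst L₂ γ c) (lipConst L₁ L₂ γ μ₀ c) (smoothConst L₁ L₂ γ μ₀) :=
  SunDSBO.landscape h.n_pos h.smooth.f_smooth h.smooth.g_smooth rfl rfl h.lower h.L₁_nonneg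
    h.L₂_pos.le h.γ_pos h.half_gap_pos h.isMinOn_thetaStar (fun k => (penalty_pos h.μ₀_pos k).le)
    (penalty_le h.μ₀_pos h.p_nonneg) (fun k => penalty_anti h.μ₀_pos h.p_nonneg k.le_succ)
    h.c_pos h.c_le

theorem measurable_potentialGrad (h : Regular P Flow L₁ L₂ γ μ₀ p c) (k : ℕ) :
    Measurable (potentialGrad P.F P.G γ (P.thetaStar γ) (penalty μ₀ p k)) :=
  (continuous_potentialGrad h.F_smooth h.G_smooth h.L₂_pos.le h.γ_pos h.gap_pos
    h.isMinOn_thetaStar (penalty_pos h.μ₀_pos k).le).measurable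

theorem measurable_residual (h : Regular P Flow L₁ L₂ γ μ₀ p c) (k : ℕ) :
    Measurable (residual P.F P.G γ (P.thetaStar γ) (penalty μ₀ p k)) :=
  (continuous_residual h.F_smooth h.G_smooth h.L₂_pos.le h.γ_pos h.gap_pos
    h.isMinOn_thetaStar (penalty_pos h.μ₀_pos k).le).measurable

theorem residual_growth (h : Regular P Flow L₁ L₂ γ μ₀ p c) (k : ℕ) :
    ∃ b, ∀ w, residual P.F P.G γ (P.thetaStar γ) (penalty μ₀ p k) w ≤ b * (1 + ‖w‖ ^ 2) :=
  SunDSBO.residual_growth h.F_smooth h.G_smooth h.L₂_pos.le h.γ_pos h.gap_pos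
    h.isMinOn_thetaStar (penalty_pos h.μ₀_pos k).le

theorem ascentConst_pos (h : Regular P Flow L₁ L₂ γ μ₀ p c) : 0 < ascentConst L₂ γ c := by
  have := h.gap_pos
  exact lt_min h.c_pos (by positivity)

theorem gradConst_pos : 0 < gradConst L₂ γ c := by unfold gradConst; positivity

theorem smoothConst_nonneg (h : Regular P Flow L₁ L₂ γ μ₀ p c) :
    0 ≤ smoothConst L₁ L₂ γ μ₀ := by
  have h1 := h.gap_pos
  have h2 := h.L₁_nonneg
  have h3 := h.L₂_pos
  have h4 := h.γ_pos
  have h5 := h.μ₀_pos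
  unfold smoothConst
  positivity

theorem biasConst_nonneg (h : Regular P Flow L₁ L₂ γ μ₀ p c) : 0 ≤ biasConst L₁ L₂ γ μ₀ c := by
  have h1 := h.ascentConst_pos
  have h2 := h.smoothConst_nonneg
  have h3 := gradConst_pos (L₂ := L₂) (γ := γ) (c := c)
  unfold biasConst
  positivity

/-- The nonnegative parts of the initial error. -/
theorem initialError_parts (h : Regular P Flow L₁ L₂ γ μ₀ p c) (v : Vars n dx dy) :
    potential P.F P.G γ Flow μ₀ (mean v.toState)
        ≤ (1 + (L₂ + 1 / γ)) * initialError P γ μ₀ Flow v ∧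
      dev v.toState ≤ initialError P γ μ₀ Flow v ∧
      ‖(mean v.toState).fst.snd - (mean v.toState).snd‖ ^ 2
        ≤ (2 / (1 / (2 * γ) - L₂) + 2) * initialError P γ μ₀ Flow v := by
  have hγ := h.γ_pos
  have hL := h.L₂_pos
  have hm := h.half_gap_pos
  have h1 := mul_nonneg h.μ₀_pos.le (sub_nonneg.mpr (h.lower v.mean))
  have h2 := moreauEnv_gap_lower h.G_smooth hL.le hγ h.isMinOn_thetaStar v.mean
  have h3 := moreauEnv_gap_upper h.G_smooth hL.le hγ h.isMinOn_thetaStar v.mean (avg v.θ)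
  have h4 : 0 ≤ (1 / (2 * γ) - L₂) * ‖v.mean.snd - P.thetaStar γ v.mean‖ ^ 2 := by positivity
  have h5 : 0 ≤ dev v.toState := dev_nonneg _
  have h6 : initialError P γ μ₀ Flow v = μ₀ * (P.F v.mean - Flow)
      + (P.G v.mean - moreauEnv P.G γ v.mean)
      + ‖avg v.θ - P.thetaStar γ v.mean‖ ^ 2 + dev v.toState := by
    rw [dev_toState]
    have : moreauEnv P.G γ v.mean = P.V γ v.mean := rfl
    rw [this, initialError]
    ring
  have h7 : 0 ≤ ‖avg v.θ - P.thetaStar γ v.mean‖ ^ 2 := by positivity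
  have hI : 0 ≤ initialError P γ μ₀ Flow v := by rw [h6]; linarith
  refine ⟨?_, by rw [h6]; linarith, ?_⟩
  · rw [mean_toState]
    unfold potential
    simp only [fst_st, snd_st]
    have h8 : ‖avg v.θ - P.thetaStar γ v.mean‖ ^ 2 ≤ initialError P γ μ₀ Flow v := by
      rw [h6]; linarith
    have h9 := mul_le_mul_of_nonneg_left h8 (show 0 ≤ L₂ + 1 / γ by positivity)
    linarith
  · rw [mean_toState]
    simp only [fst_st, snd_st]
    -- The distance from ȳ to θ* is paid for by G - V_γ in the initial error, through quadratic
    -- growth.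
    have h8 : ‖v.mean.snd - P.thetaStar γ v.mean‖ ^ 2
        ≤ 1 / (1 / (2 * γ) - L₂) * initialError P γ μ₀ Flow v := by
      rw [one_div_mul_eq_div, le_div_iff₀ hm, h6]
      linarith
    have h9 : ‖v.mean.snd - avg v.θ‖ ^ 2 ≤ 2 * ‖v.mean.snd - P.thetaStar γ v.mean‖ ^ 2
        + 2 * ‖P.thetaStar γ v.mean - avg v.θ‖ ^ 2 := by
      rw [← sub_add_sub_cancel v.mean.snd (P.thetaStar γ v.mean) (avg v.θ)]
      exact Landscape.norm_add_sq_le_two _ _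
    rw [norm_sub_rev (P.thetaStar γ v.mean)] at h9
    have h10 : 2 / (1 / (2 * γ) - L₂) = 2 * (1 / (1 / (2 * γ) - L₂)) := by ring
    rw [h10]
    linarith

/-- Center at the field built from ∇F and ∇G: the proximal part is common to all agents and cancels.
The lower-level dissimilarity counts twice, at (x, y) and at (x, θ). -/
theorem dev_field_le (h : Regular P Flow L₁ L₂ γ μ₀ p c) {σf σg : ℝ}
    (hσ : Dissimilarity P σf σg) (k : ℕ) (w : State dx dy) :
    dev (fun i => penalty μ₀ p k • upperField P.f c i w + lowerField P.g c γ i w)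
      ≤ noiseConst μ₀ c * (σf ^ 2 + σg ^ 2) := by
  refine (dev_le_msq_sub h.n_pos _ (penalty μ₀ p k • liftPair c (gradient P.F w.fst)
    + (liftPair c (gradient P.G w.fst) + crossPair c (gradient P.G (lowerPoint w))
      + proximal c γ w))).trans ?_
  have h1 : ∀ i, ‖penalty μ₀ p k • upperField P.f c i w + lowerField P.g c γ i w
      - (penalty μ₀ p k • liftPair c (gradient P.F w.fst) + (liftPair c (gradient P.G w.fst)
        + crossPair c (gradient P.G (lowerPoint w)) + proximal c γ w))‖ ^ 2
      ≤ 3 * (1 + c) ^ 2 * (μ₀ ^ 2 * ‖gradient (P.f i) w.fst - gradient P.F w.fst‖ ^ 2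
        + ‖gradient (P.g i) w.fst - gradient P.G w.fst‖ ^ 2
        + ‖gradient (P.g i) (lowerPoint w) - gradient P.G (lowerPoint w)‖ ^ 2) := fun i => by
    have e : penalty μ₀ p k • upperField P.f c i w + lowerField P.g c γ i w
        - (penalty μ₀ p k • liftPair c (gradient P.F w.fst) + (liftPair c (gradient P.G w.fst)
          + crossPair c (gradient P.G (lowerPoint w)) + proximal c γ w))
        = penalty μ₀ p k • liftPair c (gradient (P.f i) w.fst - gradient P.F w.fst)
          + liftPair c (gradient (P.g i) w.fst - gradient P.G w.fst)
          + crossPair c (gradient (P.g i) (lowerPoint w) - gradient P.G (lowerPoint w)) := by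
      unfold upperField lowerField
      rw [map_sub, map_sub, map_sub]
      module
    rw [e]
    exact norm_smul_lift_add_sq_le h.c_pos.le (penalty_pos h.μ₀_pos k).le
      (penalty_le h.μ₀_pos h.p_nonneg k) _ _ _
  have h2 := hσ.upper w.fst
  have h3 := hσ.lower w.fst
  have h4 := hσ.lower (lowerPoint w)
  calc _ ≤ (1 / (n : ℝ)) * ∑ i, 3 * (1 + c) ^ 2
          * (μ₀ ^ 2 * ‖gradient (P.f i) w.fst - gradient P.F w.fst‖ ^ 2
            + ‖gradient (P.g i) w.fst - gradient P.G w.fst‖ ^ 2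
            + ‖gradient (P.g i) (lowerPoint w) - gradient P.G (lowerPoint w)‖ ^ 2) :=
        mul_le_mul_of_nonneg_left (Finset.sum_le_sum fun i _ => h1 i) (by positivity)
    _ = 3 * (1 + c) ^ 2
          * (μ₀ ^ 2 * ((1 / (n : ℝ)) * ∑ i, ‖gradient (P.f i) w.fst - gradient P.F w.fst‖ ^ 2)
            + (1 / (n : ℝ)) * ∑ i, ‖gradient (P.g i) w.fst - gradient P.G w.fst‖ ^ 2
            + (1 / (n : ℝ)) * ∑ i,
              ‖gradient (P.g i) (lowerPoint w) - gradient P.G (lowerPoint w)‖ ^ 2) := by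
        rw [← Finset.mul_sum, Finset.sum_add_distrib, Finset.sum_add_distrib, ← Finset.mul_sum]
        ring
    _ ≤ 3 * (1 + c) ^ 2 * (μ₀ ^ 2 * σf ^ 2 + σg ^ 2 + σg ^ 2) := by gcongr
    _ ≤ noiseConst μ₀ c * (σf ^ 2 + σg ^ 2) := by
        unfold noiseConst
        rw [mul_assoc (3 * (1 + c) ^ 2)]
        refine mul_le_mul_of_nonneg_left ?_ (by positivity)
        nlinarith [sq_nonneg σf, sq_nonneg σg, mul_nonneg (sq_nonneg μ₀) (sq_nonneg σg)]

theorem isNoise (h : Regular P Flow L₁ L₂ γ μ₀ p c) {Ω : Type*} [MeasurableSpace Ω]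
    {Pr : Measure Ω} [IsProbabilityMeasure Pr] {ξf : Fin n → ℕ → Ω → Sf} {ξg : Fin n → ℕ → Ω → Sg}
    {δf δg : ℝ} (hf : IsOracle P.Df P.lossF δf) (hg : IsOracle P.Dg P.lossG δg)
    (hs : IsSampling P Pr ξf ξg) :
    IsNoise Pr (fun (q : Fin n × ℕ) ω => (ξf q.1 q.2 ω, ξg q.1 q.2 ω))
      (fun k i w s => stochNoise P c (penalty μ₀ p k) i w s)
      (noiseConst μ₀ c * (δf ^ 2 + δg ^ 2)) :=
  isNoise_stochNoise h.smooth hf hg hs h.c_pos.le (fun k => (penalty_pos h.μ₀_pos k).le)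
    (penalty_le h.μ₀_pos h.p_nonneg)

end Regular

end Standing

/-! ### Convergence of the algorithms -/

section Convergence

theorem Adapted.map {Ω S : Type*} [MeasurableSpace Ω] {Pr : Measure Ω} [IsProbabilityMeasure Pr]
    {n k : ℕ} [MeasurableSpace S] {ξ : Fin n × ℕ → Ω → S} {H H' : Type*} [NormedAddCommGroup H]
    [InnerProductSpace ℝ H] [FiniteDimensional ℝ H] [MeasurableSpace H] [BorelSpace H]
    [NormedAddCommGroup H'] [InnerProductSpace ℝ H'] [MeasurableSpace H'] [BorelSpace H']
    {X : Fin n → Ω → H} (hX : Adapted Pr ξ k X) (T : H →ₗ[ℝ] H') :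
    Adapted Pr ξ k fun i ω => T (X i ω) := fun i =>
  ⟨T.continuous_of_finiteDimensional.measurable.comp (hX i).1,
    (LinearMap.toContinuousLinearMap T).comp_memLp' (hX i).2⟩

variable {n dx dy : ℕ} {Sf Sg Ω : Type*} [MeasurableSpace Sf] [MeasurableSpace Sg]
  [MeasurableSpace Ω] {Pr : Measure Ω} [IsProbabilityMeasure Pr] {P : Problem n dx dy Sf Sg}
  {Flow L₁ L₂ γ μ₀ p c δf δg cθ : ℝ} {ξf : Fin n → ℕ → Ω → Sf} {ξg : Fin n → ℕ → Ω → Sg}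
  {W : Matrix (Fin n) (Fin n) ℝ} {init : Vars n dx dy}

theorem scaleState_inv (hc : 0 < c) (w : State dx dy) :
    scaleState (1 / c) (scaleState c w) = w := by
  rw [State.ext_iff']
  simp [scaleState, smul_smul, hc.ne']

theorem initialTracker_scaled (P : Problem n dx dy Sf Sg) (c γ m : ℝ)
    (W : Matrix (Fin n) (Fin n) ℝ) (v : Vars n dx dy) (sf : Fin n → Sf) (sg : Fin n → Sg) :
    (initialTracker P γ m W v sf sg).scaled c = mixing W fun i =>
      (m • upperField P.f c i (v.toState i) + lowerField P.g c γ i (v.toState i))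
        + stochNoise P c m i (v.toState i) (sf i, sg i) := by
  rw [initialTracker, scaled_mix, scaled_direction]

theorem seIter_toState (P : Problem n dx dy Sf Sg) (γ c r : ℝ) (μ : ℕ → ℝ)
    (W : Matrix (Fin n) (Fin n) ℝ) (init : Vars n dx dy) (sf : Fin n → ℕ → Sf)
    (sg : Fin n → ℕ → Sg) (k : ℕ) :
    (seIter P γ μ (fun _ => c * r) (fun _ => r) W init sf sg (k + 1)).toState
      = mixing W fun i =>
        (seIter P γ μ (fun _ => c * r) (fun _ => r) W init sf sg k).toState i
        - r • (μ k • upperField P.f c i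
              ((seIter P γ μ (fun _ => c * r) (fun _ => r) W init sf sg k).toState i)
            + lowerField P.g c γ i
              ((seIter P γ μ (fun _ => c * r) (fun _ => r) W init sf sg k).toState i)
          + stochNoise P c (μ k) i
              ((seIter P γ μ (fun _ => c * r) (fun _ => r) W init sf sg k).toState i)
              (sf i k, sg i k)) := by
  rw [seIter, toState_mix, toState_descend, scaled_direction]

theorem gtState_toState (P : Problem n dx dy Sf Sg) (γ c r : ℝ) (μ : ℕ → ℝ)
    (W : Matrix (Fin n) (Fin n) ℝ) (init : Vars n dx dy) (sf : Fin n → ℕ → Sf)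
    (sg : Fin n → ℕ → Sg) (k : ℕ) :
    (gtState P γ μ (fun _ => c * r) (fun _ => r) W init sf sg (k + 1)).vars.toState
      = mixing W fun i =>
        (gtState P γ μ (fun _ => c * r) (fun _ => r) W init sf sg k).vars.toState i
        - r • (gtState P γ μ (fun _ => c * r) (fun _ => r) W init sf sg (k + 1)).D.scaled c i := by
  rw [gtState, toState_mix, toState_descend]

theorem gtState_Dhat (P : Problem n dx dy Sf Sg) (γ c : ℝ) (μ lx lθ : ℕ → ℝ)
    (W : Matrix (Fin n) (Fin n) ℝ) (init : Vars n dx dy) (sf : Fin n → ℕ → Sf)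
    (sg : Fin n → ℕ → Sg) (k : ℕ) :
    (gtState P γ μ lx lθ W init sf sg (k + 1)).Dhat.scaled c = fun i =>
      (μ k • upperField P.f c i ((gtState P γ μ lx lθ W init sf sg k).vars.toState i)
          + lowerField P.g c γ i ((gtState P γ μ lx lθ W init sf sg k).vars.toState i))
        + stochNoise P c (μ k) i ((gtState P γ μ lx lθ W init sf sg k).vars.toState i)
            (sf i k, sg i k) := by
  rw [gtState, scaled_direction]

theorem gtState_D (P : Problem n dx dy Sf Sg) (γ c : ℝ) (μ lx lθ : ℕ → ℝ)
    (W : Matrix (Fin n) (Fin n) ℝ) (init : Vars n dx dy) (sf : Fin n → ℕ → Sf)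
    (sg : Fin n → ℕ → Sg) (k : ℕ) :
    (gtState P γ μ lx lθ W init sf sg (k + 1)).D.scaled c = mixing W fun i =>
      (gtState P γ μ lx lθ W init sf sg k).D.scaled c i
        + (gtState P γ μ lx lθ W init sf sg (k + 1)).Dhat.scaled c i
        - (gtState P γ μ lx lθ W init sf sg k).Dhat.scaled c i := by
  rw [gtState, scaled_mix, scaled_addSub]

/-- The residual dominates ‖∇Ψ‖² pointwise; the distance from θ to θ* is simply discarded. -/
theorem Regular.lateStationary (h : Regular P Flow L₁ L₂ γ μ₀ p c) {K : ℕ} (hK : 0 < K)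
    {v : ℕ → Ω → Vars n dx dy} {B : ℝ}
    (hint : ∀ k, Integrable (fun ω => residual P.F P.G γ (P.thetaStar γ) (penalty μ₀ p k)
      (mean (v k ω).toState)) Pr)
    (hmeas : ∀ k, Measurable fun ω => mean (v k ω).toState)
    (hB : ∃ k ∈ lateIters K, ∫ ω, residual P.F P.G γ (P.thetaStar γ) (penalty μ₀ p k)
      (mean (v k ω).toState) ∂Pr ≤ B) :
    LateStationary Pr P γ μ₀ p K (fun k ω => (v k ω).mean) B := by
  have hle : ∀ k ω, statSq P γ (penalty μ₀ p k) (v k ω).mean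
      ≤ residual P.F P.G γ (P.thetaStar γ) (penalty μ₀ p k) (mean (v k ω).toState) := by
    intro k ω
    rw [h.statSq_eq, mean_toState, residual, fst_st]
    linarith [sq_nonneg ‖(st (v k ω).mean (avg (v k ω).θ)).snd - P.thetaStar γ (v k ω).mean‖]
  have hi : ∀ k, Integrable (fun ω => statSq P γ (penalty μ₀ p k) (v k ω).mean) Pr := by
    intro k
    refine (hint k).mono' ?_ (ae_of_all _ fun ω => ?_)
    · have h1 := (continuous_of_lip (psiGrad_lipschitz h.F_smooth h.G_smooth h.L₂_pos.le h.γ_pos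
        h.gap_pos h.isMinOn_thetaStar (penalty_pos (p := p) h.μ₀_pos k).le)).comp
        (State.continuous_fst (dx := dx) (dy := dy))
      have h2 := ((h1.norm.pow 2).measurable.comp (hmeas k)).aestronglyMeasurable (μ := Pr)
      refine h2.congr (ae_of_all _ fun ω => ?_)
      simp [h.statSq_eq, mean_toState]
    · rw [Real.norm_of_nonneg (by unfold statSq; positivity)]
      exact hle k ω
  obtain ⟨k, hk, hkB⟩ := hB
  have hkB' := (integral_mono (hi k) (hint k) (hle k)).trans hkB
  exact ⟨fun k _ => hi k, (Finset.inf'_le _ hk).trans hkB', k, hk, hkB',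
    penalty_late h.μ₀_pos h.p_nonneg hK hk⟩

/-- The three contributions are each dominated by a multiple of the same right-hand side, so their
coefficients add up to one constant. -/
theorem combine_le {a b d I δ σ x y : ℝ} (ha : 0 ≤ a) (hb : 0 ≤ b) (hd : 0 ≤ d) (hI : 0 ≤ I)
    (hδ : 0 ≤ δ) (hσ : 0 ≤ σ) (hx : 0 ≤ x) (hy : 0 ≤ y) :
    a * ((I + δ) * x) + b * ((σ + δ) * y) + d * (δ * x)
      ≤ (a + b + d) * ((I + δ) * x + (δ + σ) * y) := by
  have h1 : 0 ≤ a * ((δ + σ) * y) := by positivity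
  have h2 : 0 ≤ b * ((I + δ) * x) := by positivity
  have h3 : 0 ≤ d * (I * x + (δ + σ) * y) := by positivity
  linarith

/-- Factor of the initial error in the bound for SUN-DSBO-SE. -/
def seInitConst (L₁ L₂ γ μ₀ c : ℝ) : ℝ := 1 + (L₂ + 1 / γ) + 2 * biasConst L₁ L₂ γ μ₀ c

/-- The constant in the bound for SUN-DSBO-SE. -/
def seConst (L₁ L₂ γ μ₀ c cθ : ℝ) : ℝ :=
  2 / (ascentConst L₂ γ c / 2) * (seInitConst L₁ L₂ γ μ₀ c / cθ
    + 16 * biasConst L₁ L₂ γ μ₀ c * cθ ^ 2 * noiseConst μ₀ c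
    + 2 * smoothConst L₁ L₂ γ μ₀ * cθ * noiseConst μ₀ c)

theorem Regular.initialError_nonneg (h : Regular P Flow L₁ L₂ γ μ₀ p c) (v : Vars n dx dy) :
    0 ≤ initialError P γ μ₀ Flow v := (dev_nonneg _).trans (h.initialError_parts v).2.1

theorem noiseConst_nonneg : 0 ≤ noiseConst μ₀ c := by unfold noiseConst; positivity

theorem Regular.se_lateStationary (h : Regular P Flow L₁ L₂ γ μ₀ p c)
    (hf : IsOracle P.Df P.lossF δf) (hg : IsOracle P.Dg P.lossG δg) (hs : IsSampling P Pr ξf ξg)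
    (hW : W.IsHermitian) (hds : W ∈ doublyStochastic ℝ (Fin n)) (hρ : connectivity hW < 1)
    {σf σg : ℝ} (hσ : Dissimilarity P σf σg) {K : ℕ} (hK : 0 < K) (hcθ : 0 < cθ) {lb : ℝ}
    (hlb1 : lb ≤ 1)
    (hlbC : 16 * smoothConst L₁ L₂ γ μ₀ * gradConst L₂ γ c * lb ≤ ascentConst L₂ γ c)
    (hlbℓ : 16 * lipConst L₁ L₂ γ μ₀ c ^ 2 * lb ≤ 1)
    (hrate : rate cθ n K ≤ lb * (1 - connectivity hW)) {A : ℝ}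
    (hA : seConst L₁ L₂ γ μ₀ c cθ ≤ A) :
    LateStationary Pr P γ μ₀ p K
      (fun k ω => (seIter P γ (penalty μ₀ p) (fun _ => c * rate cθ n K)
        (fun _ => rate cθ n K) W init (fun i k => ξf i k ω) (fun i k => ξg i k ω) k).mean)
      (A * seBound n K (connectivity hW) (initialError P γ μ₀ Flow init + δf ^ 2 + δg ^ 2)
        δf δg σf σg) := by
  have hn := h.n_pos
  have hn' : (0 : ℝ) < n := by exact_mod_cast hn
  have hK' : (0 : ℝ) < K := by exact_mod_cast hK
  have hr : 0 < rate cθ n K := by unfold rate; positivity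
  have hgos : IsGossip (State dx dy) W (connectivity hW) := isGossip_of_doublyStochastic hW hds hρ
  have hN := h.isNoise hf hg hs
  have hland := h.landscape
  let v : ℕ → Ω → Vars n dx dy := fun k ω => seIter P γ (penalty μ₀ p) (fun _ => c * rate cθ n K)
    (fun _ => rate cθ n K) W init (fun i k => ξf i k ω) (fun i k => ξg i k ω) k
  have hw0 : ∀ ω, (v 0 ω).toState = init.toState := fun ω => rfl
  have hw := fun k ω => seIter_toState P γ c (rate cθ n K) (penalty μ₀ p) W init
    (fun i k => ξf i k ω) (fun i k => ξg i k ω) k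
  have hX := adapted_se (w := fun k ω => (v k ω).toState) hN hland.lip hw0 hw
  have hint := fun k => integrable_R hland hN.meas_sample h.measurable_residual h.residual_growth
    (hX k) k
  have hbound := expected_bound_se hland hN hn h.measurable_potentialGrad h.measurable_residual
    h.residual_growth hgos h.ascentConst_pos gradConst_pos h.smoothConst_nonneg
    (h.dev_field_le hσ) hr hrate hlb1 hlbC hlbℓ rfl (w := fun k ω => (v k ω).toState) hw0 hw K
  rw [← biasConst, penalty_zero] at hbound
  have hM := h.biasConst_nonneg
  have hL := h.smoothConst_nonneg
  have hκ := h.ascentConst_pos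
  have hNC := noiseConst_nonneg (μ₀ := μ₀) (c := c)
  have hI := h.initialError_nonneg init
  obtain ⟨p1, p2, -⟩ := h.initialError_parts init
  have hinit : potential P.F P.G γ Flow μ₀ (mean init.toState)
      + 2 * biasConst L₁ L₂ γ μ₀ c * dev init.toState
      ≤ seInitConst L₁ L₂ γ μ₀ c
        * (initialError P γ μ₀ Flow init + (δf ^ 2 + δg ^ 2)) := by
    have q1 := mul_le_mul_of_nonneg_left p2 hM
    have q2 : 0 ≤ seInitConst L₁ L₂ γ μ₀ c * (δf ^ 2 + δg ^ 2) := by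
      have := h.L₂_pos
      have := h.γ_pos
      unfold seInitConst
      positivity
    unfold seInitConst at q2 ⊢
    linarith
  have hd : 0 < 1 - connectivity hW := by linarith
  obtain ⟨k, hk, hkle⟩ := exists_late_bound
    (fun k => integral_nonneg fun ω => hland.R_nonneg k (mean (v k ω).toState))
    hn hK hcθ (half_pos hκ) (sq_pos_of_pos hd)
    (hbound.trans (add_le_add_left (add_le_add_left hinit _) _))
  refine h.lateStationary hK hint
    (fun k => (hX k).measurable_mean.mono (past_le hN.meas_sample k) le_rfl) ⟨k, hk, hkle.trans ?_⟩
  have hS : 0 ≤ seInitConst L₁ L₂ γ μ₀ c / cθ := by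
    have := h.L₂_pos
    have := h.γ_pos
    unfold seInitConst
    positivity
  have hcomb := combine_le (a := seInitConst L₁ L₂ γ μ₀ c / cθ)
    (b := 16 * biasConst L₁ L₂ γ μ₀ c * cθ ^ 2 * noiseConst μ₀ c)
    (d := 2 * smoothConst L₁ L₂ γ μ₀ * cθ * noiseConst μ₀ c) (δ := δf ^ 2 + δg ^ 2)
    (σ := σf ^ 2 + σg ^ 2) (x := 1 / (Real.sqrt n * Real.sqrt K))
    (y := n / ((1 - connectivity hW) ^ 2 * K)) hS (by positivity) (by positivity) hI (by positivity)
    (by positivity) (by positivity) (by positivity)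
  have hB : seBound n K (connectivity hW) (initialError P γ μ₀ Flow init + δf ^ 2 + δg ^ 2)
        δf δg σf σg = (initialError P γ μ₀ Flow init + (δf ^ 2 + δg ^ 2))
          * (1 / (Real.sqrt n * Real.sqrt K)) + (δf ^ 2 + δg ^ 2 + (σf ^ 2 + σg ^ 2))
          * (n / ((1 - connectivity hW) ^ 2 * K)) := by
    unfold seBound; ring
  rw [hB]
  refine le_trans ?_ (mul_le_mul_of_nonneg_right hA (by positivity))
  unfold seConst
  rw [mul_assoc (2 / (ascentConst L₂ γ c / 2))]
  refine mul_le_mul_of_nonneg_left (le_trans (le_of_eq ?_) hcomb) (by positivity)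
  ring

/-- Factor of the initial error in the bound for SUN-DSBO-GT. -/
def gtInitConst (L₁ L₂ γ μ₀ c : ℝ) : ℝ :=
  1 + (L₂ + 1 / γ) + 2 * biasConst L₁ L₂ γ μ₀ c + 4 * biasConst L₁ L₂ γ μ₀ c * ((1 + c) ^ 2
    + 16 * ((1 + c) ^ 2 * (4 * (1 + c) ^ 2 + 8 * lipConst L₁ L₂ γ μ₀ c ^ 2 + 8 * noiseConst μ₀ c
      + 2 * L₂ ^ 2 * (2 / (1 / (2 * γ) - L₂) + 2))))

/-- The constant in the bound for SUN-DSBO-GT. -/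
def gtConst (L₁ L₂ γ μ₀ c cθ : ℝ) : ℝ :=
  2 / (ascentConst L₂ γ c / 4) * (gtInitConst L₁ L₂ γ μ₀ c / cθ
    + 4 * biasConst L₁ L₂ γ μ₀ c * (32 + 2 * trackConst L₁ L₂ γ μ₀ c) * cθ ^ 2 * noiseConst μ₀ c
    + 2 * smoothConst L₁ L₂ γ μ₀ * cθ * noiseConst μ₀ c)

theorem Regular.gtInitConst_nonneg (h : Regular P Flow L₁ L₂ γ μ₀ p c) :
    0 ≤ gtInitConst L₁ L₂ γ μ₀ c := by
  have := h.L₂_pos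
  have := h.γ_pos
  have := h.half_gap_pos
  have := h.biasConst_nonneg
  have := noiseConst_nonneg (μ₀ := μ₀) (c := c)
  unfold gtInitConst
  positivity

/-- Everything the tracking bound needs at time 0 is absorbed by the initial error, the expected
disagreement of the initial trackers and the variances. The variances enter because the trackers see
the heterogeneity only through noisy gradients. -/
theorem Regular.gt_initial_le (h : Regular P Flow L₁ L₂ γ μ₀ p c)
    (hf : IsOracle P.Df P.lossF δf) (hg : IsOracle P.Dg P.lossG δg) (hs : IsSampling P Pr ξf ξg)
    (hW : W.IsHermitian) (hds : W ∈ doublyStochastic ℝ (Fin n)) (hρ : connectivity hW < 1) :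
    0 ≤ ∫ ω, (initialTracker P γ μ₀ W init (fun i => ξf i 0 ω) (fun i => ξg i 0 ω)).disagreement ∂Pr
    ∧ (potential P.F P.G γ Flow μ₀ (mean init.toState)
        + 2 * biasConst L₁ L₂ γ μ₀ c * dev init.toState
        + 4 * biasConst L₁ L₂ γ μ₀ c * (∫ ω, dev ((initialTracker P γ μ₀ W init
            (fun i => ξf i 0 ω) (fun i => ξg i 0 ω)).scaled c) ∂Pr
          + 16 * μ₀ ^ 2 * dev (mixing W fun i => upperField P.f c i (mean init.toState))))
      ≤ gtInitConst L₁ L₂ γ μ₀ c * (initialError P γ μ₀ Flow init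
        + ∫ ω, (initialTracker P γ μ₀ W init (fun i => ξf i 0 ω)
            (fun i => ξg i 0 ω)).disagreement ∂Pr + (δf ^ 2 + δg ^ 2)) := by
  have hN := h.isNoise hf hg hs
  have hland := h.landscape
  have hM := h.biasConst_nonneg
  have hNC := noiseConst_nonneg (μ₀ := μ₀) (c := c)
  have hgos : IsGossip (State dx dy) W (connectivity hW) := isGossip_of_doublyStochastic hW hds hρ
  set T : Ω → Vars n dx dy := fun ω =>
    initialTracker P γ μ₀ W init (fun i => ξf i 0 ω) (fun i => ξg i 0 ω) with hT
  set ξ : Fin n × ℕ → Ω → Sf × Sg := fun q ω => (ξf q.1 q.2 ω, ξg q.1 q.2 ω) with hξ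
  have hTs : ∀ ω, (T ω).scaled c = mixing W fun i =>
      (μ₀ • upperField P.f c i (init.toState i) + lowerField P.g c γ i (init.toState i))
        + stochNoise P c μ₀ i (init.toState i) (ξf i 0 ω, ξg i 0 ω) := fun ω =>
    initialTracker_scaled P c γ μ₀ W init _ _
  have hconst : Adapted Pr ξ 0 fun i (_ : Ω) => init.toState i := Adapted.const _
  have hA : Adapted Pr ξ 1 fun i ω => (T ω).scaled c i := by
    have := (hconst.direction hN hland.lip).mixing W
    simp_rw [hTs]
    simpa only [penalty_zero] using this
  -- Undoing the scaling by c gives integrability of the unscaled disagreement, which is the one in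
  -- the statement.
  have hA' : Adapted Pr ξ 1 fun i ω => (T ω).toState i := by
    have := hA.map (scaleState (1 / c))
    simpa only [Vars.scaled, scaleState_inv h.c_pos] using this
  have i1 : Integrable (fun ω => dev ((T ω).scaled c)) Pr := hA.integrable_dev
  have i2 : Integrable (fun ω => (T ω).disagreement) Pr := by
    have := hA'.integrable_dev
    simpa only [dev_toState] using this
  obtain ⟨i3, n3⟩ := hN.msq_noise h.n_pos (k := 0) fun i => (hconst i).1
  have e1 : ∫ ω, dev ((T ω).scaled c) ∂Pr ≤ (1 + c) ^ 2 * ∫ ω, (T ω).disagreement ∂Pr := by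
    rw [← integral_const_mul]
    refine integral_mono i1 (i2.const_mul _) fun ω => ?_
    simp only [← dev_toState]
    exact dev_map_le (scaleState c) (norm_scaleState_le h.c_pos.le) _
  have e2 : 0 ≤ ∫ ω, (T ω).disagreement ∂Pr := integral_nonneg fun ω => by
    simp only [← dev_toState]
    exact dev_nonneg _
  have hlip : ∀ i w w', ‖(μ₀ • upperField P.f c i w + lowerField P.g c γ i w)
      - (μ₀ • upperField P.f c i w' + lowerField P.g c γ i w')‖
      ≤ lipConst L₁ L₂ γ μ₀ c * ‖w - w'‖ := by
    simpa only [penalty_zero] using hland.lip 0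
  have e3 : μ₀ ^ 2 * dev (mixing W fun i => upperField P.f c i (mean init.toState))
      ≤ (1 + c) ^ 2 * (4 * ∫ ω, dev ((T ω).scaled c) ∂Pr
        + 8 * lipConst L₁ L₂ γ μ₀ c ^ 2 * dev init.toState
        + 8 * (noiseConst μ₀ c * (δf ^ 2 + δg ^ 2))
        + 2 * L₂ ^ 2 * ‖(mean init.toState).fst.snd - (mean init.toState).snd‖ ^ 2) := by
    -- The left side is deterministic, so integrating the pathwise inequality bounds it by
    -- expectations.
    have hi : ∀ ω, μ₀ ^ 2 * dev (mixing W fun i => upperField P.f c i (mean init.toState))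
        ≤ (1 + c) ^ 2 * (8 * lipConst L₁ L₂ γ μ₀ c ^ 2 * dev init.toState
            + 2 * L₂ ^ 2 * ‖(mean init.toState).fst.snd - (mean init.toState).snd‖ ^ 2)
          + ((1 + c) ^ 2 * 4 * dev ((T ω).scaled c) + (1 + c) ^ 2 * 8 * msq fun i =>
            stochNoise P c (penalty μ₀ p 0) i (init.toState i) (ξ (i, 0) ω)) := fun ω => by
      have := initial_heterogeneity_le hgos h.n_pos h.smooth.g_smooth h.L₂_pos.le h.c_pos.le hlip
        init.toState (fun i => stochNoise P c μ₀ i (init.toState i) (ξf i 0 ω, ξg i 0 ω))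
      rw [← hTs] at this
      rw [penalty_zero]
      linarith
    have j1 := i1.const_mul ((1 + c) ^ 2 * 4)
    have j2 := i3.const_mul ((1 + c) ^ 2 * 8)
    have := integral_mono (integrable_const _) ((integrable_const _).add (j1.add j2)) hi
    have t1 := integral_add (integrable_const (μ := Pr) ((1 + c) ^ 2
      * (8 * lipConst L₁ L₂ γ μ₀ c ^ 2 * dev init.toState
            + 2 * L₂ ^ 2 * ‖(mean init.toState).fst.snd - (mean init.toState).snd‖ ^ 2)))
      (j1.add j2)
    have t2 := integral_add j1 j2
    simp only [Pi.add_apply, integral_const, probReal_univ, smul_eq_mul,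
      integral_const_mul] at this t1 t2
    rw [t1, t2] at this
    have n4 := mul_le_mul_of_nonneg_left n3 (show 0 ≤ (1 + c) ^ 2 * 8 by positivity)
    linarith
  refine ⟨e2, ?_⟩
  obtain ⟨p1, p2, p3⟩ := h.initialError_parts init
  have hI := h.initialError_nonneg init
  have hq : 0 ≤ 2 / (1 / (2 * γ) - L₂) + 2 := by
    have := h.half_gap_pos
    positivity
  set I := initialError P γ μ₀ Flow init
  set τ := ∫ ω, (T ω).disagreement ∂Pr
  set δ := δf ^ 2 + δg ^ 2 with hδ
  have hδ0 : 0 ≤ δ := by positivity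
  set Q := 2 / (1 / (2 * γ) - L₂) + 2 with hQ
  set M := biasConst L₁ L₂ γ μ₀ c
  set N := noiseConst μ₀ c
  set ℓ := lipConst L₁ L₂ γ μ₀ c
  set D0 := ∫ ω, dev ((T ω).scaled c) ∂Pr
  set C := I + τ + δ with hC
  have c1 : I ≤ C := by linarith
  have c2 : τ ≤ C := by linarith
  have c3 : δ ≤ C := by linarith
  have d1 : D0 ≤ (1 + c) ^ 2 * C := e1.trans (by gcongr)
  have d2 : dev init.toState ≤ C := p2.trans c1
  have d3 : ‖(mean init.toState).fst.snd - (mean init.toState).snd‖ ^ 2 ≤ Q * C :=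
    p3.trans (by gcongr)
  have d4 : μ₀ ^ 2 * dev (mixing W fun i => upperField P.f c i (mean init.toState))
      ≤ (1 + c) ^ 2 * (4 * ((1 + c) ^ 2 * C) + 8 * ℓ ^ 2 * C + 8 * (N * C)
        + 2 * L₂ ^ 2 * (Q * C)) := e3.trans (by gcongr)
  have d5 : potential P.F P.G γ Flow μ₀ (mean init.toState) ≤ (1 + (L₂ + 1 / γ)) * C := by
    have := h.L₂_pos
    have := h.γ_pos
    exact p1.trans (by gcongr)
  have d6 := mul_le_mul_of_nonneg_left d2 hM
  have d7 := mul_le_mul_of_nonneg_left (add_le_add d1 (mul_le_mul_of_nonneg_left d4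
    (show (0 : ℝ) ≤ 16 by norm_num))) hM
  have hexp : gtInitConst L₁ L₂ γ μ₀ c = 1 + (L₂ + 1 / γ) + 2 * M + 4 * M * ((1 + c) ^ 2
    + 16 * ((1 + c) ^ 2 * (4 * (1 + c) ^ 2 + 8 * ℓ ^ 2 + 8 * N + 2 * L₂ ^ 2 * Q))) := rfl
  rw [hexp]
  linarith

theorem Regular.gt_lateStationary (h : Regular P Flow L₁ L₂ γ μ₀ p c)
    (hf : IsOracle P.Df P.lossF δf) (hg : IsOracle P.Dg P.lossG δg) (hs : IsSampling P Pr ξf ξg)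
    (hW : W.IsHermitian) (hds : W ∈ doublyStochastic ℝ (Fin n)) (hρ : connectivity hW < 1)
    {K : ℕ} (hK : 0 < K) (hcθ : 0 < cθ) {lb : ℝ} (hlb1 : lb ≤ 1)
    (hlbC : 16 * smoothConst L₁ L₂ γ μ₀ * gradConst L₂ γ c * lb ≤ ascentConst L₂ γ c)
    (hlbq : 4 * (trackConst L₁ L₂ γ μ₀ c * (1 + 4 * lipConst L₁ L₂ γ μ₀ c ^ 2)) * lb ≤ 1)
    (hlbM : 64 * (biasConst L₁ L₂ γ μ₀ c * trackConst L₁ L₂ γ μ₀ c * gradConst L₂ γ c) * lb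
      ≤ ascentConst L₂ γ c)
    (hrate : rate cθ n K ≤ lb * (1 - connectivity hW) ^ 4) {A : ℝ}
    (hA : gtConst L₁ L₂ γ μ₀ c cθ ≤ A) :
    LateStationary Pr P γ μ₀ p K
      (fun k ω => (gtIter P γ (penalty μ₀ p) (fun _ => c * rate cθ n K)
        (fun _ => rate cθ n K) W init (fun i k => ξf i k ω) (fun i k => ξg i k ω) k).mean)
      (A * gtBound n K (connectivity hW) (initialError P γ μ₀ Flow init
        + ∫ ω, (initialTracker P γ μ₀ W init (fun i => ξf i 0 ω)
            (fun i => ξg i 0 ω)).disagreement ∂Pr + δf ^ 2 + δg ^ 2) δf δg) := by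
  have hn := h.n_pos
  have hn' : (0 : ℝ) < n := by exact_mod_cast hn
  have hK' : (0 : ℝ) < K := by exact_mod_cast hK
  have hr : 0 < rate cθ n K := by unfold rate; positivity
  have hgos : IsGossip (State dx dy) W (connectivity hW) := isGossip_of_doublyStochastic hW hds hρ
  have hN := h.isNoise hf hg hs
  have hland := h.landscape
  let s : ℕ → Ω → GTState n dx dy := fun k ω => gtState P γ (penalty μ₀ p)
    (fun _ => c * rate cθ n K) (fun _ => rate cθ n K) W init (fun i k => ξf i k ω)
    (fun i k => ξg i k ω) k
  have hw0 : ∀ ω, (s 0 ω).vars.toState = init.toState := fun ω => rfl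
  -- The state before iteration k + 1 stores the tracker of iteration k, so trackers are read with
  -- the index shifted by one.
  have hw : ∀ k ω, (s (k + 1) ω).vars.toState = mixing W fun i =>
      (s k ω).vars.toState i - rate cθ n K • (s (k + 1) ω).D.scaled c i := fun k ω =>
    gtState_toState P γ c (rate cθ n K) (penalty μ₀ p) W init (fun i k => ξf i k ω)
      (fun i k => ξg i k ω) k
  have hDh : ∀ k ω, (s (k + 1) ω).Dhat.scaled c = fun i =>
      (penalty μ₀ p k • upperField P.f c i ((s k ω).vars.toState i)
        + lowerField P.g c γ i ((s k ω).vars.toState i))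
      + stochNoise P c (penalty μ₀ p k) i ((s k ω).vars.toState i) (ξf i k ω, ξg i k ω) :=
    fun k ω => gtState_Dhat P γ c (penalty μ₀ p) _ _ W init _ _ k
  have hDinit : ∀ ω, (s 1 ω).D = initialTracker P γ μ₀ W init (fun i => ξf i 0 ω)
      (fun i => ξg i 0 ω) := fun ω => by
    have := gtState_one_D P γ (penalty μ₀ p) (fun _ => c * rate cθ n K) (fun _ => rate cθ n K)
      W init (fun i k => ξf i k ω) (fun i k => ξg i k ω)
    rwa [penalty_zero] at this
  have hD0 : ∀ ω, (s 1 ω).D.scaled c = mixing W fun i =>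
      (penalty μ₀ p 0 • upperField P.f c i ((s 0 ω).vars.toState i)
        + lowerField P.g c γ i ((s 0 ω).vars.toState i))
      + stochNoise P c (penalty μ₀ p 0) i ((s 0 ω).vars.toState i) (ξf i 0 ω, ξg i 0 ω) := fun ω => by
    rw [hDinit, initialTracker_scaled, penalty_zero]
    rfl
  have hD : ∀ k ω, (s (k + 1 + 1) ω).D.scaled c = mixing W fun i => (s (k + 1) ω).D.scaled c i
      + ((penalty μ₀ p (k + 1) • upperField P.f c i ((s (k + 1) ω).vars.toState i)
          + lowerField P.g c γ i ((s (k + 1) ω).vars.toState i))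
        + stochNoise P c (penalty μ₀ p (k + 1)) i ((s (k + 1) ω).vars.toState i)
            (ξf i (k + 1) ω, ξg i (k + 1) ω))
      - ((penalty μ₀ p k • upperField P.f c i ((s k ω).vars.toState i)
          + lowerField P.g c γ i ((s k ω).vars.toState i))
        + stochNoise P c (penalty μ₀ p k) i ((s k ω).vars.toState i) (ξf i k ω, ξg i k ω)) :=
    fun k ω => by
      have := gtState_D P γ c (penalty μ₀ p) (fun _ => c * rate cθ n K) (fun _ => rate cθ n K)
        W init (fun i k => ξf i k ω) (fun i k => ξg i k ω) (k + 1)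
      have e1 := hDh (k + 1) ω
      have e2 := hDh k ω
      simp only [s] at e1 e2 ⊢
      rw [this, e1, e2]
  have ha : ∀ i w w', ‖upperField P.f c i w - upperField P.f c i w'‖
      ≤ lipConst L₁ L₂ γ μ₀ c * ‖w - w'‖ := fun i w w' => by
    refine (upperField_lipschitz h.smooth.f_smooth h.L₁_nonneg h.c_pos.le i w w').trans ?_
    have h1 := h.L₁_nonneg
    have h2 := h.L₂_pos
    have h3 := h.γ_pos
    have h4 := h.μ₀_pos
    have h5 := h.c_pos
    unfold lipConst
    gcongr
    have : 0 ≤ μ₀ * L₁ + (2 * L₂ + 2 / γ) := by positivity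
    linarith
  have hX := adapted_gt (w := fun k ω => (s k ω).vars.toState)
    (D := fun k ω => (s (k + 1) ω).D.scaled c) hN hland.lip hw0 hw hD0 hD
  have hint := fun k => integrable_R hland hN.meas_sample h.measurable_residual h.residual_growth
    (hX k).1 k
  have hbound := expected_bound_gt hland hN hn h.measurable_potentialGrad h.measurable_residual
    h.residual_growth hgos h.ascentConst_pos gradConst_pos h.smoothConst_nonneg
    (a := upperField P.f c) (c := lowerField P.g c γ) (fun _ _ _ => rfl) ha
    (abs_penalty_sub_le h.μ₀_pos h.p_nonneg h.p_le_one) hr hrate hlb1 hlbC rfl rfl hlbq hlbM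
    (w := fun k ω => (s k ω).vars.toState) (D := fun k ω => (s (k + 1) ω).D.scaled c)
    hw0 hw hD0 hD hK
  rw [← biasConst, ← trackConst, penalty_zero] at hbound
  obtain ⟨hT, hinit⟩ := h.gt_initial_le (init := init) hf hg hs hW hds hρ
  simp only [zero_add, hDinit] at hbound
  have hM := h.biasConst_nonneg
  have hL := h.smoothConst_nonneg
  have hκ := h.ascentConst_pos
  have hNC := noiseConst_nonneg (μ₀ := μ₀) (c := c)
  have hI := h.initialError_nonneg init
  have hq : 0 ≤ trackConst L₁ L₂ γ μ₀ c := by unfold trackConst; positivity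
  have hd : 0 < 1 - connectivity hW := by linarith
  obtain ⟨k, hk, hkle⟩ := exists_late_bound
    (fun k => integral_nonneg fun ω => hland.R_nonneg k (mean (s k ω).vars.toState))
    hn hK hcθ (show 0 < ascentConst L₂ γ c / 4 by positivity) (pow_pos hd 4)
    (hbound.trans (add_le_add_left (add_le_add_left hinit _) _))
  refine h.lateStationary hK hint
    (fun k => (hX k).1.measurable_mean.mono (past_le hN.meas_sample k) le_rfl)
    ⟨k, hk, hkle.trans ?_⟩
  set τ := ∫ ω, (initialTracker P γ μ₀ W init (fun i => ξf i 0 ω)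
    (fun i => ξg i 0 ω)).disagreement ∂Pr
  have hG := h.gtInitConst_nonneg
  -- Tracking removes the dissimilarity, hence σ = 0; the tracker disagreement joins the initial
  -- error.
  have hcomb := combine_le (a := gtInitConst L₁ L₂ γ μ₀ c / cθ)
    (b := 4 * biasConst L₁ L₂ γ μ₀ c * (32 + 2 * trackConst L₁ L₂ γ μ₀ c) * cθ ^ 2
      * noiseConst μ₀ c)
    (d := 2 * smoothConst L₁ L₂ γ μ₀ * cθ * noiseConst μ₀ c) (δ := δf ^ 2 + δg ^ 2)
    (σ := 0) (x := 1 / (Real.sqrt n * Real.sqrt K))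
    (y := n / ((1 - connectivity hW) ^ 4 * K)) (by positivity) (by positivity) (by positivity)
    (add_nonneg hI hT) (by positivity) le_rfl (by positivity) (by positivity)
  have hB : gtBound n K (connectivity hW) (initialError P γ μ₀ Flow init + τ + δf ^ 2 + δg ^ 2)
        δf δg = (initialError P γ μ₀ Flow init + τ + (δf ^ 2 + δg ^ 2))
          * (1 / (Real.sqrt n * Real.sqrt K)) + (δf ^ 2 + δg ^ 2 + 0)
          * (n / ((1 - connectivity hW) ^ 4 * K)) := by
    unfold gtBound; ring
  rw [hB]
  refine le_trans ?_ (mul_le_mul_of_nonneg_right hA (by positivity))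
  unfold gtConst
  rw [mul_assoc (2 / (ascentConst L₂ γ c / 4))]
  refine mul_le_mul_of_nonneg_left (le_trans (le_of_eq ?_) hcomb) (by positivity)
  ring

end Convergence

end SunDSBO

end

/-! ### Choice of the constants, uniformly in the problem -/

open SunDSBO in
theorem mainTheorem7
    (L₂ γ : ℝ) (hL₂ : 0 < L₂) (hγ : 0 < γ) (hγL : γ < 1 / (2 * L₂)) :
    ∃ cbar : ℝ, 0 < cbar ∧
    ∀ (L₁ μ₀ p cl : ℝ), 0 ≤ L₁ → 0 < μ₀ → 0 ≤ p → p < 1 / 4 → 0 < cl → cl ≤ cbar →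
    ∃ lbar : ℝ, 0 < lbar ∧
    ∀ cθ : ℝ, 0 < cθ →
    ∃ A : ℝ, 0 < A ∧
    ∀ (n dx dy : ℕ), 0 < n →
    ∀ (Sf Sg Ω : Type*) [MeasurableSpace Sf] [MeasurableSpace Sg] [MeasurableSpace Ω]
      (Pr : Measure Ω) [IsProbabilityMeasure Pr]
      (P : Problem n dx dy Sf Sg) (Flow δf δg : ℝ)
      (ξf : Fin n → ℕ → Ω → Sf) (ξg : Fin n → ℕ → Ω → Sg)
      (W : Matrix (Fin n) (Fin n) ℝ) (hW : W.IsHermitian) (init : Vars n dx dy),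
      (∀ z, Flow ≤ P.F z) →
      Smoothness P L₁ L₂ →
      IsOracle P.Df P.lossF δf → IsOracle P.Dg P.lossG δg →
      IsSampling P Pr ξf ξg →
      W ∈ doublyStochastic ℝ (Fin n) → connectivity hW < 1 →
      ((∀ z, IsMinOn (P.proxObj γ z) Set.univ (P.thetaStar γ z)) ∧
        ∀ m, Differentiable ℝ (P.Psi γ m)) ∧
      (∀ σf σg : ℝ, Dissimilarity P σf σg →
        ∀ K : ℕ, 0 < K → rate cθ n K ≤ lbar * (1 - connectivity hW) →
          LateStationary Pr P γ μ₀ p K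
            (fun k ω => (seIter P γ (penalty μ₀ p) (fun _ => cl * rate cθ n K)
              (fun _ => rate cθ n K) W init (fun i k => ξf i k ω) (fun i k => ξg i k ω) k).mean)
            (A * seBound n K (connectivity hW)
              (initialError P γ μ₀ Flow init + δf ^ 2 + δg ^ 2) δf δg σf σg)) ∧
      (∀ K : ℕ, 0 < K → rate cθ n K ≤ lbar * (1 - connectivity hW) ^ 4 →
          LateStationary Pr P γ μ₀ p K
            (fun k ω => (gtIter P γ (penalty μ₀ p) (fun _ => cl * rate cθ n K)
              (fun _ => rate cθ n K) W init (fun i k => ξf i k ω) (fun i k => ξg i k ω) k).mean)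
            (A * gtBound n K (connectivity hW)
              (initialError P γ μ₀ Flow init
                + ∫ ω, (initialTracker P γ μ₀ W init (fun i => ξf i 0 ω)
                    (fun i => ξg i 0 ω)).disagreement ∂Pr
                + δf ^ 2 + δg ^ 2) δf δg)) := by
  have hγL' : γ * (2 * L₂) < 1 := (lt_div_iff₀ (by positivity)).mp hγL
  have hgap : 0 < 1 / γ - L₂ := by
    rw [sub_pos, lt_div_iff₀ hγ]
    nlinarith
  -- The squared ratio of the monotonicity and Lipschitz constants of the θ-gradient, halved:
  -- precisely what absorbs c‖e‖² in `landscape`.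
  refine ⟨(1 / γ - L₂) ^ 2 / (2 * (L₂ + 1 / γ) ^ 2), by positivity, ?_⟩
  intro L₁ μ₀ p cl hL₁ hμ₀ hp hp4 hcl hclb
  have hκ : 0 < ascentConst L₂ γ cl := lt_min hcl (by positivity)
  have hgrad : 0 < gradConst L₂ γ cl := Regular.gradConst_pos
  have hsm : 0 ≤ smoothConst L₁ L₂ γ μ₀ := by unfold smoothConst; positivity
  have hbias : 0 ≤ biasConst L₁ L₂ γ μ₀ cl := by unfold biasConst; positivity
  have htr : 0 ≤ trackConst L₁ L₂ γ μ₀ cl := by unfold trackConst; positivity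
  -- One threshold serves both methods; none of the four restrictions involves cθ.
  obtain ⟨lbar, hl0, hl1, hlC, hlℓ, hlq, hlM⟩ := exists_small
    (16 * smoothConst L₁ L₂ γ μ₀ * gradConst L₂ γ cl)
    (16 * lipConst L₁ L₂ γ μ₀ cl ^ 2)
    (4 * (trackConst L₁ L₂ γ μ₀ cl * (1 + 4 * lipConst L₁ L₂ γ μ₀ cl ^ 2)))
    (64 * (biasConst L₁ L₂ γ μ₀ cl * trackConst L₁ L₂ γ μ₀ cl * gradConst L₂ γ cl)) hκ
    (by positivity) (by positivity) (by positivity) (by positivity)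
  refine ⟨lbar, hl0, fun cθ hcθ => ?_⟩
  -- The maximum covers both bounds, and the entry 1 makes positivity immediate.
  refine ⟨max 1 (max (seConst L₁ L₂ γ μ₀ cl cθ) (gtConst L₁ L₂ γ μ₀ cl cθ)),
    lt_max_of_lt_left one_pos, ?_⟩
  intro n dx dy hn Sf Sg Ω _ _ _ Pr _ P Flow δf δg ξf ξg W hW init hFlow hsmooth hf hg hs hds hρ
  have h : Regular P Flow L₁ L₂ γ μ₀ p cl :=
    ⟨hn, hL₁, hL₂, hγ, hγL, hμ₀, hp, by linarith, hcl, hclb, hFlow, hsmooth⟩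
  refine ⟨⟨h.isMinOn_thetaStar, fun m z => (h.hasGradientAt_Psi m z).differentiableAt⟩, ?_, ?_⟩
  · intro σf σg hσ K hK hrate
    exact h.se_lateStationary hf hg hs hW hds hρ hσ hK hcθ hl1 hlC hlℓ hrate
      ((le_max_left _ _).trans (le_max_right _ _))
  · intro K hK hrate
    exact h.gt_lateStationary hf hg hs hW hds hρ hK hcθ hl1 hlC hlq hlM hrate
      ((le_max_right _ _).trans (le_max_right _ _))
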